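/- **Theorem (deterministic maximal matching in CONGEST).** Consider the synchronous $\mathsf{CONGEST}$ model on an undirected simple graph $G=(V,E)$ with $n$ nodes and maximum degree $\Delta$. Each node $v$ addresses its incident edges by ports numbered $0,\dots,\deg(v)-1$ in an arbitrary way. Initially it knows only its own unique identifier and upper bounds $N\ge n$ and $D\ge\Delta$ that are common to all nodes (for instance $N=n$ and $D=\Delta$). In each round a node sends one $B$-bit message through each of its ports, possibly different messages through different ports, and receives the messages of its neighbors; local computation is unrestricted. For every $c\in\mathbb{N}$ there is a constant $C$, depending only on $c$, such that for all $N$ and $D$ there is a deterministic $\mathsf{CONGEST}$ algorithm with message size $B\le C\log_2 N$ that runs for at most $$C\cdot\log_2^2 D\cdot\log_2 N+1$$ rounds (where $\log_2 0$ is read as $0$), and that computes an inclusion-maximal matching in every graph with $n\le N$ and $\Delta\le D$, for every port numbering and every assignment of unique identifiers from $\{0,\dots,N^c-1\}$: at the end every node knows whether it is matched and, if so, which of its incident edges is its matching edge. In particular, given $n$ and $\Delta$, a maximal matching in an $n$-node graph of maximum degree $\Delta\geq 2$ can be computed deterministically in $O(\log^2\Delta\cdot\log n)$ rounds in the $\mathsf{CONGEST}$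 model; for $\Delta\le 1$ one round suffices. -/

import Mathlib

/-- A port numbering of `G`: every node `v` addresses its incident edges by the numbers
`0, …, deg v - 1`; `nbr v p` is the neighbour that `v` reaches through its port `p`. -/
structure PortNumbering {V : Type} [Fintype V] (G : SimpleGraph V) [DecidableRel G.Adj] where
  nbr : ∀ v : V, Fin (G.degree v) ≃ G.neighborSet v

namespace PortNumbering

variable {V : Type} [Fintype V] {G : SimpleGraph V} [DecidableRel G.Adj]

/-- The port by which the neighbour of `v` at port `p` addresses `v`. -/
def backPort (P : PortNumbering G) (v : V) (p : Fin (G.degree v)) :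
    Fin (G.degree (P.nbr v p : V)) :=
  (P.nbr (P.nbr v p : V)).symm ⟨v, SimpleGraph.Adj.symm (P.nbr v p).2⟩

end PortNumbering

/-- A deterministic synchronous message-passing algorithm in which every message has `B` bits.
All nodes run the same algorithm, local computation is unrestricted, and a node starts with
nothing but its own identifier. -/
structure CongestAlgorithm (B : ℕ) where
  /-- the local states of a node -/
  State : Type
  /-- the initial state of a node, a function of its identifier only -/
  init : ℕ → State
  /-- the message that a node in the given state sends through the given port -/
  send : State → ℕ → (Fin B → Bool)
  /-- the new state of a node of degree `d` that was in the given state and has received one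
  message through each of its `d` ports -/
  receive : State → (d : ℕ) → (Fin d → (Fin B → Bool)) → State
  /-- the output of a node for the matching problem: the port of its matching edge, or `none`
  if the node is unmatched -/
  output : State → Option ℕ

namespace CongestAlgorithm

variable {B : ℕ} {V : Type} [Fintype V] {G : SimpleGraph V} [DecidableRel G.Adj]

/-- The state of node `v` after `t` synchronous rounds on the network `G`, with port numbering
`P` and identifiers `ident`. -/
def stateAfter (A : CongestAlgorithm B) (P : PortNumbering G) (ident : V → ℕ) :
    ℕ → V → A.State
  | 0, v => A.init (ident v)
  | t + 1, v =>
      A.receive (A.stateAfter P ident t v) (G.degree v) fun p =>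
        A.send (A.stateAfter P ident t (P.nbr v p)) (P.backPort v p)

/-- After `T` rounds the outputs of the nodes describe an inclusion-maximal matching `M` of `G`:
every node knows which of its incident edges, if any, belongs to `M`. -/
def ComputesMaximalMatching (A : CongestAlgorithm B) (T : ℕ) (P : PortNumbering G)
    (ident : V → ℕ) : Prop :=
  ∃ M : G.Subgraph, Maximal SimpleGraph.Subgraph.IsMatching M ∧
    ∀ (v : V) (p : ℕ), A.output (A.stateAfter P ident T v) = some p ↔
      ∃ h : p < G.degree v, M.Adj v (P.nbr v ⟨p, h⟩)

end CongestAlgorithm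

/-! The algorithm runs O(log N) phases of O(m²) rounds, where `D ≤ 2 ^ m`. In a phase, the newly
matched nodes amount to at least a 1/32 fraction of the nodes covered by any matching of the nodes
that were free before (`phase`). A matching of the nodes still free, together with the new edges, is
again a matching of the previously free nodes; hence the bound on such matchings drops by the factor
31/32 (`shrink`), and after O(log N) phases no edge between free nodes remains.

A phase starts from a fractional matching with values in multiples of `2 ^ (-m)` in which every free
edge has an end of load above 1/2 (`fractional_matching`). Read row `v` of the array as up to `2 ^
m` units that `v` may propose along; the aim is to reduce every row to one unit while a number of
nodes proportional to the total value still receive a proposal. The quality is measured by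
`potential`, the sum over the receivers of `2 q S` minus the products of the proposals of distinct
senders, a second-moment bound on the number of nodes reached.

The row sums are halved `m` times by keeping one half of each row and doubling it (`halve`). The
potential is quadratic without diagonal terms, so for a node that moves alone one of the two halves
does not decrease it, and nodes that move simultaneously lose at most the weight of the pairs among
them (`potential_le_of_ascent`). The nodes move by the classes of a colouring with O(m) colours in
which monochromatic pairs carry at most a `1 / (2 m)` fraction of the pair weight
(`defective_coloring`). Pruning beforehand makes the pair weight at most the potential (`prune`,
`pairs_le_potential`). So a halving takes O(m) rounds and loses a factor `1 - 1 / (2 m)`, which is a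
constant factor over all halvings (`round_proposals`).

The colourings come from polynomial hash functions, derandomized by conditional expectations. The
sums over nodes at distance two that this needs are computed in two rounds by the common neighbours
(`oracle_pair`).

Finally every node accepts one proposal. Accepted arcs have in- and outdegree at most one; a proper
colouring with O(m) bits splits them into O(m) matchings, which are added greedily (`resolve`). -/

open Finset

/-! ### Networks, and port arrays as functions on pairs of nodes -/

/-- A network with at most `N` nodes of degree at most `D`. -/
structure Net (N D : ℕ) where
  V : Type
  [fintype : Fintype V]
  [decEq : DecidableEq V]
  G : SimpleGraph V
  [decAdj : DecidableRel G.Adj]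
  P : PortNumbering G
  card_le : Fintype.card V ≤ N
  degree_le : ∀ v, G.degree v ≤ D

attribute [instance] Net.fintype Net.decEq Net.decAdj

namespace Net

variable {N D : ℕ} (net : Net N D)

/-- The port array `σ` of every node lists the values of `a` at the neighbours. -/
def Reads {X : Type} (σ : net.V → ℕ → X) (a : net.V → net.V → X) : Prop :=
  ∀ (v : net.V) (p : Fin (net.G.degree v)), σ v p = a v (net.P.nbr v p)

variable {net}

theorem nbr_backPort (v : net.V) (p : Fin (net.G.degree v)) :
    (net.P.nbr (net.P.nbr v p : net.V) (net.P.backPort v p) : net.V) = v := by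
  simp [PortNumbering.backPort]

theorem adj_nbr (v : net.V) (p : Fin (net.G.degree v)) : net.G.Adj v (net.P.nbr v p) :=
  (net.P.nbr v p).2

theorem exists_port {v w : net.V} (h : net.G.Adj v w) :
    ∃ p : Fin (net.G.degree v), (net.P.nbr v p : net.V) = w :=
  ⟨(net.P.nbr v).symm ⟨w, h⟩, by simp⟩

theorem nbr_inj {v : net.V} {p q : Fin (net.G.degree v)}
    (h : (net.P.nbr v p : net.V) = net.P.nbr v q) : p = q :=
  (net.P.nbr v).injective (Subtype.ext h)

/-- Allows locally computed arrays to be handled as functions of two nodes. The default value off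
the edges (zero for multiplicities) lets sums over neighbours be extended to all nodes. -/
theorem exists_reads {X : Type} [Inhabited X] (σ : net.V → ℕ → X) :
    ∃ a : net.V → net.V → X, net.Reads σ a ∧ ∀ v w, ¬ net.G.Adj v w → a v w = default := by
  classical
  refine ⟨fun v w => if h : net.G.Adj v w then σ v ((net.P.nbr v).symm ⟨w, h⟩) else default,
    fun v p => ?_, fun v w h => by simp [h]⟩
  have h := adj_nbr v p
  have e : (⟨(net.P.nbr v p : net.V), h⟩ : net.G.neighborSet v) = net.P.nbr v p := rfl
  simp only [h, dite_true]
  rw [e, Equiv.symm_apply_apply]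

theorem Reads.map₂ {X Y Z : Type} {σ : net.V → ℕ → X} {τ : net.V → ℕ → Y}
    {a : net.V → net.V → X} {b : net.V → net.V → Y} (h : net.Reads σ a) (h' : net.Reads τ b)
    (F : net.V → X → Y → Z) :
    net.Reads (fun v p => F v (σ v p) (τ v p)) (fun v w => F v (a v w) (b v w)) := by
  intro v p
  simp only [h v p, h' v p]

theorem Reads.map {X Z : Type} {σ : net.V → ℕ → X}
    {a : net.V → net.V → X} (h : net.Reads σ a) (F : net.V → X → Z) :
    net.Reads (fun v p => F v (σ v p)) (fun v w => F v (a v w)) := by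
  intro v p
  simp only [h v p]

theorem sum_nbr {M : Type} [AddCommMonoid M] (v : net.V) (f : net.V → M) :
    ∑ p : Fin (net.G.degree v), f (net.P.nbr v p) = ∑ w ∈ net.G.neighborFinset v, f w := by
  rw [Finset.sum_bij (fun p _ => (net.P.nbr v p : net.V))]
  · intro p _
    simpa using adj_nbr v p
  · intro p _ q _ h
    exact nbr_inj h
  · intro w hw
    obtain ⟨p, hp⟩ := exists_port (net := net) (by simpa using hw)
    exact ⟨p, mem_univ _, hp⟩
  · intros; rfl

theorem sum_nbr_erase {M : Type} [AddCommMonoid M] (v : net.V) (q : Fin (net.G.degree v))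
    (f : net.V → M) :
    ∑ p ∈ univ.erase q, f (net.P.nbr v p) =
      ∑ w ∈ (net.G.neighborFinset v).erase (net.P.nbr v q), f w := by
  rw [Finset.sum_bij (fun p _ => (net.P.nbr v p : net.V))]
  · intro p hp
    simp only [mem_erase, mem_univ, and_true] at hp
    simp only [mem_erase, SimpleGraph.mem_neighborFinset]
    exact ⟨fun h => hp (nbr_inj h), adj_nbr v p⟩
  · intro p _ q _ h
    exact nbr_inj h
  · intro w hw
    simp only [mem_erase, SimpleGraph.mem_neighborFinset] at hw
    obtain ⟨p, hp⟩ := exists_port (net := net) hw.2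
    refine ⟨p, ?_, hp⟩
    simp only [mem_erase, mem_univ, and_true]
    rintro rfl
    exact hw.1 hp.symm
  · intros; rfl

/-- A sum over ports, extended to all port numbers below the degree. -/
theorem Reads.sum {X M : Type} [AddCommMonoid M] {σ : net.V → ℕ → X} {a : net.V → net.V → X}
    (h : net.Reads σ a) (v : net.V) (F : X → M) :
    ∑ p ∈ range (net.G.degree v), F (σ v p) = ∑ w ∈ net.G.neighborFinset v, F (a v w) := by
  rw [← sum_nbr, Finset.sum_range]
  exact sum_congr rfl fun p _ => by rw [h v p]

theorem Reads.sum_erase {X M : Type} [AddCommMonoid M] {σ : net.V → ℕ → X}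
    {a : net.V → net.V → X}
    (h : net.Reads σ a) (v : net.V) (q : Fin (net.G.degree v)) (F : X → M) :
    ∑ p ∈ (range (net.G.degree v)).erase q, F (σ v p) =
      ∑ w ∈ (net.G.neighborFinset v).erase (net.P.nbr v q), F (a v w) := by
  rw [← sum_nbr_erase]
  symm
  refine Finset.sum_bij (fun p _ => (p : ℕ)) ?_ ?_ ?_ ?_
  · intro p hp
    simp only [mem_erase, mem_univ, and_true, mem_range, ne_eq] at hp ⊢
    exact ⟨fun h => hp (Fin.ext h), p.2⟩
  · intro p _ q _ h
    exact Fin.ext h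
  · intro w hw
    simp only [mem_erase, mem_range, ne_eq] at hw
    refine ⟨⟨w, hw.2⟩, ?_, rfl⟩
    simp only [mem_erase, mem_univ, and_true, ne_eq]
    exact fun h => hw.1 (congrArg Fin.val h)
  · intro p _
    rw [h v p]

end Net

/-! ### Protocols and their composition -/

/-- A message-passing protocol that turns an input of type `S` at every node into an output of
type `S'`. -/
structure Proto (B : ℕ) (S S' : Type) where
  State : Type
  load : S → State
  send : State → ℕ → (Fin B → Bool)
  receive : State → (d : ℕ) → (Fin d → (Fin B → Bool)) → State
  unload : State → S'

namespace Proto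

variable {N D B : ℕ} {S S' S'' : Type}

/-- One synchronous round. -/
def step (A : Proto B S S') (net : Net N D) (σ : net.V → A.State) : net.V → A.State := fun v =>
  A.receive (σ v) (net.G.degree v) fun p => A.send (σ (net.P.nbr v p)) (net.P.backPort v p)

/-- The output after `T` rounds. -/
def run (A : Proto B S S') (T : ℕ) (net : Net N D) (σ : net.V → S) : net.V → S' := fun v =>
  A.unload ((A.step net)^[T] (fun u => A.load (σ u)) v)

section comp

variable (A : Proto B S S') (A' : Proto B S' S'')

/-- The state of a sequential composition when `k` rounds of the first protocol are left. -/
def seqState (k : ℕ) (s : A.State) : (ℕ × A.State) ⊕ A'.State :=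
  -- The switch happens inside the reception that ends the last round of the first protocol, or
  -- already at loading when `k = 0`, so composing costs no extra round.
  if k = 0 then Sum.inr (A'.load (A.unload s)) else Sum.inl (k, s)

/-- Sequential composition: `T` rounds of `A`, then `A'`. -/
def seq (T : ℕ) : Proto B S S'' where
  State := (ℕ × A.State) ⊕ A'.State
  load s := A.seqState A' T (A.load s)
  send := Sum.elim (fun s => A.send s.2) A'.send
  receive := Sum.elim (fun s d ms => A.seqState A' (s.1 - 1) (A.receive s.2 d ms))
    (fun s d ms => Sum.inr (A'.receive s d ms))
  unload := Sum.elim (fun s => A'.unload (A'.load (A.unload s.2))) A'.unload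

theorem seq_step_inl (T k : ℕ) (net : Net N D) (σ : net.V → A.State) :
    (A.seq A' T).step net (fun v => A.seqState A' (k + 1) (σ v)) =
      fun v => A.seqState A' k (A.step net σ v) := by
  funext v
  simp [step, seq, seqState]

theorem seq_iterate_inr (T n : ℕ) (net : Net N D) (σ : net.V → A'.State) :
    ((A.seq A' T).step net)^[n] (fun v => Sum.inr (σ v)) =
      fun v => Sum.inr ((A'.step net)^[n] σ v) := by
  induction n generalizing σ with
  | zero => rfl
  | succ n ih => exact ih (A'.step net σ)

theorem seq_iterate_inl (T k : ℕ) (net : Net N D) (σ : net.V → A.State) :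
    ((A.seq A' T).step net)^[k] (fun v => A.seqState A' k (σ v)) =
      fun v => Sum.inr (A'.load (A.unload ((A.step net)^[k] σ v))) := by
  induction k generalizing σ with
  | zero => rfl
  | succ k ih => 
    exact (congrArg (((A.seq A' T).step net)^[k]) (A.seq_step_inl A' T k net σ)).trans
      (ih (A.step net σ))

theorem seq_run (T T' : ℕ) (net : Net N D) (σ : net.V → S) :
    (A.seq A' T).run (T' + T) net σ = A'.run T' net (A.run T net σ) := by
  funext v
  unfold run
  rw [Function.iterate_add_apply]
  have := A.seq_iterate_inl A' T T net (fun u => A.load (σ u))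
  change (A.seq A' T).unload (((A.seq A' T).step net)^[T'] (((A.seq A' T).step net)^[T]
    (fun v => A.seqState A' T (A.load (σ v)))) v) = _
  rw [this, seq_iterate_inr]
  rfl

end comp

/-- Pre- and post-processing, which keeps the input of the whole computation. -/
def frame {X Y : Type} (A : Proto B S S') (g : X → S) (h : X → S' → Y) : Proto B X Y where
  State := X × A.State
  load x := (x, A.load (g x))
  send s := A.send s.2
  receive s d ms := (s.1, A.receive s.2 d ms)
  unload s := h s.1 (A.unload s.2)

theorem frame_run {X Y : Type} (A : Proto B S S') (g : X → S) (h : X → S' → Y) (T : ℕ)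
    (net : Net N D) (σ : net.V → X) :
    (A.frame g h).run T net σ = fun v => h (σ v) (A.run T net (fun u => g (σ u)) v) := by
  have key : ∀ (ρ : net.V → A.State), ((A.frame g h).step net)^[T] (fun u => (σ u, ρ u)) =
      fun u => (σ u, (A.step net)^[T] ρ u) := by
    induction T with
    | zero => intro ρ; rfl
    | succ T ih => exact fun ρ => ih (A.step net ρ)
  funext v
  unfold run
  change (A.frame g h).unload (((A.frame g h).step net)^[T]
    (fun u => (σ u, A.load (g (σ u)))) v) = _
  rw [key]
  rfl

/-- Messages are natural numbers below `2 ^ B`. -/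
noncomputable def bitsEquiv (B : ℕ) : (Fin B → Bool) ≃ Fin (2 ^ B) :=
  Fintype.equivFinOfCardEq (by simp)

noncomputable def encode (B n : ℕ) : Fin B → Bool :=
  (bitsEquiv B).symm ⟨n % 2 ^ B, Nat.mod_lt _ (by positivity)⟩

noncomputable def decode {B : ℕ} (f : Fin B → Bool) : ℕ := bitsEquiv B f

theorem decode_encode {B n : ℕ} (h : n < 2 ^ B) : decode (encode B n) = n := by
  simp [decode, encode, Nat.mod_eq_of_lt h]

/-- A single round. -/
noncomputable def single (B : ℕ) (snd : S → ℕ → ℕ) (rcv : S → ℕ → (ℕ → ℕ) → S') :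
    Proto B S S' where
  State := S ⊕ S'
  load := Sum.inl
  send := Sum.elim (fun s p => encode B (snd s p)) (fun _ _ _ => false)
  receive := Sum.elim
    (fun s d ms => Sum.inr (rcv s d fun p => if h : p < d then decode (ms ⟨p, h⟩) else 0))
    (fun s _ _ => Sum.inr s)
  unload := Sum.elim (fun s => rcv s 0 fun _ => 0) id

end Proto

/-! ### Calculus of relational specifications with round bounds -/

/-- Some `B`-bit protocol computes, within `T` rounds, outputs that are related to the inputs
by `R` on all networks. -/
def Computes (N D B T : ℕ) {S S' : Type}
    (R : ∀ net : Net N D, (net.V → S) → (net.V → S') → Prop) : Prop :=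
  ∃ A : Proto B S S', ∃ T' ≤ T, ∀ (net : Net N D) (σ : net.V → S), R net σ (A.run T' net σ)

namespace Computes

variable {N D B T T' : ℕ} {S S' S'' : Type}
  {R : ∀ net : Net N D, (net.V → S) → (net.V → S') → Prop}

theorem mono (h : Computes N D B T R) (hT : T ≤ T')
    {R' : ∀ net : Net N D, (net.V → S) → (net.V → S') → Prop}
    (hR : ∀ net σ τ, R net σ τ → R' net σ τ) : Computes N D B T' R' := by
  obtain ⟨A, t, ht, h⟩ := h
  exact ⟨A, t, ht.trans hT, fun net σ => hR _ _ _ (h net σ)⟩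

theorem comp {R' : ∀ net : Net N D, (net.V → S') → (net.V → S'') → Prop}
    (h : Computes N D B T R) (h' : Computes N D B T' R') :
    Computes N D B (T + T') (fun net σ ρ => ∃ τ, R net σ τ ∧ R' net τ ρ) := by
  obtain ⟨A, t, ht, h⟩ := h
  obtain ⟨A', t', ht', h'⟩ := h'
  refine ⟨A.seq A' t, t' + t, by omega, fun net σ => ⟨_, h net σ, ?_⟩⟩
  rw [Proto.seq_run]
  exact h' _ _

theorem frame {X Y : Type} (h : Computes N D B T R) (g : X → S) (k : X → S' → Y) :
    Computes N D B T (fun net (σ : net.V → X) (τ : net.V → Y) =>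
      ∃ ρ, R net (fun v => g (σ v)) ρ ∧ ∀ v, τ v = k (σ v) (ρ v)) := by
  obtain ⟨A, t, ht, h⟩ := h
  refine ⟨A.frame g k, t, ht, fun net σ => ⟨_, h net _, fun v => ?_⟩⟩
  rw [Proto.frame_run]

/-- Local computation takes no rounds. -/
theorem pure (N D B : ℕ) (f : S → S') :
    Computes N D B 0 (fun net (σ : net.V → S) (τ : net.V → S') => ∀ v, τ v = f (σ v)) :=
  ⟨⟨S, id, fun _ _ _ => false, fun s _ _ => s, f⟩, 0, le_rfl, fun _ _ _ => rfl⟩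

/-- Exchange of one message with every neighbour. -/
theorem round (N D B : ℕ) (snd : S → ℕ → ℕ) (rcv : S → ℕ → (ℕ → ℕ) → S') :
    Computes N D B 1 (fun net (σ : net.V → S) (τ : net.V → S') =>
      ∀ a : net.V → net.V → ℕ, net.Reads (fun v => snd (σ v)) a →
        (∀ v w, net.G.Adj v w → a v w < 2 ^ B) →
        ∃ r : net.V → ℕ → ℕ, net.Reads r (fun v w => a w v) ∧
          ∀ v, τ v = rcv (σ v) (net.G.degree v) (r v)) := by
  refine ⟨Proto.single B snd rcv, 1, le_rfl, fun net σ a ha hb => ?_⟩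
  refine ⟨fun v p => if h : p < net.G.degree v then
    Proto.decode (Proto.encode B (snd (σ (net.P.nbr v ⟨p, h⟩)) (net.P.backPort v ⟨p, h⟩))) else 0,
    fun v p => ?_, fun v => rfl⟩
  simp only [p.2, dite_true]
  have := ha (net.P.nbr v p) (net.P.backPort v p)
  rw [Net.nbr_backPort] at this
  dsimp only at this
  rw [this, Proto.decode_encode]
  exact hb _ _ (Net.adj_nbr v p).symm

/-- Iteration, with a relation between the initial and the current configuration. -/
theorem loop (I : ℕ → ∀ net : Net N D, (net.V → S) → (net.V → S) → Prop) (n : ℕ)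
    (h0 : ∀ net σ, I 0 net σ σ)
    (Q : ℕ → ∀ net : Net N D, (net.V → S) → (net.V → S) → Prop)
    (hQ : ∀ i < n, Computes N D B T (Q i))
    (hs : ∀ i < n, ∀ net σ τ ρ, I i net σ τ → Q i net τ ρ → I (i + 1) net σ ρ) :
    Computes N D B (n * T) (I n) := by
  induction n with
  | zero =>
    refine (Computes.pure N D B (id : S → S)).mono (by simp) fun net σ τ h => ?_
    obtain rfl : τ = σ := funext h
    exact h0 _ _
  | succ n ih =>
    refine ((ih (fun i hi => hQ i (by omega)) (fun i hi => hs i (by omega))).comp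
      (hQ n (by omega))).mono (by rw [Nat.succ_mul]) ?_
    rintro net σ ρ ⟨τ, h1, h2⟩
    exact hs n (by omega) _ _ _ _ h1 h2

end Computes

/-! ### Weighted sums over pairs of nodes, for adjacency and for common targets -/

namespace Computes

variable {N D B : ℕ}

/-- Every node `w` adds up a function of the messages of the pairs of its neighbours: node `v`
learns from each neighbour `w` the sum over the other neighbours of `w`. -/
theorem pairSum (N D B : ℕ) (φ : ℕ → ℕ → ℕ) :
    Computes N D B 2 (fun net (σ : net.V → ℕ → ℕ) (τ : net.V → ℕ × (ℕ → ℕ)) =>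
      ∀ a : net.V → net.V → ℕ, net.Reads σ a → (∀ v w, net.G.Adj v w → a v w < 2 ^ B) →
        (∀ v w, net.G.Adj v w →
          ∑ v' ∈ (net.G.neighborFinset w).erase v, φ (a v w) (a v' w) < 2 ^ B) →
        (∀ v, (τ v).1 = net.G.degree v) ∧ net.Reads (fun v => (τ v).2)
          fun v w => ∑ v' ∈ (net.G.neighborFinset w).erase v, φ (a v w) (a v' w)) := by
  refine ((Computes.round N D B (fun (s : ℕ → ℕ) p => s p) fun _ d r => (d, r)).comp
    (Computes.round N D B (fun (s : ℕ × (ℕ → ℕ)) q =>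
      ∑ p ∈ (range s.1).erase q, φ (s.2 q) (s.2 p)) fun _ d r => (d, r))).mono le_rfl ?_
  rintro net σ τ ⟨ρ, h1, h2⟩ a ha hb hc
  obtain ⟨r, hr, h1⟩ := h1 a ha hb
  obtain ⟨r', hr', h2⟩ := h2
    (fun w v => ∑ v' ∈ (net.G.neighborFinset w).erase v, φ (a v w) (a v' w)) (fun v p => by
      simp only [h1]
      rw [hr.sum_erase v p (fun z => φ (r v p) z), hr v p])
    (fun v w h => hc w v h.symm)
  refine ⟨fun v => by rw [h2], fun v p => ?_⟩
  simp only [h2]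
  exact hr' v p

/-- The nodes can add up functions of the messages of pairs of nodes, weighted with the
weights `u`; these weights are encoded in the states as prescribed by `E`. -/
def Oracle (N D B T : ℕ) {S : Type}
    (E : ∀ net : Net N D, (net.V → S) → (net.V → net.V → ℕ) → Prop) (bm bs : ℕ) : Prop :=
  ∀ ψ : ℕ → ℕ → ℕ, (∀ m m', ψ m m' ≤ 2 ^ bs) →
    Computes N D B T (fun net (σ : net.V → S × ℕ) (τ : net.V → ℕ) =>
      ∀ u, E net (fun v => (σ v).1) u → (∀ v, (σ v).2 < 2 ^ bm) →
        ∀ v, τ v = ∑ v' ∈ univ.erase v, u v v' * ψ (σ v).2 (σ v').2)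

/-- Adjacency as a weight. -/
def AdjWeight (net : Net N D) (_ : net.V → Unit) (u : net.V → net.V → ℕ) : Prop :=
  u = fun v w => if net.G.Adj v w then 1 else 0

/-- One exchange suffices: the neighbours' messages arrive unchanged, and each node evaluates and
sums `ψ` itself. -/
theorem oracle_adj {bm : ℕ} (bs : ℕ) (hB : bm ≤ B) : Oracle N D B 1 AdjWeight bm bs := by
  intro ψ hψ
  refine (Computes.round N D B (fun (s : Unit × ℕ) _ => s.2)
    fun s d r => ∑ p ∈ range d, ψ s.2 (r p)).mono le_rfl ?_
  rintro net σ τ h u rfl hm v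
  obtain ⟨r, hr, h⟩ := h (fun v _ => (σ v).2) (fun _ _ => rfl)
    (fun v _ _ => (hm v).trans_le (Nat.pow_le_pow_right two_pos hB))
  rw [h, hr.sum v (fun z => ψ (σ v).2 z)]
  symm
  simp only [ite_mul, one_mul, zero_mul]
  rw [← sum_filter]
  refine sum_congr ?_ fun _ _ => rfl
  ext w
  simp only [mem_filter, mem_erase, mem_univ, SimpleGraph.mem_neighborFinset]
  exact ⟨fun h => h.2, fun h => ⟨⟨h.ne', trivial⟩, h⟩⟩

/-- The weight of a pair of nodes is the number of common targets, where the arc from `v` to `w`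
has multiplicity `x v w`. -/
def PairWeight (X : ℕ) (net : Net N D) (σ : net.V → ℕ → ℕ) (u : net.V → net.V → ℕ) : Prop :=
  ∃ x : net.V → net.V → ℕ, net.Reads σ x ∧ (∀ v w, ¬ net.G.Adj v w → x v w = 0) ∧
    (∀ v w, x v w ≤ 2 ^ X) ∧ u = fun v v' => ∑ w, x v w * x v' w

theorem sum_neighborFinset {net : Net N D} (v : net.V) (f : net.V → ℕ)
    (h : ∀ w, ¬ net.G.Adj v w → f w = 0) : ∑ w ∈ net.G.neighborFinset v, f w = ∑ w, f w := by
  refine sum_subset (subset_univ _) fun w _ hw => h w ?_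
  simpa using hw

theorem sum_neighborFinset_erase {net : Net N D} (v w : net.V) (f : net.V → ℕ)
    (h : ∀ v', ¬ net.G.Adj w v' → f v' = 0) :
    ∑ v' ∈ (net.G.neighborFinset w).erase v, f v' = ∑ v' ∈ univ.erase v, f v' := by
  refine sum_subset (erase_subset_erase _ (subset_univ _)) fun v' h1 h2 => h v' ?_
  intro h3
  exact h2 (mem_erase.2 ⟨(mem_erase.1 h1).1, by simpa using h3⟩)

theorem sum_nbr_le {net : Net N D} (v w : net.V) (f : net.V → ℕ) {c m : ℕ} (hD : D ≤ 2 ^ m)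
    (hf : ∀ v', f v' ≤ 2 ^ c) :
    ∑ v' ∈ (net.G.neighborFinset w).erase v, f v' ≤ 2 ^ (m + c) := by
  calc _ ≤ ∑ v' ∈ net.G.neighborFinset w, f v' := sum_le_sum_of_subset (erase_subset _ _)
    _ ≤ (net.G.neighborFinset w).card • 2 ^ c := sum_le_card_nsmul _ _ _ fun v' _ => hf v'
    _ ≤ 2 ^ m * 2 ^ c := by
        rw [smul_eq_mul, SimpleGraph.card_neighborFinset_eq_degree]
        exact Nat.mul_le_mul_right _ ((net.degree_le w).trans hD)
    _ = _ := by rw [pow_add]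

/-- The target `w` knows all messages of its neighbours and returns to `v` the sum of `x v' w * ψ`
over the other `v'`; node `v` multiplies by `x v w`, adds over `w`, and an exchange of summation
gives the pair weights. A message on the way out packs a multiplicity (`X + 1` bits) with `bm` bits;
an answer is a sum of at most `2 ^ m` terms of size at most `2 ^ (X + bs)`. -/
theorem oracle_pair {m X bm bs : ℕ} (hD : D ≤ 2 ^ m) (h1 : X + 1 + bm ≤ B)
    (h2 : m + X + bs < B) : Oracle N D B 2 (PairWeight X) bm bs := by
  intro ψ hψ
  refine ((pairSum N D B fun a a' => a' / 2 ^ bm * ψ (a % 2 ^ bm) (a' % 2 ^ bm)).frame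
    (fun (s : (ℕ → ℕ) × ℕ) p => s.1 p * 2 ^ bm + s.2)
    (fun s t => ∑ p ∈ range t.1, s.1 p * t.2 p)).mono le_rfl ?_
  rintro net σ τ ⟨ρ, hρ, hτ⟩ u ⟨x, hx, hx0, hX, rfl⟩ hm v
  have hpos : 0 < 2 ^ bm := by positivity
  have hdiv : ∀ v w, (x v w * 2 ^ bm + (σ v).2) / 2 ^ bm = x v w := fun v w => by
    rw [add_comm, Nat.add_mul_div_right _ _ hpos, Nat.div_eq_of_lt (hm v), zero_add]
  have hmod : ∀ v w, (x v w * 2 ^ bm + (σ v).2) % 2 ^ bm = (σ v).2 := fun v w => by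
    rw [add_comm, Nat.add_mul_mod_self_right, Nat.mod_eq_of_lt (hm v)]
  obtain ⟨hd, hr⟩ := hρ (fun v w => x v w * 2 ^ bm + (σ v).2)
    (hx.map fun v z => z * 2 ^ bm + (σ v).2) (fun v w _ => by
      have : x v w * 2 ^ bm + (σ v).2 < (2 ^ X + 1) * 2 ^ bm := by
        have := Nat.mul_le_mul_right (2 ^ bm) (hX v w)
        have := hm v
        linarith
      refine this.trans_le (le_trans (Nat.mul_le_mul_right _ ?_)
        ((pow_add 2 (X + 1) bm).symm.le.trans (Nat.pow_le_pow_right two_pos h1)))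
      rw [pow_succ]
      have := Nat.one_le_two_pow (n := X)
      omega) (fun v w _ => by
      simp only [hdiv, hmod]
      refine (sum_nbr_le v w _ hD (c := X + bs) fun v' => ?_).trans_lt
        (Nat.pow_lt_pow_right one_lt_two (by omega))
      rw [pow_add]
      exact Nat.mul_le_mul (hX _ _) (hψ _ _))
  simp only [hdiv, hmod] at hr
  rw [hτ, hd]
  have := (hx.map₂ hr (fun _ a b => a * b)).sum v id
  simp only [id] at this
  rw [this]
  rw [sum_neighborFinset v _ (fun w h => by rw [hx0 v w h, zero_mul])]
  simp_rw [sum_mul]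
  rw [sum_comm]
  refine sum_congr rfl fun w _ => ?_
  rw [sum_neighborFinset_erase v w _ (fun v' h => by
    rw [hx0 v' w (fun h' => h h'.symm), zero_mul]), mul_sum]
  exact sum_congr rfl fun _ _ => by ring

end Computes

/-! ### Hash functions from polynomials over a prime field -/

theorem card_filter_eval_le {p n : ℕ} [Fact p.Prime] (hn : n ≤ p) {q : Polynomial (ZMod p)}
    (hq : q ≠ 0) : #{x ∈ range n | q.eval ((x : ℕ) : ZMod p) = 0} ≤ q.natDegree := by
  classical
  refine le_trans ?_ ((Multiset.toFinset_card_le _).trans q.card_roots')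
  refine card_le_card_of_injOn (fun x : ℕ => (x : ZMod p)) ?_ ?_
  · intro x hx
    simp only [coe_filter, mem_range, Set.mem_ofPred_eq] at hx
    simp [hq, hx.2]
  · intro x hx y hy h
    simp only [coe_filter, mem_range, Set.mem_ofPred_eq] at hx hy
    have := (ZMod.natCast_eq_natCast_iff' x y p).1 h
    rwa [Nat.mod_eq_of_lt (by omega), Nat.mod_eq_of_lt (by omega)] at this

/-- Monic polynomials of degree `d` over the field with `p` elements as hash functions: two of
them agree at fewer than `d` points, and each takes every value at most `d` times. -/
theorem exists_hash {p d K n : ℕ} (hp : p.Prime) (hd : 1 ≤ d) (hK : K ≤ p ^ d) (hn : n ≤ p) :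
    ∃ h : ℕ → ℕ → ℕ, (∀ k x, h k x < p) ∧
      (∀ k < K, ∀ k' < K, k ≠ k' → #{x ∈ range n | h k x = h k' x} ≤ d - 1) ∧
      ∀ k y, #{x ∈ range n | h k x = y} ≤ d := by
  classical
  have : Fact p.Prime := ⟨hp⟩
  have hcard : Fintype.card (Fin K) ≤ Fintype.card (Fin d → ZMod p) := by
    simpa [ZMod.card] using hK
  obtain ⟨e⟩ := Function.Embedding.nonempty_of_card_le hcard
  let e' := (Polynomial.degreeLTEquiv (ZMod p) d).symm
  let r : ℕ → Polynomial (ZMod p) := fun k => if hk : k < K then (e' (e ⟨k, hk⟩) : _) else 0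
  have hr : ∀ k, (r k).degree < d := by
    intro k
    by_cases hk : k < K
    · simp only [r, hk, dite_true]
      exact Polynomial.mem_degreeLT.1 (e' (e ⟨k, hk⟩)).2
    · simp only [r, hk, dite_false, Polynomial.degree_zero]
      exact WithBot.bot_lt_coe d
  have hinj : ∀ k < K, ∀ k' < K, r k = r k' → k = k' := by
    intro k hk k' hk' h
    simp only [r, hk, hk', dite_true] at h
    have := e.injective (e'.injective (Subtype.ext h))
    simpa using this
  -- The leading term `X ^ d` makes every hash function nonconstant, as the bound on preimages
  -- requires; it cancels in differences, whose degree therefore stays below `d`.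
  refine ⟨fun k x => ((Polynomial.X ^ d + r k).eval ((x : ℕ) : ZMod p)).val,
    fun k x => ZMod.val_lt _, fun k hk k' hk' hne => ?_, fun k y => ?_⟩
  · have h0 : r k - r k' ≠ 0 := fun h => hne (hinj k hk k' hk' (sub_eq_zero.1 h))
    have hdeg : (r k - r k').natDegree ≤ d - 1 := by
      have := (Polynomial.natDegree_lt_iff_degree_lt h0).2
        ((Polynomial.degree_sub_le _ _).trans_lt (max_lt (hr k) (hr k')))
      omega
    refine le_trans (card_le_card fun x hx => ?_) ((card_filter_eval_le hn h0).trans hdeg)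
    simp only [mem_filter] at hx ⊢
    have := ZMod.val_injective p hx.2
    simp only [Polynomial.eval_add] at this
    exact ⟨hx.1, by simpa [sub_eq_zero] using this⟩
  · have hm : (Polynomial.X ^ d + (r k - Polynomial.C (y : ZMod p))).Monic := by
      refine Polynomial.monic_X_pow_add ((Polynomial.degree_sub_le _ _).trans_lt
        (max_lt (hr k) (Polynomial.degree_C_le.trans_lt ?_)))
      exact_mod_cast hd
    have hdeg : (Polynomial.X ^ d + (r k - Polynomial.C (y : ZMod p))).natDegree ≤ d := by
      refine Polynomial.natDegree_add_le_of_degree_le (by simp) ?_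
      refine Polynomial.natDegree_le_of_degree_le (le_trans (Polynomial.degree_sub_le _ _)
        (max_le (hr k).le (Polynomial.degree_C_le.trans ?_)))
      exact_mod_cast Nat.zero_le d
    refine le_trans (card_le_card fun x hx => ?_) ((card_filter_eval_le hn hm.ne_zero).trans hdeg)
    simp only [mem_filter] at hx ⊢
    refine ⟨hx.1, ?_⟩
    have : (Polynomial.X ^ d + r k).eval ((x : ℕ) : ZMod p) = (y : ZMod p) := by
      rw [← hx.2, ZMod.natCast_zmod_val]
    simp only [Polynomial.eval_add] at this
    simp only [Polynomial.eval_add, Polynomial.eval_sub, Polynomial.eval_C, ← this]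
    ring

/-- Bertrand's postulate gives a prime between `2 ^ s` and `2 ^ (s + 1)`. Degree 6 then provides `2
^ (6 * s)` keys, and a random point out of `2 ^ s` is a collision with probability at most `5 / 2 ^
s`. -/
theorem exists_hash_two_pow (s : ℕ) :
    ∃ h : ℕ → ℕ → ℕ, (∀ k x, h k x < 2 ^ (s + 1)) ∧
      ∀ k < 2 ^ (6 * s), ∀ k' < 2 ^ (6 * s), k ≠ k' →
        #{x ∈ range (2 ^ s) | h k x = h k' x} ≤ 5 := by
  obtain ⟨p, hp, h1, h2⟩ := Nat.exists_prime_lt_and_le_two_mul (2 ^ s) (by positivity)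
  obtain ⟨h, ha, hb, -⟩ := exists_hash (p := p) (d := 6) (K := 2 ^ (6 * s)) (n := 2 ^ s) hp
    (by norm_num) (by rw [mul_comm, pow_mul]; exact Nat.pow_le_pow_left h1.le 6) h1.le
  exact ⟨h, fun k x => (ha k x).trans_le (by rw [pow_succ]; omega), hb⟩

/-! ### Halving the number of colour bits by conditional expectations -/

namespace Computes

variable {N D B To bm bs : ℕ} {S : Type}
  {E : ∀ net : Net N D, (net.V → S) → (net.V → net.V → ℕ) → Prop}

/-- The number of points in the `i`-bit interval `π` (of length `2 ^ (s - i)`) at which the hash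
functions of two different colours agree. -/
def collisions (h : ℕ → ℕ → ℕ) (L k k' π : ℕ) : ℕ :=
  if k = k' then 0 else #{x ∈ Ico (π * L) ((π + 1) * L) | h k x = h k' x}

theorem collisions_split (h : ℕ → ℕ → ℕ) (L k k' π : ℕ) :
    collisions h L k k' (2 * π) + collisions h L k k' (2 * π + 1) =
      collisions h (2 * L) k k' π := by
  unfold collisions
  split_ifs with hk
  · rfl
  · rw [← card_union_of_disjoint, ← filter_union]
    · congr 2
      ext x
      simp only [mem_union, mem_Ico]
      constructor
      · rintro (h | h) <;> constructor <;> nlinarith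
      · rintro ⟨h1, h2⟩
        by_cases hx : x < (2 * π + 1) * L
        · exact Or.inl ⟨by nlinarith, hx⟩
        · exact Or.inr ⟨by omega, by nlinarith⟩
    · refine disjoint_filter_filter ?_
      rw [disjoint_left]
      intro x h1 h2
      simp only [mem_Ico] at h1 h2
      omega

theorem collisions_le (h : ℕ → ℕ → ℕ) (L k k' π : ℕ) : collisions h L k k' π ≤ L := by
  unfold collisions
  split_ifs
  · exact Nat.zero_le _
  · refine (card_filter_le _ _).trans ?_
    rw [Nat.card_Ico, add_mul, one_mul, Nat.add_sub_cancel_left]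

/-- Reduction of colours with `6 s` bits to colours with `3 s` bits; at every node, the weight
of new monochromatic pairs is at most a `5 / 2 ^ s` fraction. -/
theorem reduce_colors (hO : Oracle N D B To E bm bs) {s : ℕ} (hs : 1 ≤ s) (hm : 7 * s ≤ bm)
    (hb : s ≤ bs) :
    Computes N D B (s * (To + To)) (fun net (σ : net.V → S × ℕ) (τ : net.V → ℕ) =>
      ∀ u, E net (fun v => (σ v).1) u → (∀ v, (σ v).2 < 2 ^ (6 * s)) →
        (∀ v, τ v < 2 ^ (3 * s)) ∧ ∀ v, 2 ^ s * (∑ v' ∈ univ.erase v,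
          if (σ v).2 ≠ (σ v').2 ∧ τ v = τ v' then u v v' else 0) ≤
            5 * ∑ v' ∈ univ.erase v, u v v') := by
  classical
  obtain ⟨h, hlt, hh⟩ := exists_hash_two_pow s
  -- A message packs a colour with the `s`-bit prefix of the point chosen so far. Of the other node
  -- only the colour enters, never its prefix: `v` minimizes the hash agreements over its own
  -- interval, whatever point `v'` selects. So all nodes fix their bits in parallel.
  let ψ : ℕ → ℕ → ℕ → ℕ → ℕ := fun i β m m' =>
    collisions h (2 ^ (s - (i + 1))) (m / 2 ^ s) (m' / 2 ^ s) (2 * (m % 2 ^ s) + β)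
  have hψ : ∀ i β m m', ψ i β m m' ≤ 2 ^ bs := fun i β m m' =>
    (collisions_le _ _ _ _ _).trans (Nat.pow_le_pow_right two_pos (by omega))
  let pack : (S × ℕ) × ℕ → S × ℕ := fun z => (z.1.1, z.1.2 * 2 ^ s + z.2)
  have key : ∀ i β, Computes N D B To (fun net (σ : net.V → (S × ℕ) × ℕ) (τ : net.V → ℕ) =>
      ∀ u, E net (fun v => (σ v).1.1) u → (∀ v, (σ v).1.2 < 2 ^ (6 * s)) →
        (∀ v, (σ v).2 < 2 ^ s) → ∀ v, τ v = ∑ v' ∈ univ.erase v, u v v' *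
          collisions h (2 ^ (s - (i + 1))) (σ v).1.2 (σ v').1.2 (2 * (σ v).2 + β)) := by
    intro i β
    refine ((hO (ψ i β) (hψ i β)).frame pack fun _ t => t).mono le_rfl ?_
    rintro net σ τ ⟨ρ, h1, h2⟩ u hu hκ hπ v
    rw [h2, h1 u hu ?_ v]
    · refine sum_congr rfl fun v' _ => ?_
      have e : ∀ v, ((pack (σ v)).2) / 2 ^ s = (σ v).1.2 ∧ (pack (σ v)).2 % 2 ^ s = (σ v).2 := by
        intro v
        have := hπ v
        simp only [pack]
        constructor
        · rw [add_comm, Nat.add_mul_div_right _ _ (by positivity), Nat.div_eq_of_lt this, zero_add]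
        · rw [add_comm, Nat.add_mul_mod_self_right, Nat.mod_eq_of_lt this]
      simp only [ψ, (e v).1, (e v).2, (e v').1]
    · intro v
      have h1 := hκ v
      have h2 := hπ v
      simp only [pack]
      refine lt_of_lt_of_le ?_ (Nat.pow_le_pow_right two_pos hm)
      rw [show 7 * s = 6 * s + s by ring, pow_add]
      nlinarith
  -- one bit of the point
  have body : ∀ i, Computes N D B (To + To) (fun net (σ τ : net.V → (S × ℕ) × ℕ) =>
      ∀ v, (τ v).1 = (σ v).1 ∧ ∀ u, E net (fun v => (σ v).1.1) u →
        (∀ v, (σ v).1.2 < 2 ^ (6 * s)) → (∀ v, (σ v).2 < 2 ^ s) →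
        (τ v).2 / 2 = (σ v).2 ∧
        2 * (∑ v' ∈ univ.erase v, u v v' *
          collisions h (2 ^ (s - (i + 1))) (σ v).1.2 (σ v').1.2 (τ v).2) ≤
        ∑ v' ∈ univ.erase v, u v v' *
          collisions h (2 * 2 ^ (s - (i + 1))) (σ v).1.2 (σ v').1.2 (σ v).2) := by
    intro i
    refine (((key i 0).frame (fun z => z) fun z c => (z, c)).comp
      ((key i 1).frame (fun z => z.1)
        fun z c => (z.1.1, if z.2 ≤ c then 2 * z.1.2 else 2 * z.1.2 + 1))).mono le_rfl ?_
    rintro net σ τ ⟨ρ, ⟨c0, h0, hρ⟩, c1, h1, hτ⟩ v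
    have hρ1 : ∀ v, (ρ v).1 = σ v := fun v => by rw [hρ]
    have hρ2 : ∀ v, (ρ v).2 = c0 v := fun v => by rw [hρ]
    simp only [hρ1] at h1
    refine ⟨by rw [hτ, hρ], fun u hu hκ hπ => ?_⟩
    have e0 := h0 u hu hκ hπ v
    have e1 := h1 u hu hκ hπ v
    rw [hτ, hρ1, hρ2]
    have e : (∑ v' ∈ univ.erase v, u v v' *
        collisions h (2 * 2 ^ (s - (i + 1))) (σ v).1.2 (σ v').1.2 (σ v).2) = c0 v + c1 v := by
      rw [e0, e1, ← sum_add_distrib]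
      refine sum_congr rfl fun v' _ => ?_
      rw [← mul_add, ← collisions_split]
      rfl
    rw [e]
    simp only [add_zero] at e0
    split_ifs with hc
    · dsimp only
      rw [← e0]
      constructor <;> omega
    · dsimp only
      rw [← e1]
      constructor <;> omega
  -- Always taking the better half of the interval at least halves the weight of collisions, so
  -- after `i` bits at most a `1 / 2 ^ i` fraction is left.
  have lp := Computes.loop (N := N) (D := D) (B := B) (T := To + To) (S := (S × ℕ) × ℕ)
    (fun i net σ τ => ∀ v, (τ v).1 = (σ v).1 ∧ ∀ u, E net (fun v => (σ v).1.1) u →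
        (∀ v, (σ v).1.2 < 2 ^ (6 * s)) → (∀ v, (σ v).2 = 0) →
        (τ v).2 < 2 ^ i ∧
        2 ^ i * (∑ v' ∈ univ.erase v, u v v' *
          collisions h (2 ^ (s - i)) (σ v).1.2 (σ v').1.2 (τ v).2) ≤
        ∑ v' ∈ univ.erase v, u v v' *
          collisions h (2 ^ s) (σ v).1.2 (σ v').1.2 0) s
    (fun net σ v => ⟨rfl, fun u _ _ h0 => by simp [h0]⟩) _ (fun i _ => body i) (by
      intro i hi net σ τ ρ h1 h2 v
      have hf : ∀ v, (τ v).1 = (σ v).1 := fun v => (h1 v).1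
      refine ⟨((h2 v).1).trans (hf v), fun u hu hκ hz => ?_⟩
      obtain ⟨h3, h4⟩ := (h1 v).2 u hu hκ hz
      obtain ⟨h5, h6⟩ := (h2 v).2 u (by simpa only [hf] using hu) (by simpa only [hf] using hκ)
        (fun v => ((h1 v).2 u hu hκ hz).1.trans_le (Nat.pow_le_pow_right two_pos hi.le))
      simp only [hf] at h6
      rw [← pow_succ', show s - (i + 1) + 1 = s - i by omega] at h6
      refine ⟨by rw [pow_succ]; omega, le_trans ?_ h4⟩
      rw [pow_succ, mul_assoc]
      exact Nat.mul_le_mul_left _ h6)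
  -- The new colour is the chosen point together with the hash value there, `2 * s + 1 ≤ 3 * s`
  -- bits. Equal new colours mean the same point and the same value, that is, a collision at the
  -- point chosen by `v`.
  refine (lp.frame (fun z : S × ℕ => (z, 0)) fun _ z =>
    z.2 * 2 ^ (s + 1) + h z.1.2 z.2).mono le_rfl ?_
  rintro net σ τ ⟨ρ, h1, h2⟩ u hu hκ
  have hf : ∀ v, (ρ v).1 = σ v := fun v => (h1 v).1
  have h3 := fun v => (h1 v).2 u hu hκ (fun _ => rfl)
  have hpos : 0 < 2 ^ (s + 1) := by positivity
  refine ⟨fun v => ?_, fun v => ?_⟩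
  · rw [h2]
    have ha := (h3 v).1
    have hb := hlt (ρ v).1.2 (ρ v).2
    calc (ρ v).2 * 2 ^ (s + 1) + h (ρ v).1.2 (ρ v).2 < 2 ^ s * 2 ^ (s + 1) := by nlinarith
      _ = 2 ^ (2 * s + 1) := by rw [← pow_add]; ring_nf
      _ ≤ _ := Nat.pow_le_pow_right two_pos (by omega)
  · have e1 : (∑ v' ∈ univ.erase v, if (σ v).2 ≠ (σ v').2 ∧ τ v = τ v' then u v v' else 0) ≤
        ∑ v' ∈ univ.erase v, u v v' *
          collisions h (2 ^ (s - s)) (σ v).2 (σ v').2 (ρ v).2 := by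
      refine sum_le_sum fun v' _ => ?_
      split_ifs with hc
      · refine le_mul_of_one_le_right (Nat.zero_le _) ?_
        obtain ⟨hc1, hc2⟩ := hc
        rw [h2, h2, hf, hf] at hc2
        have hx : (ρ v).2 = (ρ v').2 := by
          have := congrArg (· / 2 ^ (s + 1)) hc2
          simpa [add_comm _ (h _ _), Nat.add_mul_div_right _ _ hpos,
            Nat.div_eq_of_lt (hlt _ _)] using this
        rw [hx] at hc2 ⊢
        rw [collisions, if_neg hc1, Nat.sub_self, pow_zero, mul_one, mul_one, Nat.one_le_iff_ne_zero,
          ← Nat.pos_iff_ne_zero, card_pos]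
        exact ⟨(ρ v').2, by simpa using hc2⟩
      · exact Nat.zero_le _
    refine (Nat.mul_le_mul_left _ e1).trans ((h3 v).2.trans ?_)
    rw [mul_sum]
    refine sum_le_sum fun v' _ => ?_
    rw [mul_comm 5]
    refine Nat.mul_le_mul_left _ ?_
    unfold collisions
    split_ifs with hk
    · exact Nat.zero_le _
    · have := hh _ (hκ v) _ (hκ v') hk
      rwa [zero_mul, zero_add, one_mul, ← range_eq_Ico]

end Computes

/-! ### Iterated colour reduction and reduction to linearly many colours -/

namespace Computes

variable {N D B To bm bs : ℕ} {S : Type}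
  {E : ∀ net : Net N D, (net.V → S) → (net.V → net.V → ℕ) → Prop}

/-- The total weight of the pairs `v, v'` of nodes with different old and equal new colours. -/
def monoWeight (net : Net N D) (u : net.V → net.V → ℕ) (κ τ : net.V → ℕ) (v : net.V) : ℕ :=
  ∑ v' ∈ univ.erase v, if κ v ≠ κ v' ∧ τ v = τ v' then u v v' else 0

/-- A pair merged by `τ` was either already merged by `μ`, or still separated by `μ` and merged
afterwards; so the losses of successive reductions add. -/
theorem monoWeight_trans (net : Net N D) (u : net.V → net.V → ℕ) (κ μ τ : net.V → ℕ) (v : net.V) :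
    monoWeight net u κ τ v ≤ monoWeight net u κ μ v + monoWeight net u μ τ v := by
  unfold monoWeight
  rw [← sum_add_distrib]
  refine sum_le_sum fun v' _ => ?_
  by_cases h1 : μ v = μ v' <;> simp only [h1] <;> split_ifs <;> simp_all

/-- Iterated colour reduction. -/
theorem reduce_colors_iterate (hO : Oracle N D B To E bm bs) (n : ℕ) : ∀ b : ℕ,
    7 * 2 ^ (b + n) ≤ bm → 2 ^ (b + n) ≤ bs →
    Computes N D B (4 * To * (2 ^ (b + n) - 2 ^ b))
      (fun net (σ : net.V → S × ℕ) (τ : net.V → ℕ) =>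
        ∀ u, E net (fun v => (σ v).1) u → (∀ v, (σ v).2 < 2 ^ (6 * 2 ^ (b + n))) →
          (∀ v, τ v < 2 ^ (6 * 2 ^ b)) ∧
          ∀ v, 2 ^ 2 ^ (b + 1) * monoWeight net u (fun v => (σ v).2) τ v ≤
            10 * ∑ v' ∈ univ.erase v, u v v') := by
  induction n with
  | zero =>
    intro b _ _
    refine (Computes.pure N D B (fun z : S × ℕ => z.2)).mono (Nat.zero_le _) ?_
    intro net σ τ h u _ hκ
    obtain rfl : τ = fun v => (σ v).2 := funext h
    refine ⟨hκ, fun v => ?_⟩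
    have : monoWeight net u (fun v => (σ v).2) (fun v => (σ v).2) v = 0 := by
      refine sum_eq_zero fun v' _ => if_neg ?_
      tauto
    rw [this, mul_zero]
    exact Nat.zero_le _
  | succ n ih =>
    intro b h1 h2
    rw [show b + (n + 1) = b + 1 + n by ring] at h1 h2 ⊢
    have hle : 2 ^ (b + 1) ≤ 2 ^ (b + 1 + n) := Nat.pow_le_pow_right two_pos (by omega)
    refine (((ih (b + 1) h1 h2).frame (fun z => z) fun z k => (z, k)).comp
      ((reduce_colors hO (s := 2 ^ (b + 1)) Nat.one_le_two_pow
        (by omega) (by omega)).frame (fun z => (z.1.1, z.2)) fun _ k => k)).mono ?_ ?_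
    · have e : 2 ^ (b + 1) * (To + To) = 4 * To * 2 ^ b := by rw [pow_succ]; ring
      rw [e, ← mul_add]
      refine Nat.mul_le_mul_left _ ?_
      have : 2 ^ (b + 1) = 2 * 2 ^ b := pow_succ' 2 b
      omega
    · rintro net σ τ ⟨ρ, ⟨κ, h1, hρ⟩, ν, h2, hτ⟩ u hu hκ
      obtain rfl : τ = ν := funext hτ
      obtain rfl : ρ = fun v => (σ v, κ v) := funext hρ
      obtain ⟨h3, h4⟩ := h1 u hu hκ
      obtain ⟨h5, h6⟩ := h2 u hu h3
      refine ⟨fun v => (h5 v).trans_eq ?_, fun v => ?_⟩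
      · rw [pow_succ]
        ring_nf
      · have ha := h4 v
        have hb : 2 ^ 2 ^ (b + 1) * monoWeight net u κ τ v ≤ _ := h6 v
        have hc := monoWeight_trans net u (fun v => (σ v).2) κ τ v
        -- With `q = 2 ^ 2 ^ (b + 1)`, the earlier reductions lost at most a fraction `10 / q ^ 2 ≤
        -- 5 / q` and the last one `5 / q`; together this is `10 / q`.
        have hd : 2 ^ 2 ^ (b + 1 + 1) = 2 ^ 2 ^ (b + 1) * 2 ^ 2 ^ (b + 1) := by
          rw [← pow_add, pow_succ 2 (b + 1), mul_two]
        rw [hd] at ha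
        have he : 2 ≤ 2 ^ 2 ^ (b + 1) := Nat.le_self_pow (by positivity) 2
        generalize 2 ^ 2 ^ (b + 1) = q at *
        generalize monoWeight net u (fun v => (σ v).2) κ v = M at *
        have hf : 2 * (q * M) ≤ q * q * M := by
          rw [mul_assoc]
          exact Nat.mul_le_mul_right _ he
        nlinarith

/-- The colour that a node tries at time `t`, or has decided on. -/
def trial (h : ℕ → ℕ → ℕ) (t k : ℕ) (o : Option (ℕ × ℕ)) : ℕ := o.elim (h k t) Prod.fst

/-- Reduction to `p = O(T)` colours in `O(T)` rounds: at time `t` every undecided node tries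
the value of its polynomial at `t`. -/
theorem reduce_colors_linear (hO : Oracle N D B To E bm bs) {T p K e : ℕ} (hT : 1 ≤ T)
    (hp : p.Prime) (hTp : T ≤ p) (hK : 2 ^ K ≤ p ^ 6) (he : p ≤ 2 ^ e) (hbm : K + e ≤ bm) :
    Computes N D B (To + T * To) (fun net (σ : net.V → S × ℕ) (τ : net.V → ℕ) =>
      ∀ u, E net (fun v => (σ v).1) u → (∀ v v', u v v' = u v' v) →
        (∀ v, (σ v).2 < 2 ^ K) → (∀ v, τ v < p) ∧
          T * ∑ v, monoWeight net u (fun v => (σ v).2) τ v ≤ 24 * ∑ v, ∑ v' ∈ univ.erase v, u v v') := by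
  classical
  obtain ⟨h, hlt, hh1, hh2⟩ := exists_hash (n := T) hp (by norm_num : 1 ≤ 6) hK hTp
  let ψ : ℕ → ℕ → ℕ := fun m m' =>
    if m / 2 ^ e ≠ m' / 2 ^ e ∧ m % 2 ^ e = m' % 2 ^ e then 1 else 0
  have hψ : ∀ m m', ψ m m' ≤ 2 ^ bs := fun m m' => by
    have := Nat.one_le_two_pow (n := bs)
    simp only [ψ]
    split_ifs <;> omega
  -- one time step
  have body : ∀ t, Computes N D B To
      (fun net (σ τ : net.V → ((S × ℕ) × ℕ) × Option (ℕ × ℕ)) =>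
      ∀ v, (τ v).1 = (σ v).1 ∧ ∀ u, E net (fun v => (σ v).1.1.1) u →
        (∀ v, (σ v).1.1.2 < 2 ^ K) → (∀ v, trial h t (σ v).1.1.2 (σ v).2 < p) →
        (τ v).2 = if (σ v).2 = none ∧ T * (monoWeight net u (fun v => (σ v).1.1.2)
          (fun v => trial h t (σ v).1.1.2 (σ v).2) v) ≤ 12 * (σ v).1.2
            then some (h (σ v).1.1.2 t, t) else (σ v).2) := by
    intro t
    refine ((hO ψ hψ).frame (fun z : ((S × ℕ) × ℕ) × Option (ℕ × ℕ) =>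
      (z.1.1.1, z.1.1.2 * 2 ^ e + trial h t z.1.1.2 z.2)) fun z c =>
        (z.1, if z.2 = none ∧ T * c ≤ 12 * z.1.2 then some (h z.1.1.2 t, t) else z.2)).mono
      le_rfl ?_
    rintro net σ τ ⟨c, h1, h2⟩ v
    refine ⟨by rw [h2], fun u hu hκ htr => ?_⟩
    have hc := h1 u hu (fun v => by
      have h1 := hκ v
      have h2 := (htr v).trans_le he
      refine lt_of_lt_of_le ?_ (Nat.pow_le_pow_right two_pos hbm)
      rw [pow_add]
      dsimp only
      nlinarith) v
    rw [h2]
    dsimp only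
    suffices c v = monoWeight net u (fun v => (σ v).1.1.2)
        (fun v => trial h t (σ v).1.1.2 (σ v).2) v by rw [this]
    rw [hc]
    refine sum_congr rfl fun v' _ => ?_
    have hq : ∀ v, ((σ v).1.1.2 * 2 ^ e + trial h t (σ v).1.1.2 (σ v).2) / 2 ^ e =
        (σ v).1.1.2 := fun v => by
      rw [add_comm, Nat.add_mul_div_right _ _ (by positivity),
        Nat.div_eq_of_lt ((htr v).trans_le he), zero_add]
    have hr : ∀ v, ((σ v).1.1.2 * 2 ^ e + trial h t (σ v).1.1.2 (σ v).2) % 2 ^ e =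
        trial h t (σ v).1.1.2 (σ v).2 := fun v => by
      rw [add_comm, Nat.add_mul_mod_self_right, Nat.mod_eq_of_lt ((htr v).trans_le he)]
    simp only [ψ, hq, hr, mul_ite, mul_one, mul_zero]
  -- The state holds the old colour, the total weight `U` at the node, and the decision with its
  -- time. A decided node has conflict weight at most `12 * U / T` with the nodes decided no later.
  -- An undecided node has failed at every time, each time with `T` times its conflict weight at
  -- least `12 * U + 1`; these conflicts are counted by hash agreements with the other colour and
  -- with the other node's final value.
  have lp := Computes.loop (N := N) (D := D) (B := B) (T := To)
    (S := ((S × ℕ) × ℕ) × Option (ℕ × ℕ))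
    (fun t net σ τ => (∀ v, (τ v).1 = (σ v).1) ∧ ∀ u, E net (fun v => (σ v).1.1.1) u →
        (∀ v, (σ v).1.1.2 < 2 ^ K) → (∀ v, (σ v).2 = none) →
        (∀ v, (σ v).1.2 = ∑ v' ∈ univ.erase v, u v v') →
        (∀ v f θ, (τ v).2 = some (f, θ) → f < p ∧ θ < t ∧
          T * (∑ v' ∈ univ.erase v, if (σ v).1.1.2 ≠ (σ v').1.1.2 ∧
            ∃ θ' ≤ θ, (τ v').2 = some (f, θ') then u v v' else 0) ≤ 12 * (σ v).1.2) ∧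
        ∀ v, (τ v).2 = none → t * (12 * (σ v).1.2 + 1) ≤
          T * ∑ v' ∈ univ.erase v, if (σ v).1.1.2 ≠ (σ v').1.1.2 then u v v' *
            (#{x ∈ range t | h (σ v).1.1.2 x = h (σ v').1.1.2 x} +
              (τ v').2.elim 0 fun f => #{x ∈ range t | h (σ v).1.1.2 x = f.1}) else 0) T
    (fun net σ => ⟨fun _ => rfl, fun u _ _ h0 _ =>
      ⟨fun v f θ h => by simp [h0] at h, fun v _ => by simp⟩⟩) _ (fun t _ => body t) (by
      intro t ht net σ τ ρ ⟨hf, h1⟩ h2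
      refine ⟨fun v => ((h2 v).1).trans (hf v), fun u hu hκ hz hU => ?_⟩
      obtain ⟨h3, h4⟩ := h1 u hu hκ hz hU
      have htr : ∀ v, trial h t (σ v).1.1.2 (τ v).2 < p := by
        intro v
        cases ho : (τ v).2 with
        | none => exact hlt _ _
        | some f => exact (h3 v f.1 f.2 ho).1
      have h5 := fun v => (h2 v).2 u (by simpa only [hf] using hu) (by simpa only [hf] using hκ)
        (by simpa only [hf] using htr)
      simp only [hf] at h5
      have hold : ∀ v f, (τ v).2 = some f → (ρ v).2 = some f := by
        intro v f hv
        rw [h5, if_neg (by simp [hv]), hv]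
      have hnew : ∀ v f, (τ v).2 = none → (ρ v).2 = some f → f = (h (σ v).1.1.2 t, t) := by
        intro v f hv hv'
        rw [h5] at hv'
        split_ifs at hv' with hc
        · exact (Option.some.inj hv').symm
        · simp [hv] at hv'
      refine ⟨fun v f θ hv => ?_, fun v hv => ?_⟩
      · cases ho : (τ v).2 with
        | none =>
          have e := hnew v _ ho hv
          obtain ⟨rfl, rfl⟩ := Prod.mk.inj e
          refine ⟨hlt _ _, Nat.lt_succ_self _, ?_⟩
          have h6 := h5 v
          rw [hv] at h6
          split_ifs at h6 with hc
          · refine le_trans (Nat.mul_le_mul_left _ (sum_le_sum fun v' _ => ?_)) hc.2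
            split_ifs with ha hb hb
            · exact le_rfl
            · exfalso
              obtain ⟨ha1, θ', -, ha2⟩ := ha
              refine hb ⟨ha1, ?_⟩
              dsimp only
              rw [ho]
              cases ho' : (τ v').2 with
              | none => exact (Prod.mk.inj (hnew v' _ ho' ha2)).1
              | some g =>
                rw [hold v' g ho'] at ha2
                rw [Option.some.inj ha2]
                rfl
            · exact Nat.zero_le _
            · exact le_rfl
          · rw [ho] at h6
            simp at h6
        | some g =>
          have e := hold v g ho
          rw [hv] at e
          obtain rfl := Option.some.inj e
          obtain ⟨h6, h7, h8⟩ := h3 v f θ ho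
          refine ⟨h6, by omega, le_trans (Nat.mul_le_mul_left _ (sum_le_sum fun v' _ => ?_)) h8⟩
          split_ifs with ha hb hb
          · exact le_rfl
          · exfalso
            obtain ⟨ha1, θ', hle, ha2⟩ := ha
            refine hb ⟨ha1, θ', hle, ?_⟩
            cases ho' : (τ v').2 with
            | none =>
              have := (Prod.mk.inj (hnew v' _ ho' ha2)).2
              omega
            | some g =>
              rw [hold v' g ho'] at ha2
              exact ha2
          · exact Nat.zero_le _
          · exact le_rfl
      · have ho : (τ v).2 = none := by
          cases ho : (τ v).2 with
          | none => rfl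
          | some g => rw [hold v g ho] at hv; simp at hv
        have h6 := h4 v ho
        have h7 := h5 v
        rw [hv] at h7
        split_ifs at h7 with hc
        rw [ho] at hc
        simp only [true_and, not_le] at hc
        have h8 : ∑ v' ∈ univ.erase v, (if (σ v).1.1.2 ≠ (σ v').1.1.2 then u v v' *
            (#{x ∈ range t | h (σ v).1.1.2 x = h (σ v').1.1.2 x} +
              (τ v').2.elim 0 fun f => #{x ∈ range t | h (σ v).1.1.2 x = f.1}) else 0) +
            monoWeight net u (fun v => (σ v).1.1.2) (fun v => trial h t (σ v).1.1.2 (τ v).2) v ≤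
            ∑ v' ∈ univ.erase v, if (σ v).1.1.2 ≠ (σ v').1.1.2 then u v v' *
            (#{x ∈ range (t + 1) | h (σ v).1.1.2 x = h (σ v').1.1.2 x} +
              (ρ v').2.elim 0 fun f => #{x ∈ range (t + 1) | h (σ v).1.1.2 x = f.1}) else 0 := by
          unfold monoWeight
          rw [← sum_add_distrib]
          refine sum_le_sum fun v' _ => ?_
          by_cases hk : (σ v).1.1.2 = (σ v').1.1.2
          · simp [hk]
          · simp only [ne_eq, hk, not_false_eq_true, if_true, true_and]
            have hcount : ∀ P : ℕ → Prop, ∀ [DecidablePred P], #{x ∈ range (t + 1) | P x} =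
                #{x ∈ range t | P x} + if P t then 1 else 0 := by
              intro P _
              rw [range_add_one, filter_insert]
              split_ifs with hP
              · rw [card_insert_of_notMem (by simp)]
              · rfl
            have hm : ∀ i j q : ℕ, i + (if q = 1 then 1 else 0) ≤ j →
                u v v' * i + (if q = 1 then u v v' else 0) ≤ u v v' * j := by
              intro i j q hij
              refine le_trans (le_of_eq ?_) (Nat.mul_le_mul_left _ hij)
              split_ifs <;> ring
            rw [hcount]
            cases ho' : (τ v').2 with
            | none =>
              simp only [trial, ho, Option.elim]
              split_ifs with hx
              · nlinarith [Nat.zero_le (u v v' * (match (ρ v').2 with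
                  | some x => #{x_1 ∈ range (t + 1) | h (σ v).1.1.2 x_1 = x.1}
                  | none => 0))]
              · nlinarith [Nat.zero_le (u v v' * (match (ρ v').2 with
                  | some x => #{x_1 ∈ range (t + 1) | h (σ v).1.1.2 x_1 = x.1}
                  | none => 0))]
            | some g =>
              simp only [trial, ho, hold v' g ho', Option.elim]
              rw [hcount]
              split_ifs <;> nlinarith [Nat.zero_le (u v v')]
        nlinarith)
  refine (((hO (fun _ _ => 1) (fun _ _ => Nat.one_le_two_pow)).frame
    (fun z : S × ℕ => z) fun z c => (z, c)).comp
    (lp.frame (fun z => (z, none)) fun _ z => z.2.elim 0 Prod.fst)).mono le_rfl ?_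
  rintro net σ τ ⟨ρ, ⟨U, hU, hρ⟩, μ, ⟨hf, h1⟩, hτ⟩ u hu hsym hκ
  obtain rfl : ρ = fun v => (σ v, U v) := funext hρ
  replace hU := hU u hu (fun v => (hκ v).trans_le (Nat.pow_le_pow_right two_pos (by omega)))
  simp only [mul_one] at hU
  obtain ⟨h3, h4⟩ := h1 u hu hκ (fun _ => rfl) hU
  dsimp only at h3 h4
  -- Another node causes at most 5 conflicts by hash collisions and at most 6 by its final value.
  -- Since 5 + 6 ≤ 12, failing at all `T` times is impossible; the summand 1 keeps the contradiction
  -- strict when `U = 0`.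
  have hdec : ∀ v, ∃ f θ, (μ v).2 = some (f, θ) := by
    intro v
    cases ho : (μ v).2 with
    | some g => exact ⟨g.1, g.2, rfl⟩
    | none =>
      exfalso
      have h5 := h4 v ho
      have h6 : ∑ v' ∈ univ.erase v, (if (σ v).2 ≠ (σ v').2 then u v v' *
            (#{x ∈ range T | h (σ v).2 x = h (σ v').2 x} +
              (μ v').2.elim 0 fun f => #{x ∈ range T | h (σ v).2 x = f.1}) else 0) ≤
          ∑ v' ∈ univ.erase v, u v v' * 12 := by
        refine sum_le_sum fun v' _ => ?_
        split_ifs with hk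
        · refine Nat.mul_le_mul_left _ ?_
          have ha := hh1 _ (hκ v) _ (hκ v') hk
          cases ho' : (μ v').2 with
          | none => simp only [Option.elim]; omega
          | some g =>
            have hb := hh2 (σ v).2 g.1
            simp only [Option.elim]; omega
        · exact Nat.zero_le _
      rw [← sum_mul, ← hU] at h6
      nlinarith [Nat.mul_le_mul_left T h6]
  choose f θ hfθ using hdec
  have hτf : ∀ v, τ v = f v := fun v => by rw [hτ, hfθ]; rfl
  have h5 := fun v => h3 v _ _ (hfθ v)
  refine ⟨fun v => by rw [hτf]; exact (h5 v).1, ?_⟩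
  have h6 : ∀ v, T * (∑ v' ∈ univ.erase v,
      if (σ v).2 ≠ (σ v').2 ∧ θ v' ≤ θ v ∧ f v = f v' then u v v' else 0) ≤
        12 * ∑ v' ∈ univ.erase v, u v v' := by
    intro v
    rw [← hU]
    refine le_trans (Nat.mul_le_mul_left _ (sum_le_sum fun v' _ => ?_)) (h5 v).2.2
    by_cases hc : (σ v).2 ≠ (σ v').2 ∧ θ v' ≤ θ v ∧ f v = f v'
    · rw [if_pos hc, if_pos ⟨hc.1, θ v', hc.2.1, by rw [hfθ, hc.2.2]⟩]
    · rw [if_neg hc]; exact Nat.zero_le _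
  have h7 : ∀ g : net.V → net.V → ℕ,
      ∑ v, ∑ v' ∈ univ.erase v, g v v' = ∑ v, ∑ v' ∈ univ.erase v, g v' v := by
    intro g
    refine sum_comm' fun v v' => ?_
    simp [eq_comm]
  -- Each merged pair is charged to an end that decided no earlier than the other. Counting ordered
  -- pairs doubles the bound, whence 24 = 2 * 12; this needs `u` symmetric.
  have h8 : ∑ v, monoWeight net u (fun v => (σ v).2) τ v ≤
      2 * ∑ v, ∑ v' ∈ univ.erase v,
        if (σ v).2 ≠ (σ v').2 ∧ θ v' ≤ θ v ∧ f v = f v' then u v v' else 0 := by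
    rw [two_mul]
    nth_rewrite 2 [h7]
    rw [← sum_add_distrib]
    refine sum_le_sum fun v _ => ?_
    rw [← sum_add_distrib]
    refine sum_le_sum fun v' _ => ?_
    rw [hτf, hτf, hsym v' v]
    by_cases h9 : (σ v).2 ≠ (σ v').2 ∧ f v = f v'
    · obtain ⟨h9, h10⟩ := h9
      rcases le_total (θ v') (θ v) with h11 | h11
      · rw [if_pos ⟨h9, h10⟩, if_pos ⟨h9, h11, h10⟩]
        exact Nat.le_add_right _ _
      · rw [if_pos ⟨h9, h10⟩, if_pos (c := (σ v').2 ≠ (σ v).2 ∧ _) ⟨h9.symm, h11, h10.symm⟩]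
        exact Nat.le_add_left _ _
    · rw [if_neg h9]; exact Nat.zero_le _
  have h9 := sum_le_sum fun v (_ : v ∈ univ) => h6 v
  rw [← mul_sum, ← mul_sum] at h9
  nlinarith [Nat.mul_le_mul_left T h8]

end Computes

/-! ### The potential, its ascent and its relation to the pair weight -/

/-- `2 q` times the sum of `y` minus the sum of all products `y i * y j`, `i ≠ j`. -/
def gain {ι : Type} (q : ℕ) (s : Finset ι) (y : ι → ℕ) : ℤ :=
  2 * q * (∑ i ∈ s, (y i : ℤ)) - (∑ i ∈ s, (y i : ℤ)) ^ 2 + ∑ i ∈ s, (y i : ℤ) ^ 2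

theorem gain_congr {ι : Type} (q : ℕ) {s : Finset ι} {y y' : ι → ℕ} (h : ∀ i ∈ s, y i = y' i) :
    gain q s y = gain q s y' := by
  unfold gain
  rw [sum_congr rfl fun i hi => by rw [h i hi],
    sum_congr (f := fun i => (y i : ℤ) ^ 2) rfl fun i hi => by rw [h i hi]]

/-- The squares of single entries cancel, so the gain is affine in each entry, with slope twice `q`
minus the sum of the others. -/
theorem gain_erase {ι : Type} [DecidableEq ι] (q : ℕ) {s : Finset ι} (y : ι → ℕ) {i : ι}
    (hi : i ∈ s) :
    gain q s y = gain q (s.erase i) y + 2 * y i * (q - ∑ j ∈ s.erase i, (y j : ℤ)) := by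
  unfold gain
  rw [← add_sum_erase s (fun j => (y j : ℤ)) hi, ← add_sum_erase s (fun j => (y j : ℤ) ^ 2) hi]
  ring

/-- Take a subset of maximal gain. Dropping a kept positive entry cannot increase the gain, so by
`gain_erase` the other kept entries sum to at most `q`. -/
theorem exists_keep {ι : Type} (q : ℕ) (s : Finset ι) (r : ι → ℕ) :
    ∃ k : ι → ℕ, (∀ i, k i ≤ 1) ∧ gain q s r ≤ gain q s (fun i => r i * k i) ∧
      ∀ i ∈ s, r i * k i ≠ 0 → ∑ j ∈ s, r j * k j ≤ q + r i * k i := by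
  classical
  let k : Finset ι → ι → ℕ := fun t i => if i ∈ t then 1 else 0
  obtain ⟨t, ht, hmax⟩ := exists_max_image s.powerset
    (fun t => gain q s (fun i => r i * k t i)) ⟨s, mem_powerset_self s⟩
  refine ⟨k t, fun i => by simp only [k]; split_ifs <;> omega, ?_, fun i hi h0 => ?_⟩
  · exact (gain_congr q fun i hi => by simp [k, hi]).trans_le (hmax s (mem_powerset_self s))
  · have hit : i ∈ t := by
      by_contra h
      simp [k, h] at h0
    have h1 := hmax (t.erase i) (mem_powerset.2 ((erase_subset _ _).trans (mem_powerset.1 ht)))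
    rw [gain_erase q _ hi, gain_erase q (fun i => r i * k t i) hi,
      gain_congr (y' := fun i => r i * k t i) q (fun j hj => by
        simp [k, (mem_erase.1 hj).1])] at h1
    have hk : k (t.erase i) i = 0 := by simp [k]
    have hk' : k t i = 1 := by simp [k, hit]
    rw [hk] at h1
    rw [hk'] at h0 h1
    rw [← add_sum_erase s (fun j => r j * k t j) hi, add_comm, hk']
    refine Nat.add_le_add_right ?_ _
    have hr : (0 : ℤ) < r i := by exact_mod_cast Nat.pos_of_ne_zero (by simpa using h0)
    rw [← Nat.cast_le (α := ℤ), Nat.cast_sum]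
    by_contra hc
    have := mul_neg_of_pos_of_neg hr (sub_neg.2 (not_le.1 hc))
    simp only [mul_zero, Nat.cast_zero, zero_mul, add_zero, mul_one] at h1
    linarith

/-- The potential of an array of multiplicities, in which the column `w` lists the proposals
to `w`. -/
def potential {V : Type} [Fintype V] (q : ℕ) (y : V → V → ℕ) : ℤ :=
  ∑ w, gain q univ fun v => y v w

theorem sq_sum_sub {V : Type} [Fintype V] [DecidableEq V] (d : V → ℤ) :
    (∑ v, d v) ^ 2 - ∑ v, d v ^ 2 = ∑ v, ∑ v' ∈ univ.erase v, d v * d v' := by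
  rw [sq, sum_mul, ← sum_sub_distrib]
  refine sum_congr rfl fun v _ => ?_
  rw [← add_sum_erase univ d (mem_univ v), mul_add, mul_sum]
  ring

/-- Change of the potential when some rows are changed in a direction of ascent. -/
theorem potential_le_of_ascent {V : Type} [Fintype V] [DecidableEq V] (q : ℕ)
    (y y' x : V → V → ℕ) (e : V → Prop) [DecidablePred e]
    (h0 : ∀ v, ¬ e v → ∀ w, y' v w = y v w)
    (hx : ∀ v w, |(y' v w : ℤ) - y v w| ≤ x v w)
    (h1 : ∀ v, e v → 0 ≤ ∑ w, ((y' v w : ℤ) - y v w) * (q - ∑ v' ∈ univ.erase v, (y v' w : ℤ))) :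
    potential q y ≤ potential q y' + ((∑ v, ∑ v' ∈ univ.erase v,
      if e v ∧ e v' then ∑ w, x v w * x v' w else 0 : ℕ) : ℤ) := by
  let d : V → V → ℤ := fun v w => (y' v w : ℤ) - y v w
  have hd : ∀ v w, (y' v w : ℤ) = y v w + d v w := fun v w => by simp [d]
  have hd0 : ∀ v, ¬ e v → ∀ w, d v w = 0 := fun v hv w => by simp [d, h0 v hv w]
  -- Exact second-order expansion. The absence of diagonal terms leaves only products of changes of
  -- two different rows in the remainder, so a row that moves alone contributes linearly.
  have expand : potential q y' = potential q y +
      2 * ∑ v, ∑ w, d v w * (q - ∑ v' ∈ univ.erase v, (y v' w : ℤ)) -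
        ∑ w, ((∑ v, d v w) ^ 2 - ∑ v, d v w ^ 2) := by
    unfold potential
    rw [sum_comm, mul_sum, ← sum_add_distrib, ← sum_sub_distrib]
    refine sum_congr rfl fun w _ => ?_
    have e1 : ∑ v, d v w * (q - ∑ v' ∈ univ.erase v, (y v' w : ℤ)) =
        q * ∑ v, d v w - (∑ v, d v w) * (∑ v, (y v w : ℤ)) + ∑ v, d v w * y v w := by
      rw [mul_sum, sum_mul, ← sum_sub_distrib, ← sum_add_distrib]
      refine sum_congr rfl fun v _ => ?_
      rw [← add_sum_erase univ (fun v => (y v w : ℤ)) (mem_univ v)]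
      ring
    rw [e1]
    unfold gain
    simp only [hd]
    have e2 : ∑ v, ((y v w : ℤ) + d v w) ^ 2 =
        ∑ v, (y v w : ℤ) ^ 2 + 2 * ∑ v, d v w * y v w + ∑ v, d v w ^ 2 := by
      rw [mul_sum, ← sum_add_distrib, ← sum_add_distrib]
      exact sum_congr rfl fun v _ => by ring
    rw [e2, sum_add_distrib]
    ring
  have hfirst : 0 ≤ ∑ v, ∑ w, d v w * (q - ∑ v' ∈ univ.erase v, (y v' w : ℤ)) := by
    refine sum_nonneg fun v _ => ?_
    by_cases hv : e v
    · exact h1 v hv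
    · exact (sum_eq_zero fun w _ => by rw [hd0 v hv, zero_mul]).ge
  have hsecond : ∑ w, ((∑ v, d v w) ^ 2 - ∑ v, d v w ^ 2) ≤ ((∑ v, ∑ v' ∈ univ.erase v,
      if e v ∧ e v' then ∑ w, x v w * x v' w else 0 : ℕ) : ℤ) := by
    simp only [sq_sum_sub]
    rw [sum_comm]
    push_cast
    refine sum_le_sum fun v _ => ?_
    rw [sum_comm]
    refine sum_le_sum fun v' _ => ?_
    split_ifs with h
    · refine sum_le_sum fun w _ => ?_
      calc d v w * d v' w ≤ |d v w * d v' w| := le_abs_self _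
        _ = |d v w| * |d v' w| := abs_mul _ _
        _ ≤ _ := mul_le_mul (hx v w) (hx v' w) (abs_nonneg _) (by positivity)
    · refine (sum_eq_zero fun w _ => ?_).le
      rcases not_and_or.1 h with h | h
      · rw [hd0 v h, zero_mul]
      · rw [hd0 v' h, mul_zero]
  linarith

/-- If all columns are pruned, then the potential bounds the weight of all pairs. -/
theorem pairs_le_potential {V : Type} [Fintype V] [DecidableEq V] {q : ℕ} {y : V → V → ℕ}
    (h : ∀ v w, y v w ≠ 0 → ∑ v', y v' w ≤ q + y v w) :
    ((∑ v, ∑ v' ∈ univ.erase v, ∑ w, y v w * y v' w : ℕ) : ℤ) ≤ potential q y := by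
  have e : ((∑ v, ∑ v' ∈ univ.erase v, ∑ w, y v w * y v' w : ℕ) : ℤ) =
      ∑ w, ((∑ v, (y v w : ℤ)) ^ 2 - ∑ v, (y v w : ℤ) ^ 2) := by
    simp only [sq_sum_sub]
    rw [sum_comm]
    push_cast
    refine sum_congr rfl fun v _ => ?_
    rw [sum_comm]
  rw [e]
  refine sum_le_sum fun w _ => ?_
  -- In a column with sum `S`, each positive entry sees at most `q` from the others, so the products
  -- of distinct entries add up to at most `q * S`; the gain `2 q S` minus these products is then at
  -- least as large as they are.
  have h1 : (∑ v, (y v w : ℤ)) ^ 2 ≤ q * ∑ v, (y v w : ℤ) + ∑ v, (y v w : ℤ) ^ 2 := by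
    rw [sq, sum_mul, mul_sum, ← sum_add_distrib]
    refine sum_le_sum fun v _ => ?_
    by_cases hv : y v w = 0
    · simp [hv]
    · have := h v w hv
      have : (∑ v', (y v' w : ℤ)) ≤ q + y v w := by exact_mod_cast this
      nlinarith [Nat.cast_nonneg (α := ℤ) (y v w)]
  unfold gain
  linarith

/-- The first `M` units of the sequence `a`. -/
def firstPart (M : ℕ) (a : ℕ → ℕ) (p : ℕ) : ℕ :=
  min (∑ i ∈ range (p + 1), a i) M - min (∑ i ∈ range p, a i) M

theorem firstPart_le (M : ℕ) (a : ℕ → ℕ) (p : ℕ) : firstPart M a p ≤ a p := by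
  unfold firstPart
  rw [sum_range_succ]
  omega

theorem sum_firstPart (M : ℕ) (a : ℕ → ℕ) (d : ℕ) :
    ∑ p ∈ range d, firstPart M a p = min (∑ i ∈ range d, a i) M := by
  have h : Monotone fun n => min (∑ i ∈ range n, a i) M := by
    refine monotone_nat_of_le_succ fun n => ?_
    rw [sum_range_succ]
    omega
  have := sum_range_tsub h d
  simpa [firstPart] using this

/-! ### Pruning and the choice of a half of every row -/

namespace Computes

variable {N D B : ℕ}

/-- Every node accepts the proposals of a subset of its neighbours that maximizes its
contribution to the potential. -/
theorem prune (N D q : ℕ) (hB : 1 ≤ B) :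
    Computes N D B 2 (fun net (σ τ : net.V → ℕ → ℕ) =>
      ∀ x : net.V → net.V → ℕ, net.Reads σ x → (∀ v w, ¬ net.G.Adj v w → x v w = 0) →
        (∀ v w, x v w < 2 ^ B) → ∃ x' : net.V → net.V → ℕ, net.Reads τ x' ∧
          (∀ v w, x' v w ≤ x v w) ∧ potential q x ≤ potential q x' ∧
          ∀ v w, x' v w ≠ 0 → ∑ v', x' v' w ≤ q + x' v w) := by
  choose keep hk1 hk2 hk3 using fun (d : ℕ) (r : ℕ → ℕ) => exists_keep q (range d) r
  refine ((Computes.round N D B (fun (s : ℕ → ℕ) p => s p) fun s d r => (s, keep d r)).comp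
    (Computes.round N D B (fun (s : (ℕ → ℕ) × (ℕ → ℕ)) p => s.2 p)
      fun s _ r p => s.1 p * r p)).mono le_rfl ?_
  rintro net σ τ ⟨ρ, h1, h2⟩ x hx hx0 hxB
  obtain ⟨r, hr, h1⟩ := h1 x hx (fun v w _ => hxB v w)
  obtain rfl : ρ = fun v => (σ v, keep (net.G.degree v) (r v)) := funext h1
  obtain ⟨k, hk, hk0⟩ := net.exists_reads (fun w => keep (net.G.degree w) (r w))
  have hk1' : ∀ v w, k v w ≤ 1 := by
    intro v w
    by_cases h : net.G.Adj v w
    · obtain ⟨p, rfl⟩ := Net.exists_port h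
      rw [← hk v p]
      exact hk1 _ _ _
    · rw [hk0 v w h]; exact Nat.zero_le _
  obtain ⟨r', hr', h2⟩ := h2 k hk (fun v w _ => (hk1' v w).trans_lt
    (Nat.one_lt_two_pow (by omega)))
  have hprod := hr.map₂ hk fun _ a b => a * b
  have conv : ∀ w (f : net.V → ℤ), (∀ v, ¬ net.G.Adj w v → f v = 0) →
      ∑ v ∈ net.G.neighborFinset w, f v = ∑ v, f v := fun w f h =>
    sum_subset (subset_univ _) fun v _ hv => h v (by simpa using hv)
  have hzero : ∀ w v, ¬ net.G.Adj w v → x v w = 0 := fun w v h => hx0 v w fun h' => h h'.symm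
  have g1 : ∀ w, gain q (range (net.G.degree w)) (r w) = gain q univ fun v => x v w := by
    intro w
    unfold gain
    rw [hr.sum w (fun z => (z : ℤ)), hr.sum w (fun z => (z : ℤ) ^ 2), conv, conv]
    · intro v h; simp [hzero w v h]
    · intro v h; simp [hzero w v h]
  have g2 : ∀ w, gain q (range (net.G.degree w))
      (fun p => r w p * keep (net.G.degree w) (r w) p) =
        gain q univ fun v => x v w * k w v := by
    intro w
    unfold gain
    rw [hprod.sum w (fun z => (z : ℤ)), hprod.sum w (fun z => (z : ℤ) ^ 2), conv, conv]
    · intro v h; simp [hzero w v h]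
    · intro v h; simp [hzero w v h]
  refine ⟨fun v w => x v w * k w v, fun v p => ?_, fun v w => ?_, ?_, fun v w h => ?_⟩
  · simp only [h2, hx v p, hr' v p]
  · exact (Nat.mul_le_mul_left _ (hk1' w v)).trans (mul_one _).le
  · refine sum_le_sum fun w _ => ?_
    rw [← g1, ← g2]
    exact hk2 _ _
  · replace h : x v w * k w v ≠ 0 := h
    have hadj : net.G.Adj w v := by
      by_contra hc
      exact h (by rw [hzero w v hc, zero_mul])
    obtain ⟨p, rfl⟩ := Net.exists_port hadj
    have hp : r w p * keep (net.G.degree w) (r w) p = _ := hprod w p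
    have hs := hprod.sum w (fun z => z)
    have := hk3 (net.G.degree w) (r w) p (by simp) (by rw [hp]; exact h)
    rw [hp, hs, sum_neighborFinset w _ (fun v hv => by
      rw [hzero w v hv, zero_mul])] at this
    exact this

/-- The current multiplicity of an arc when its tail is undecided between the two halves, or has
doubled one of them. -/
def pick (o : Option Bool) (a b : ℕ) : ℕ :=
  match o with
  | none => a + b
  | some false => 2 * a
  | some true => 2 * b

/-- One colour class after the other, the nodes choose one of the two halves of their
proposals. -/
theorem choose_half (N D q p : ℕ) {m X : ℕ} (hD : D ≤ 2 ^ m) (hB : m + X + 1 < B) :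
    Computes N D B (p * 2)
      (fun net (σ : net.V → ((ℕ → ℕ) × (ℕ → ℕ)) × ℕ) (τ : net.V → ℕ → ℕ) =>
      ∀ x₀ x₁ : net.V → net.V → ℕ, net.Reads (fun v => (σ v).1.1) x₀ →
        net.Reads (fun v => (σ v).1.2) x₁ → (∀ v w, ¬ net.G.Adj v w → x₀ v w = 0) →
        (∀ v w, ¬ net.G.Adj v w → x₁ v w = 0) → (∀ v w, x₀ v w + x₁ v w ≤ 2 ^ X) →
        (∀ v, (σ v).2 < p) → ∃ x' : net.V → net.V → ℕ, net.Reads τ x' ∧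
          (∀ v, x' v = x₀ v ∨ x' v = x₁ v) ∧
          potential q (fun v w => x₀ v w + x₁ v w) ≤ potential q (fun v w => 2 * x' v w) +
            ((∑ v, ∑ v' ∈ univ.erase v, if (σ v).2 = (σ v').2 then
              ∑ w, (x₀ v w + x₁ v w) * (x₀ v' w + x₁ v' w) else 0 : ℕ) : ℤ)) := by
  classical
  let L := (((ℕ → ℕ) × (ℕ → ℕ)) × ℕ) × Option Bool
  let val : L → ℕ → ℕ := fun z i => pick z.2 (z.1.1.1 i) (z.1.1.2 i)
  -- Replacing `a + b` by `2 * a` or by `2 * b` changes the row by `a - b` or `b - a`. The two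
  -- linear terms are opposite, so the half with the larger slope sum gives an ascent.
  let adv : L → ℕ → (ℕ → ℕ) → Bool := fun z d r =>
    decide (∑ i ∈ range d, (z.1.1.1 i : ℤ) * (q - r i) ≤ ∑ i ∈ range d, (z.1.1.2 i : ℤ) * (q - r i))
  let Ok : ∀ net : Net N D, (net.V → L) → (net.V → net.V → ℕ) → (net.V → net.V → ℕ) → Prop :=
    fun net σ x₀ x₁ => net.Reads (fun v => (σ v).1.1.1) x₀ ∧
        net.Reads (fun v => (σ v).1.1.2) x₁ ∧ (∀ v w, ¬ net.G.Adj v w → x₀ v w = 0) ∧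
        (∀ v w, ¬ net.G.Adj v w → x₁ v w = 0) ∧ (∀ v w, x₀ v w + x₁ v w ≤ 2 ^ X)
  let cur : ∀ net : Net N D, (net.V → L) → (net.V → net.V → ℕ) → (net.V → net.V → ℕ) →
      net.V → net.V → ℕ := fun net σ x₀ x₁ v w => pick (σ v).2 (x₀ v w) (x₁ v w)
  have hpick : ∀ o a b, a + b ≤ 2 ^ X → pick o a b ≤ 2 ^ (X + 1) := by
    intro o a b h
    rw [pow_succ]
    rcases o with _ | _ | _ <;> simp only [pick] <;> omega
  have body : ∀ c, Computes N D B 2 (fun net (σ τ : net.V → L) =>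
      ∀ v, (τ v).1 = (σ v).1 ∧ ((σ v).1.2 ≠ c → (τ v).2 = (σ v).2) ∧
        ((σ v).1.2 = c → ∃ b, (τ v).2 = some b ∧ ∀ x₀ x₁, Ok net σ x₀ x₁ → (σ v).2 = none →
          0 ≤ ∑ w, ((pick (some b) (x₀ v w) (x₁ v w) : ℤ) - cur net σ x₀ x₁ v w) *
            (q - ∑ v' ∈ univ.erase v, (cur net σ x₀ x₁ v' w : ℤ)))) := by
    intro c
    refine ((pairSum N D B fun _ a => a).frame (fun z : L => val z)
      fun z t => (z.1, if z.1.2 = c then some (adv z t.1 t.2) else z.2)).mono le_rfl ?_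
    rintro net σ τ ⟨ρ, h1, h2⟩ v
    rw [h2]
    refine ⟨rfl, fun hc => if_neg hc, fun hc => ⟨_, if_pos hc, fun x₀ x₁ hok hn => ?_⟩⟩
    obtain ⟨hr0, hr1, hz0, hz1, hX⟩ := hok
    have hcur0 : ∀ v w, ¬ net.G.Adj v w → cur net σ x₀ x₁ v w = 0 := by
      intro v w h
      simp only [cur, hz0 v w h, hz1 v w h]
      rcases (σ v).2 with _ | _ | _ <;> rfl
    have hcurX : ∀ v w, cur net σ x₀ x₁ v w ≤ 2 ^ (X + 1) := fun v w => hpick _ _ _ (hX v w)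
    obtain ⟨hd, hr⟩ := h1 (cur net σ x₀ x₁)
      (hr0.map₂ hr1 fun v a b => pick (σ v).2 a b)
      (fun v w _ => (hcurX v w).trans_lt (Nat.pow_lt_pow_right one_lt_two (by omega)))
      (fun v w _ => (sum_nbr_le v w _ hD (fun v' => hcurX v' w)).trans_lt
        (Nat.pow_lt_pow_right one_lt_two (by omega)))
    have conv : ∀ (x : net.V → net.V → ℕ) (y : net.V → ℕ → ℕ), net.Reads y x →
        (∀ v w, ¬ net.G.Adj v w → x v w = 0) →
        ∑ i ∈ range (net.G.degree v), (y v i : ℤ) * (q - ((ρ v).2 i : ℤ)) =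
        ∑ w, (x v w : ℤ) * (q - ∑ v' ∈ univ.erase v, (cur net σ x₀ x₁ v' w : ℤ)) := by
      intro x y hy hx
      rw [(hy.map₂ hr fun _ a b => (a : ℤ) * (q - (b : ℤ))).sum v (fun z => z)]
      refine (sum_subset (subset_univ _) fun w _ hw => ?_).trans (sum_congr rfl fun w _ => ?_)
      · rw [hx v w (by simpa using hw), Nat.cast_zero, zero_mul]
      · rw [sum_neighborFinset_erase v w _ fun v' h => hcur0 v' w fun h' => h h'.symm]
        push_cast
        rfl
    have c0 := conv x₀ _ hr0 hz0
    have c1 := conv x₁ _ hr1 hz1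
    have hcv : ∀ w, cur net σ x₀ x₁ v w = x₀ v w + x₁ v w := fun w => by simp [cur, hn, pick]
    have hadv : adv (σ v) (ρ v).1 (ρ v).2 = decide
        (∑ w, (x₀ v w : ℤ) * (q - ∑ v' ∈ univ.erase v, (cur net σ x₀ x₁ v' w : ℤ)) ≤
         ∑ w, (x₁ v w : ℤ) * (q - ∑ v' ∈ univ.erase v, (cur net σ x₀ x₁ v' w : ℤ))) := by
      simp only [adv, hd, c0, c1]
    rw [hadv]
    have split : ∀ s : ℤ, ∑ w, s * ((x₁ v w : ℤ) - x₀ v w) *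
          (q - ∑ v' ∈ univ.erase v, (cur net σ x₀ x₁ v' w : ℤ)) =
        s * (∑ w, (x₁ v w : ℤ) * (q - ∑ v' ∈ univ.erase v, (cur net σ x₀ x₁ v' w : ℤ)) -
          ∑ w, (x₀ v w : ℤ) * (q - ∑ v' ∈ univ.erase v, (cur net σ x₀ x₁ v' w : ℤ))) := by
      intro s
      rw [← sum_sub_distrib, mul_sum]
      exact sum_congr rfl fun w _ => by ring
    by_cases hle : (∑ w, (x₀ v w : ℤ) * (q - ∑ v' ∈ univ.erase v, (cur net σ x₀ x₁ v' w : ℤ)) ≤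
         ∑ w, (x₁ v w : ℤ) * (q - ∑ v' ∈ univ.erase v, (cur net σ x₀ x₁ v' w : ℤ)))
    · rw [decide_eq_true hle]
      have := split 1
      rw [one_mul] at this
      refine le_of_le_of_eq (sub_nonneg.2 hle) (this.symm.trans (sum_congr rfl fun w _ => ?_))
      rw [hcv]
      simp only [pick]
      push_cast
      ring
    · rw [decide_eq_false hle]
      have := split (-1)
      refine le_of_le_of_eq (b := (-1) * _) ?_ (this.symm.trans (sum_congr rfl fun w _ => ?_))
      · linarith [not_le.1 hle]
      · rw [hcv]
        simp only [pick]
        push_cast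
        ring
  -- After the colours below `c` have moved, the loss is at most the pair weight inside these colour
  -- classes. Different classes never move at the same time, and a moved row differs from the
  -- undecided one by at most `x₀ + x₁`.
  have lp := Computes.loop (N := N) (D := D) (B := B) (T := 2) (S := L)
    (fun c net σ τ => (∀ v, (τ v).1 = (σ v).1) ∧ ((∀ v, (σ v).2 = none) →
      (∀ v, (τ v).2 = none ↔ c ≤ (σ v).1.2) ∧ ∀ x₀ x₁, Ok net σ x₀ x₁ →
        potential q (fun v w => x₀ v w + x₁ v w) ≤ potential q (cur net τ x₀ x₁) +
            ((∑ v, ∑ v' ∈ univ.erase v, if (σ v).1.2 = (σ v').1.2 ∧ (σ v).1.2 < c then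
              ∑ w, (x₀ v w + x₁ v w) * (x₀ v' w + x₁ v' w) else 0 : ℕ) : ℤ))) p
    (fun net σ => ⟨fun _ => rfl, fun h0 => ⟨fun v => by simp [h0], fun x₀ x₁ _ => by
      simp [cur, h0, pick]⟩⟩) _ (fun c _ => body c) (by
      intro c hc net σ τ ρ ⟨hf, h1⟩ h2
      refine ⟨fun v => ((h2 v).1).trans (hf v), fun h0 => ?_⟩
      obtain ⟨h3, h4⟩ := h1 h0
      refine ⟨fun v => ?_, fun x₀ x₁ hok => ?_⟩
      · by_cases hv : (σ v).1.2 = c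
        · obtain ⟨b, hb, -⟩ := (h2 v).2.2 (by rw [hf]; exact hv)
          rw [hb]
          simp only [reduceCtorEq, false_iff]
          omega
        · rw [(h2 v).2.1 (by rw [hf]; exact hv), h3]
          omega
      · have h5 := h4 x₀ x₁ hok
        have hok' : Ok net τ x₀ x₁ := by simpa only [Ok, hf] using hok
        have h6 := potential_le_of_ascent q (cur net τ x₀ x₁) (cur net ρ x₀ x₁)
          (fun v w => x₀ v w + x₁ v w) (fun v => (σ v).1.2 = c) (fun v hv w => by
            simp only [cur]
            rw [(h2 v).2.1 (by rw [hf]; exact hv)])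
          (fun v w => by
            by_cases hv : (σ v).1.2 = c
            · have hn := (h3 v).2 hv.ge
              simp only [cur, hn]
              obtain ⟨b, hb, -⟩ := (h2 v).2.2 (by rw [hf]; exact hv)
              rw [hb, abs_le]
              rcases b with _ | _ <;> simp only [pick] <;> push_cast <;> constructor <;> linarith
            · simp only [cur]
              rw [(h2 v).2.1 (by rw [hf]; exact hv), sub_self, abs_zero]
              positivity)
          (fun v hv => by
            obtain ⟨b, hb, hg⟩ := (h2 v).2.2 (by rw [hf]; exact hv)
            have := hg x₀ x₁ hok' ((h3 v).2 hv.ge)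
            simpa only [cur, hb] using this)
        refine h5.trans ((add_le_add_left h6 _).trans (le_of_eq ?_))
        rw [add_assoc]
        congr 1
        rw [← Nat.cast_add, ← sum_add_distrib]
        congr 1
        refine sum_congr rfl fun v _ => ?_
        rw [← sum_add_distrib]
        refine sum_congr rfl fun v' _ => ?_
        by_cases hv : (σ v).1.2 = (σ v').1.2
        · rcases lt_trichotomy (σ v').1.2 c with h | h | h
          · rw [if_neg (by omega), if_pos (by omega), if_pos (by omega), zero_add]
          · rw [if_pos (by omega), if_neg (by omega), if_pos (by omega), add_zero]
          · rw [if_neg (by omega), if_neg (by omega), if_neg (by omega)]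
        · rw [if_neg (by omega), if_neg (by tauto), if_neg (by tauto)])
  refine (lp.frame (fun z : ((ℕ → ℕ) × (ℕ → ℕ)) × ℕ => ((z, none) : L))
    fun _ z => if z.2 = some true then z.1.1.2 else z.1.1.1).mono le_rfl ?_
  rintro net σ τ ⟨ρ, ⟨hf, h1⟩, h2⟩ x₀ x₁ hr0 hr1 hz0 hz1 hX hp
  obtain ⟨h3, h4⟩ := h1 fun _ => rfl
  refine ⟨fun v => if (ρ v).2 = some true then x₁ v else x₀ v, fun v i => ?_, fun v => ?_, ?_⟩
  · simp only [h2, hf]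
    split_ifs
    · exact hr1 v i
    · exact hr0 v i
  · dsimp only
    split_ifs <;> simp
  · have e1 : cur net ρ x₀ x₁ = fun v w => 2 * (if (ρ v).2 = some true then x₁ v else x₀ v) w := by
      funext v w
      have hn : (ρ v).2 ≠ none := fun h => by
        have := (h3 v).1 h
        have := hp v
        dsimp only at *
        omega
      simp only [cur]
      rcases ho : (ρ v).2 with _ | _ | _
      · exact absurd ho hn
      · simp [pick]
      · simp [pick]
    rw [← e1]
    refine (h4 x₀ x₁ ⟨hr0, hr1, hz0, hz1, hX⟩).trans (le_of_eq ?_)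
    congr 2
    refine sum_congr rfl fun v _ => sum_congr rfl fun v' _ => ?_
    simp [hp v]

end Computes

/-- The potential is homogeneous of degree two in `q` and the array; this removes the doubling after
a half has been chosen. -/
theorem potential_two_mul {V : Type} [Fintype V] (q : ℕ) (y : V → V → ℕ) :
    potential (2 * q) (fun v w => 2 * y v w) = 4 * potential q y := by
  unfold potential gain
  rw [mul_sum]
  refine sum_congr rfl fun w _ => ?_
  push_cast
  simp only [mul_pow, ← mul_sum]
  ring

/-- The parameters of the reduction to `O(m)` colours. -/
theorem exists_color_parameters {m b : ℕ} (hm : 1 ≤ m) (hb : m + 8 ≤ 2 ^ b) :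
    ∃ g p : ℕ, g ≤ b ∧ 2 ^ 2 ^ g ≤ 68 * m ∧ 68 * m ≤ 2 ^ 2 ^ (g + 1) ∧ p.Prime ∧ 68 * m ≤ p ∧
      p ≤ 2 * (68 * m) := by
  obtain ⟨p, hp, h1, h2⟩ := Nat.exists_prime_lt_and_le_two_mul (68 * m) (by omega)
  have hlog : Nat.log 2 (68 * m) ≠ 0 := (Nat.log_pos one_lt_two (by omega)).ne'
  have hg : 2 ^ Nat.log 2 (Nat.log 2 (68 * m)) ≤ Nat.log 2 (68 * m) := Nat.pow_log_le_self 2 hlog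
  refine ⟨Nat.log 2 (Nat.log 2 (68 * m)), p, ?_, ?_, ?_, hp, h1.le, h2⟩
  · have h3 : Nat.log 2 (68 * m) < m + 8 := by
      refine Nat.log_lt_of_lt_pow (by omega) ?_
      have := Nat.lt_two_pow_self (n := m)
      rw [pow_add]
      omega
    exact (Nat.pow_lt_pow_iff_right one_lt_two).1 (hg.trans_lt (h3.trans_le hb)) |>.le
  · exact (Nat.pow_le_pow_right two_pos hg).trans (Nat.pow_log_le_self 2 (by omega))
  · exact (Nat.lt_pow_succ_log_self one_lt_two _).le.trans (Nat.pow_le_pow_right two_pos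
      (Nat.lt_pow_succ_log_self one_lt_two _))

/-! ### Defective colouring, halving, and rounding to single proposals -/

namespace Computes

variable {N D B : ℕ}

/-- A colouring in which nodes with a common neighbour have different colours. -/
def DistTwo (net : Net N D) (κ : net.V → ℕ) : Prop :=
  ∀ v v' w, v ≠ v' → net.G.Adj v w → net.G.Adj v' w → κ v ≠ κ v'

/-- Colouring with `O(m)` colours such that at most a `1 / (2 m)` fraction of the weight of all
pairs is monochromatic. -/
theorem defective_coloring {m b p g : ℕ} (hD : D ≤ 2 ^ m) (hm : 1 ≤ m) (hb : m + 8 ≤ 2 ^ b)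
    (hB : 12 * 2 ^ b ≤ B) (hgb : g ≤ b) (hg1 : 2 ^ 2 ^ g ≤ 68 * m)
    (hg2 : 68 * m ≤ 2 ^ 2 ^ (g + 1)) (hp : p.Prime) (hp1 : 68 * m ≤ p) (hp2 : p ≤ 2 * (68 * m)) :
    Computes N D B (8 * 2 ^ b + 2 + 136 * m)
      (fun net (σ : net.V → (ℕ → ℕ) × ℕ) (τ : net.V → ℕ) =>
      ∀ x : net.V → net.V → ℕ, net.Reads (fun v => (σ v).1) x →
        (∀ v w, ¬ net.G.Adj v w → x v w = 0) → (∀ v w, x v w ≤ 2 ^ m) →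
        (∀ v, (σ v).2 < 2 ^ (6 * 2 ^ b)) → DistTwo net (fun v => (σ v).2) →
        (∀ v, τ v < p) ∧ 2 * m * (∑ v, ∑ v' ∈ univ.erase v,
          if τ v = τ v' then ∑ w, x v w * x v' w else 0) ≤
            ∑ v, ∑ v' ∈ univ.erase v, ∑ w, x v w * x v' w) := by
  -- The last stage sends `6 * 2 ^ g` bits of old colour with `2 * 2 ^ g + 1` bits of trial colour;
  -- together at most `9 * 2 ^ g`.
  have hO : Oracle N D B 2 (PairWeight m) (9 * 2 ^ b) (2 ^ b) :=
    oracle_pair hD (by omega) (by omega)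
  have hgb' : 2 ^ g ≤ 2 ^ b := Nat.pow_le_pow_right two_pos hgb
  obtain ⟨n, rfl⟩ := Nat.exists_eq_add_of_le hgb
  refine (((reduce_colors_iterate hO n g (by omega) le_rfl).frame (fun z => z)
    fun z k => (z.1, k)).comp (reduce_colors_linear hO (T := 68 * m) (K := 6 * 2 ^ g)
      (e := 2 * 2 ^ g + 1) (by omega) hp hp1 ?_ ?_ ?_)).mono ?_ ?_
  · rw [mul_comm, pow_mul]
    exact Nat.pow_le_pow_left (hg1.trans hp1) 6
  · refine hp2.trans ?_
    rw [pow_succ' 2 g] at hg2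
    rw [pow_succ']
    omega
  · have := Nat.one_le_two_pow (n := g)
    omega
  · have : 2 ^ (g + n) - 2 ^ g ≤ 2 ^ (g + n) := Nat.sub_le _ _
    omega
  · rintro net σ τ ⟨ρ, ⟨κ, h1, hρ⟩, h2⟩ x hx hx0 hX hκ hd
    obtain rfl : ρ = fun v => ((σ v).1, κ v) := funext hρ
    have hu : PairWeight m net (fun v => (σ v).1) fun v v' => ∑ w, x v w * x v' w :=
      ⟨x, hx, hx0, hX, rfl⟩
    obtain ⟨h3, h4⟩ := h1 _ hu hκ
    obtain ⟨h5, h6⟩ := h2 _ hu (fun v v' => sum_congr rfl fun w _ => mul_comm _ _) h3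
    refine ⟨h5, ?_⟩
    have h7 : (∑ v, ∑ v' ∈ univ.erase v, if τ v = τ v' then ∑ w, x v w * x v' w else 0) ≤
        ∑ v, monoWeight net (fun v v' => ∑ w, x v w * x v' w) (fun v => (σ v).2) κ v +
        ∑ v, monoWeight net (fun v v' => ∑ w, x v w * x v' w) κ τ v := by
      rw [← sum_add_distrib]
      refine sum_le_sum fun v _ => le_trans (sum_le_sum fun v' hv' => ?_)
        (monoWeight_trans net _ (fun v => (σ v).2) κ τ v)
      by_cases hc : τ v = τ v'
      -- `monoWeight` ignores pairs whose initial colours agree. This is harmless: by `DistTwo` such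
      -- a pair has no common neighbour, hence weight zero.
      · by_cases hk : (σ v).2 = (σ v').2
        · rw [if_pos hc, if_neg (by tauto)]
          refine (sum_eq_zero fun w _ => ?_).le
          by_contra h0
          have hne := mul_ne_zero_iff.1 h0
          exact hd v v' w (mem_erase.1 hv').1.symm (not_not.1 fun h => hne.1 (hx0 _ _ h))
            (not_not.1 fun h => hne.2 (hx0 _ _ h)) hk
        · rw [if_pos hc, if_pos ⟨hk, hc⟩]
      · rw [if_neg hc]; exact Nat.zero_le _
    have h8 := sum_le_sum fun v (_ : v ∈ univ) =>
      (Nat.mul_le_mul_right (monoWeight net (fun v v' => ∑ w, x v w * x v' w)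
        (fun v => (σ v).2) κ v) hg2).trans (h4 v)
    rw [← mul_sum, ← mul_sum] at h8
    dsimp only at h6
    have h9 := Nat.mul_le_mul_left (68 * m) h7
    rw [mul_add] at h9
    -- The two stages lose the fractions `10 / (68 m)` and `24 / (68 m)`; together `34 / (68 m) = 1
    -- / (2 m)`.
    have : 34 * (2 * m * (∑ v, ∑ v' ∈ univ.erase v,
        if τ v = τ v' then ∑ w, x v w * x v' w else 0)) ≤
        34 * ∑ v, ∑ v' ∈ univ.erase v, ∑ w, x v w * x v' w := by
      rw [← mul_assoc, show 34 * (2 * m) = 68 * m by ring]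
      linarith
    exact Nat.le_of_mul_le_mul_left this (by norm_num)

/-- Halving of the number of proposals of every node. -/
theorem halve {m b : ℕ} (hD : D ≤ 2 ^ m) (hm : 1 ≤ m) (hb : m + 8 ≤ 2 ^ b)
    (hB : 12 * 2 ^ b ≤ B) (q : ℕ) (hq : 2 * q ≤ 2 ^ m) :
    Computes N D B (8 * 2 ^ b + 4 + 408 * m)
      (fun net (σ : net.V → (ℕ → ℕ) × ℕ) (τ : net.V → ℕ → ℕ) =>
      ∀ x : net.V → net.V → ℕ, net.Reads (fun v => (σ v).1) x →
        (∀ v w, ¬ net.G.Adj v w → x v w = 0) → (∀ v, ∑ w, x v w ≤ 2 * q) →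
        (∀ v, (σ v).2 < 2 ^ (6 * 2 ^ b)) → DistTwo net (fun v => (σ v).2) →
        ∃ x' : net.V → net.V → ℕ, net.Reads τ x' ∧ (∀ v w, x' v w ≤ x v w) ∧
          (∀ v, ∑ w, x' v w ≤ q) ∧
          (2 * m - 1) * potential (2 * q) x ≤ 8 * m * potential q x') := by
  obtain ⟨g, p, hgb, hg1, hg2, hp, hp1, hp2⟩ := exists_color_parameters hm hb
  -- A row of at most `2 * q` units is cut into its first `q` units and the rest, so either choice
  -- leaves at most `q`.
  refine (((prune N D (B := B) (2 * q) (by omega)).frame (fun z : (ℕ → ℕ) × ℕ => z.1)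
    fun z x => (x, z.2)).comp (((defective_coloring hD hm hb hB hgb hg1 hg2 hp hp1 hp2).frame
      (fun z => z) fun z f => ((firstPart q z.1, fun i => z.1 i - firstPart q z.1 i), f)).comp
      (choose_half N D (2 * q) p (B := B) (X := m) hD (by omega)))).mono (by omega) ?_
  rintro net σ τ ⟨ρ, ⟨y', h1, hρ⟩, μ, ⟨f, h2, hμ⟩, h3⟩ x hx hx0 hrow hκ hd
  obtain rfl : ρ = fun v => (y' v, (σ v).2) := funext hρ
  obtain rfl : μ = fun v => ((firstPart q (y' v), fun i => y' v i - firstPart q (y' v) i), f v) :=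
    funext hμ
  have hxm : ∀ v w, x v w ≤ 2 ^ m := fun v w =>
    (single_le_sum (fun _ _ => Nat.zero_le _) (mem_univ w)).trans ((hrow v).trans hq)
  obtain ⟨y, hy, hyx, hpot, hcol⟩ := h1 x hx hx0 fun v w =>
    (hxm v w).trans_lt (Nat.pow_lt_pow_right one_lt_two (by omega))
  have hy0 : ∀ v w, ¬ net.G.Adj v w → y v w = 0 := fun v w h =>
    Nat.le_zero.1 ((hyx v w).trans_eq (hx0 v w h))
  obtain ⟨h4, h5⟩ := h2 y hy hy0 (fun v w => (hyx v w).trans (hxm v w)) hκ hd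
  obtain ⟨x₀, hr0, hz0⟩ := net.exists_reads fun v => firstPart q (y' v)
  have hle : ∀ v w, x₀ v w ≤ y v w := by
    intro v w
    by_cases h : net.G.Adj v w
    · obtain ⟨i, rfl⟩ := Net.exists_port h
      rw [← hr0 v i, ← hy v i]
      exact firstPart_le _ _ _
    · rw [hz0 v w h]; exact Nat.zero_le _
  have hadd : ∀ v w, x₀ v w + (y v w - x₀ v w) = y v w := fun v w =>
    Nat.add_sub_cancel' (hle v w)
  obtain ⟨x', hx', hor, hfin⟩ := h3 x₀ (fun v w => y v w - x₀ v w) hr0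
    (hy.map₂ hr0 fun _ a b => a - b) hz0 (fun v w h => by simp only [hy0 v w h, Nat.zero_sub])
    (fun v w => by rw [hadd]; exact (hyx v w).trans (hxm v w)) h4
  simp only [hadd] at hfin
  have hys : ∀ v, ∑ w, y v w ≤ 2 * q := fun v =>
    (sum_le_sum fun w _ => hyx v w).trans (hrow v)
  have hs0 : ∀ v, ∑ w, x₀ v w = min (∑ w, y v w) q := by
    intro v
    have e1 := hr0.sum v fun z => z
    have e2 := hy.sum v fun z => z
    rw [sum_neighborFinset v _ (hz0 v)] at e1
    rw [sum_neighborFinset v _ (hy0 v)] at e2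
    rw [← e1, sum_firstPart]
    congr 1
  have hs1 : ∀ v, ∑ w, (y v w - x₀ v w) ≤ q := by
    intro v
    have : ∑ w, x₀ v w + ∑ w, (y v w - x₀ v w) = ∑ w, y v w := by
      rw [← sum_add_distrib]
      exact sum_congr rfl fun w _ => hadd v w
    have := hs0 v
    have := hys v
    omega
  refine ⟨x', hx', fun v w => ?_, fun v => ?_, ?_⟩
  · rcases hor v with h | h <;> rw [h]
    · exact (hle v w).trans (hyx v w)
    · exact (Nat.sub_le _ _).trans (hyx v w)
  · rcases hor v with h | h <;> rw [h]
    · rw [hs0]; exact min_le_right _ _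
    · exact hs1 v
  -- The monochromatic weight is at most a `1 / (2 m)` fraction of the pair weight of the pruned
  -- array, hence of its potential, so a fraction `1 - 1 / (2 m)` of that potential survives.
  · rw [potential_two_mul] at hfin
    have h6 := pairs_le_potential hcol
    have h7 : 2 * (m : ℤ) * ((∑ v, ∑ v' ∈ univ.erase v,
        if f v = f v' then ∑ w, y v w * y v' w else 0 : ℕ) : ℤ) ≤
        ((∑ v, ∑ v' ∈ univ.erase v, ∑ w, y v w * y v' w : ℕ) : ℤ) := by exact_mod_cast h5
    have hm' : (1 : ℤ) ≤ m := by exact_mod_cast hm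
    have h8 := mul_le_mul_of_nonneg_left hfin (by omega : (0 : ℤ) ≤ 2 * m)
    have h9 := mul_le_mul_of_nonneg_left hpot (by omega : (0 : ℤ) ≤ 2 * m - 1)
    linarith

/-- Bernoulli's inequality: `(1 - 1 / (2 m)) ^ m ≥ 1 / 2`. So all `m` halvings together lose at most
a factor 2. -/
theorem two_mul_pow_le (m : ℕ) (hm : 1 ≤ m) : (2 * (m : ℤ)) ^ m ≤ 2 * (2 * m - 1) ^ m := by
  have h1 : (-2 : ℝ) ≤ -(1 / (2 * m)) := by
    have : (1 : ℝ) ≤ m := by exact_mod_cast hm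
    rw [neg_le_neg_iff, div_le_iff₀ (by positivity)]
    linarith
  have h2 := one_add_mul_le_pow h1 m
  have hm0 : (m : ℝ) ≠ 0 := by positivity
  have h3 : 1 + (m : ℝ) * (-(1 / (2 * m))) = 1 / 2 := by field_simp; norm_num
  have h4 : 1 + -(1 / (2 * (m : ℝ))) = (2 * m - 1) / (2 * m) := by field_simp; ring
  rw [h3, h4, div_pow, div_le_div_iff₀ (by norm_num) (by positivity)] at h2
  have : (2 * (m : ℝ)) ^ m ≤ 2 * (2 * m - 1) ^ m := by linarith
  exact_mod_cast this

/-- Rounding of an array of multiplicities to a single proposal of every node. -/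
theorem round_proposals {m b : ℕ} (hD : D ≤ 2 ^ m) (hm : 1 ≤ m) (hb : m + 8 ≤ 2 ^ b)
    (hB : 12 * 2 ^ b ≤ B) :
    Computes N D B (m * (8 * 2 ^ b + 4 + 408 * m))
      (fun net (σ : net.V → (ℕ → ℕ) × ℕ) (τ : net.V → ℕ → ℕ) =>
      ∀ x : net.V → net.V → ℕ, net.Reads (fun v => (σ v).1) x →
        (∀ v w, ¬ net.G.Adj v w → x v w = 0) → (∀ v, ∑ w, x v w ≤ 2 ^ m) →
        (∀ v, (σ v).2 < 2 ^ (6 * 2 ^ b)) → DistTwo net (fun v => (σ v).2) →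
        0 ≤ potential (2 ^ m) x →
        ∃ x' : net.V → net.V → ℕ, net.Reads τ x' ∧ (∀ v w, x' v w ≤ x v w) ∧
          (∀ v, ∑ w, x' v w ≤ 1) ∧ potential (2 ^ m) x ≤ 2 * 4 ^ m * potential 1 x') := by
  have lp := Computes.loop (N := N) (D := D) (B := B) (T := 8 * 2 ^ b + 4 + 408 * m)
    (S := (ℕ → ℕ) × ℕ)
    (fun i net σ τ => (∀ v, (τ v).2 = (σ v).2) ∧
      ∀ x : net.V → net.V → ℕ, net.Reads (fun v => (σ v).1) x →
        (∀ v w, ¬ net.G.Adj v w → x v w = 0) → (∀ v, ∑ w, x v w ≤ 2 ^ m) →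
        (∀ v, (σ v).2 < 2 ^ (6 * 2 ^ b)) → DistTwo net (fun v => (σ v).2) →
        ∃ x' : net.V → net.V → ℕ, net.Reads (fun v => (τ v).1) x' ∧ (∀ v w, x' v w ≤ x v w) ∧
          (∀ v, ∑ w, x' v w ≤ 2 ^ (m - i)) ∧
          (2 * m - 1) ^ i * potential (2 ^ m) x ≤ (8 * m) ^ i * potential (2 ^ (m - i)) x') m
    (fun net σ => ⟨fun _ => rfl, fun x hx _ hr _ _ =>
      ⟨x, hx, fun _ _ => le_rfl, hr, by simp⟩⟩) _
    (fun i hi => (halve hD hm hb hB (2 ^ (m - (i + 1))) (by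
      rw [← pow_succ']; exact Nat.pow_le_pow_right two_pos (by omega))).frame
        (fun z => z) fun z x => (x, z.2)) (by
      rintro i hi net σ τ ρ ⟨hf, h1⟩ ⟨μ, h2, hρ⟩
      obtain rfl : ρ = fun v => (μ v, (τ v).2) := funext hρ
      refine ⟨hf, fun x hx hx0 hr hκ hd => ?_⟩
      obtain ⟨y, hy, hyx, hyr, hpot⟩ := h1 x hx hx0 hr hκ hd
      have e : 2 * 2 ^ (m - (i + 1)) = 2 ^ (m - i) := by
        rw [← pow_succ']; congr 1; omega
      simp only [← hf] at hκ hd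
      obtain ⟨x', hx', hle, hr', hpot'⟩ := h2 y hy
        (fun v w h => Nat.le_zero.1 ((hyx v w).trans_eq (hx0 v w h))) (by rwa [e]) hκ hd
      rw [e] at hpot'
      refine ⟨x', hx', fun v w => (hle v w).trans (hyx v w), hr', ?_⟩
      have hm' : (1 : ℤ) ≤ m := by exact_mod_cast hm
      have h3 := mul_le_mul_of_nonneg_left hpot (by omega : (0 : ℤ) ≤ 2 * m - 1)
      have h4 := mul_le_mul_of_nonneg_left hpot' (by positivity : (0 : ℤ) ≤ (8 * m) ^ i)
      rw [pow_succ, pow_succ]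
      linarith)
  refine (lp.frame (fun z => z) fun _ z => z.1).mono le_rfl ?_
  rintro net σ τ ⟨ρ, ⟨-, h1⟩, h2⟩ x hx hx0 hr hκ hd hpos
  obtain rfl : τ = fun v => (ρ v).1 := funext h2
  obtain ⟨x', hx', hle, hr', hpot⟩ := h1 x hx hx0 hr hκ hd
  rw [Nat.sub_self, pow_zero] at hr' hpot
  refine ⟨x', hx', hle, hr', ?_⟩
  have hm' : (1 : ℤ) ≤ m := by exact_mod_cast hm
  have hA : (0 : ℤ) < (2 * m - 1) ^ m := by
    have : (0 : ℤ) < 2 * m - 1 := by omega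
    positivity
  have e : (8 * (m : ℤ)) ^ m = 4 ^ m * (2 * m) ^ m := by rw [← mul_pow]; ring
  rw [e] at hpot
  have h3 : 0 ≤ potential 1 x' := by
    by_contra hc
    have : (0 : ℤ) ≤ (2 * m - 1) ^ m * potential (2 ^ m) x := mul_nonneg hA.le hpos
    have : (4 : ℤ) ^ m * (2 * m) ^ m * potential 1 x' < 0 :=
      mul_neg_of_pos_of_neg (by positivity) (not_le.1 hc)
    linarith
  have h4 := mul_le_mul_of_nonneg_right (two_mul_pow_le m hm)
    (mul_nonneg (by positivity : (0 : ℤ) ≤ 4 ^ m) h3)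
  refine le_of_mul_le_mul_left ?_ hA
  linarith

end Computes

/-! ### Fractional matching, acceptance of proposals, greedy matching -/

namespace Computes

variable {N D B : ℕ}

/-- Fractional matching: the values of the edges between two nodes of small load are doubled
`m` times; in the end every edge has an end of large load. -/
theorem fractional_matching {m : ℕ} (hD : D ≤ 2 ^ m) (hB : 1 ≤ B) :
    Computes N D B m (fun net (σ : net.V → ℕ × (ℕ → ℕ)) (τ : net.V → ℕ → ℕ) =>
      ∀ x : net.V → net.V → ℕ, (∀ v, (σ v).1 = net.G.degree v) →
        net.Reads (fun v => (σ v).2) x → (∀ v w, ¬ net.G.Adj v w → x v w = 0) →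
        (∀ v w, x v w ≤ 1) → (∀ v w, x v w = x w v) →
        ∃ x' : net.V → net.V → ℕ, net.Reads τ x' ∧ (∀ v w, x v w = 0 → x' v w = 0) ∧
          (∀ v w, x' v w = x' w v) ∧ (∀ v, ∑ w, x' v w ≤ 2 ^ m) ∧
          ∀ v w, x v w = 1 → 2 ^ m < 2 * ∑ w', x' v w' ∨ 2 ^ m < 2 * ∑ w', x' w w') := by
  classical
  -- A load of `2 ^ m` stands for 1. Doubling at a loose node keeps its load within the capacity,
  -- and loads never decrease, so a node that is no longer loose stays so.
  let loose : ℕ × (ℕ → ℕ) → ℕ := fun s => if 2 * ∑ p ∈ range s.1, s.2 p ≤ 2 ^ m then 1 else 0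
  have lp := Computes.loop (N := N) (D := D) (B := B) (T := 1) (S := ℕ × (ℕ → ℕ))
    (fun t net σ τ => ∀ x : net.V → net.V → ℕ, (∀ v, (σ v).1 = net.G.degree v) →
        net.Reads (fun v => (σ v).2) x → (∀ v w, ¬ net.G.Adj v w → x v w = 0) →
        (∀ v w, x v w ≤ 1) → (∀ v w, x v w = x w v) → (∀ v, (τ v).1 = net.G.degree v) ∧
        ∃ x' : net.V → net.V → ℕ, net.Reads (fun v => (τ v).2) x' ∧
          (∀ v w, x v w = 0 → x' v w = 0) ∧
          (∀ v w, x' v w = x' w v) ∧ (∀ v, ∑ w, x' v w ≤ 2 ^ m) ∧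
          ∀ v w, x v w = 1 → x' v w = 2 ^ t ∨
            2 ^ m < 2 * ∑ w', x' v w' ∨ 2 ^ m < 2 * ∑ w', x' w w') m
    (fun net σ x hd hx hx0 h1 hs => ⟨hd, x, hx, fun _ _ => id, hs, fun v => by
      rw [← sum_neighborFinset v _ (hx0 v)]
      calc _ ≤ ∑ w ∈ net.G.neighborFinset v, 1 := sum_le_sum fun w _ => h1 v w
        _ = net.G.degree v := by simp
        _ ≤ _ := (net.degree_le v).trans hD, fun v w h => Or.inl h⟩) _
    (fun t _ => Computes.round N D B (fun s _ => loose s)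
      (fun s _ r => (s.1, fun p => if loose s = 1 ∧ r p = 1 then 2 * s.2 p else s.2 p))) (by
      intro t ht net σ τ ρ h1 h2 x hd hx hx0 hle hs
      obtain ⟨hd', y, hy, hy0, hys, hyr, hyt⟩ := h1 x hd hx hx0 hle hs
      have hyz : ∀ v w, ¬ net.G.Adj v w → y v w = 0 := fun v w h => hy0 _ _ (hx0 _ _ h)
      have hl1 : ∀ s, loose s < 2 := fun s => by simp only [loose]; split_ifs <;> omega
      obtain ⟨r, hr, h2⟩ := h2 (fun v _ => loose (τ v)) (fun _ _ => rfl)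
        (fun v w _ => (hl1 _).trans_le (Nat.le_self_pow (by omega) 2))
      have hload : ∀ v, loose (τ v) = 1 ↔ 2 * ∑ w, y v w ≤ 2 ^ m := by
        intro v
        have := hy.sum v fun z => z
        rw [sum_neighborFinset v _ (hyz v)] at this
        simp only [loose, hd', this]
        split_ifs with h <;> simp [h]
      refine ⟨fun v => by rw [h2]; exact hd' v, fun v w =>
        if loose (τ v) = 1 ∧ loose (τ w) = 1 then 2 * y v w else y v w, fun v p => ?_,
        fun v w h => ?_, fun v w => ?_, fun v => ?_, fun v w h => ?_⟩
      · have e1 := hy v p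
        have e2 := hr v p
        dsimp only at e1 e2
        simp only [h2, e1, e2]
      · dsimp only
        rw [hy0 v w h]; simp
      · dsimp only
        simp only [hys v w, and_comm (a := loose (τ v) = 1)]
      · by_cases hv : loose (τ v) = 1
        · refine le_trans (sum_le_sum fun w _ => ?_) ((mul_sum _ _ _).symm.le.trans
            ((hload v).1 hv))
          dsimp only; split_ifs <;> omega
        · simp only [hv, false_and, if_false]
          exact hyr v
      · have hmono : ∀ v, ∑ w, y v w ≤
            ∑ w, if loose (τ v) = 1 ∧ loose (τ w) = 1 then 2 * y v w else y v w := fun v =>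
          sum_le_sum fun w _ => by split_ifs <;> omega
        have hv := hmono v
        have hw := hmono w
        dsimp only
        rcases hyt v w h with h3 | h3 | h3
        · by_cases hlv : loose (τ v) = 1
          · by_cases hlw : loose (τ w) = 1
            · left
              rw [if_pos ⟨hlv, hlw⟩, h3, pow_succ']
            · have := mt (hload w).2 hlw
              right; right; omega
          · have := mt (hload v).2 hlv
            right; left; omega
        · right; left; omega
        · right; right; omega)
  refine (lp.frame (fun z => z) fun _ z => z.2).mono (by omega) ?_
  rintro net σ τ ⟨ρ, h1, h2⟩ x hd hx hx0 hle hs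
  obtain rfl : τ = fun v => (ρ v).2 := funext h2
  obtain ⟨-, x', hx', h3, h4, h5, h6⟩ := h1 x hd hx hx0 hle hs
  refine ⟨x', hx', h3, h4, h5, fun v w h => ?_⟩
  -- An edge doubled in all `m` rounds has value `2 ^ m` and alone makes its end heavy.
  rcases h6 v w h with h7 | h7
  · left
    have := single_le_sum (f := x' v) (fun _ _ => Nat.zero_le _) (mem_univ w)
    have : 0 < 2 ^ m := by positivity
    omega
  · exact h7

/-- Every node accepts one of the proposals that it received. -/
theorem accept (N D : ℕ) (hB : 1 ≤ B) :
    Computes N D B 2 (fun net (σ : net.V → ℕ → ℕ) (τ : net.V → (ℕ → ℕ) × (ℕ → ℕ)) =>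
      ∀ y : net.V → net.V → ℕ, net.Reads σ y → (∀ v w, ¬ net.G.Adj v w → y v w = 0) →
        (∀ v w, y v w ≤ 1) →
        ∃ z : net.V → net.V → ℕ, net.Reads (fun v => (τ v).1) z ∧
          net.Reads (fun v => (τ v).2) (fun v w => z w v) ∧ (∀ v w, z v w ≤ y v w) ∧
          (∀ v v' w, z v w ≠ 0 → z v' w ≠ 0 → v = v') ∧
          ∀ v w, y v w ≠ 0 → ∃ v', z v' w ≠ 0) := by
  classical
  -- The proposal through the lowest port is accepted.
  let sel : (ℕ → ℕ) → ℕ → ℕ := fun r p => if r p ≠ 0 ∧ ∀ i < p, r i = 0 then 1 else 0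
  have hsel : ∀ r p, sel r p < 2 := fun r p => by simp only [sel]; split_ifs <;> omega
  refine ((Computes.round N D B (fun (s : ℕ → ℕ) p => s p) fun s _ r => (s, r)).comp
    (Computes.round N D B (fun (s : (ℕ → ℕ) × (ℕ → ℕ)) p => sel s.2 p)
      fun s _ r' => (fun p => s.1 p * r' p, fun p => s.2 p * sel s.2 p))).mono le_rfl ?_
  rintro net σ τ ⟨ρ, h1, h2⟩ y hy hy0 hy1
  obtain ⟨r, hr, h1⟩ := h1 y hy fun v w _ =>
    (hy1 v w).trans_lt (Nat.one_lt_two_pow (by omega))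
  obtain rfl : ρ = fun v => (σ v, r v) := funext h1
  obtain ⟨s, hs, hs0⟩ := net.exists_reads fun v => sel (r v)
  have hs1 : ∀ v w, s v w < 2 := by
    intro v w
    by_cases h : net.G.Adj v w
    · obtain ⟨p, rfl⟩ := Net.exists_port h
      rw [← hs v p]
      exact hsel _ _
    · rw [hs0 v w h]; exact two_pos
  obtain ⟨r', hr', h2⟩ := h2 s hs fun v w _ => (hs1 v w).trans_le (Nat.le_self_pow (by omega) 2)
  have hadj : ∀ v w, y v w ≠ 0 → net.G.Adj w v := fun v w h =>
    (not_not.1 fun h' => h (hy0 v w h')).symm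
  refine ⟨fun v w => y v w * s w v, fun v p => ?_, fun v p => ?_, fun v w => ?_,
    fun v v' w h h' => ?_, fun v w h => ?_⟩
  · have e1 := hy v p
    have e2 := hr' v p
    dsimp only at e1 e2
    simp only [h2, e1, e2]
  · have e1 := hr v p
    have e2 := hs v p
    dsimp only at e1 e2
    simp only [h2, e1, e2]
  · exact (Nat.mul_le_mul_left _ (Nat.lt_succ_iff.1 (hs1 w v))).trans (mul_one _).le
  · have h1 := mul_ne_zero_iff.1 h
    have h2 := mul_ne_zero_iff.1 h'
    obtain ⟨p, rfl⟩ := Net.exists_port (hadj v w h1.1)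
    obtain ⟨p', rfl⟩ := Net.exists_port (hadj v' w h2.1)
    have h3 := h1.2
    have h4 := h2.2
    rw [← hs] at h3 h4
    simp only [sel, ne_eq, ite_eq_right_iff, one_ne_zero, imp_false, not_not] at h3 h4
    have : p = p' := by
      rcases lt_trichotomy p p' with hlt | heq | hlt
      · exact absurd (h4.2 p hlt) h3.1
      · exact heq
      · exact absurd (h3.2 p' hlt) h4.1
    rw [this]
  · obtain ⟨p, rfl⟩ := Net.exists_port (hadj v w h)
    have hex : ∃ i, r w i ≠ 0 := ⟨p, by rw [hr w p]; exact h⟩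
    have hle := Nat.find_min' hex (m := p) (by rw [hr w p]; exact h)
    have hspec := Nat.find_spec hex
    have hmin := fun i => Nat.find_min hex (m := i)
    generalize Nat.find hex = i at *
    have e1 := hr w ⟨i, hle.trans_lt p.2⟩
    have e2 := hs w ⟨i, hle.trans_lt p.2⟩
    dsimp only at e1 e2
    refine ⟨net.P.nbr w ⟨i, hle.trans_lt p.2⟩, mul_ne_zero (by rwa [← e1]) ?_⟩
    rw [← e2]
    simp only [sel]
    rw [if_pos ⟨hspec, fun j hj => not_not.1 (hmin j hj)⟩]
    exact one_ne_zero

/-- The involution `g`, which exchanges matched nodes, describes a matching, and every matched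
node knows the port of its matching edge. -/
structure IsMate (net : Net N D) (mate : net.V → Option ℕ) (g : net.V → net.V) : Prop where
  invol : ∀ v, g (g v) = v
  adj : ∀ v, g v ≠ v → net.G.Adj v (g v)
  port : ∀ v p, mate v = some p ↔ ∃ h : p < net.G.degree v, g v = net.P.nbr v ⟨p, h⟩

theorem IsMate.eq_none_iff {net : Net N D} {mate : net.V → Option ℕ} {g : net.V → net.V}
    (h : IsMate net mate g) (v : net.V) : mate v = none ↔ g v = v := by
  constructor
  · intro h1
    by_contra hc
    obtain ⟨p, hp⟩ := Net.exists_port (h.adj v hc)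
    have := (h.port v p).2 ⟨p.2, hp.symm⟩
    rw [h1] at this
    cases this
  · intro h1
    cases hm : mate v with
    | none => rfl
    | some p =>
      obtain ⟨hp, e⟩ := (h.port v p).1 hm
      have := Net.adj_nbr v ⟨p, hp⟩
      rw [← e, h1] at this
      exact absurd this (net.G.loopless.irrefl v)

/-- Addition of edges to a matching. The edges are given in `n` classes, each of which is a
matching. -/
theorem greedy_matching (N D n : ℕ) (hB : 1 ≤ B) :
    Computes N D B n (fun net (σ : net.V → (ℕ → ℕ → Prop) × Option ℕ) (τ : net.V → Option ℕ) =>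
      ∀ (q : net.V → net.V → ℕ → Prop) (g : net.V → net.V), net.Reads (fun v => (σ v).1) q →
        (∀ v w j, q v w j → net.G.Adj v w) → (∀ v w j, q v w j → q w v j) →
        (∀ v w w' j, q v w j → q v w' j → w = w') → IsMate net (fun v => (σ v).2) g →
        ∃ g', IsMate net τ g' ∧ (∀ v, g v ≠ v → g' v = g v) ∧
          ∀ j < n, ∀ v w, q v w j → g' v ≠ v ∨ g' w ≠ w) := by
  classical
  let avail : (ℕ → ℕ → Prop) → ℕ → ℕ → (ℕ → ℕ) → ℕ → Prop := fun A j d r p =>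
    p < d ∧ A p j ∧ r p = 1
  let upd : ℕ → (ℕ → ℕ → Prop) × Option ℕ → ℕ → (ℕ → ℕ) → Option ℕ := fun j s d r =>
    if h : s.2 = none ∧ ∃ p, avail s.1 j d r p then some (Classical.choose h.2) else s.2
  have lp := Computes.loop (N := N) (D := D) (B := B) (T := 1)
    (S := (ℕ → ℕ → Prop) × Option ℕ)
    (fun t net σ τ => ∀ (q : net.V → net.V → ℕ → Prop) (g : net.V → net.V),
        net.Reads (fun v => (σ v).1) q →
        (∀ v w j, q v w j → net.G.Adj v w) → (∀ v w j, q v w j → q w v j) →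
        (∀ v w w' j, q v w j → q v w' j → w = w') → IsMate net (fun v => (σ v).2) g →
        net.Reads (fun v => (τ v).1) q ∧
        ∃ g', IsMate net (fun v => (τ v).2) g' ∧ (∀ v, g v ≠ v → g' v = g v) ∧
          ∀ j < t, ∀ v w, q v w j → g' v ≠ v ∨ g' w ≠ w) n
    (fun net σ q g hq _ _ _ hg => ⟨hq, g, hg, fun _ _ => rfl, fun j hj => by omega⟩) _
    (fun t _ => Computes.round N D B (fun s _ => if s.2 = none then 1 else 0)
      (fun s d r => (s.1, upd t s d r))) (by
      intro t ht net σ τ ρ h1 h2 q g₀ hq hadj hsymm huniq hg₀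
      obtain ⟨hq', g, hg, hext, hmax⟩ := h1 q g₀ hq hadj hsymm huniq hg₀
      obtain ⟨r, hr, h2⟩ := h2 (fun v _ => if (τ v).2 = none then 1 else 0) (fun _ _ => rfl)
        (fun v w _ => by
          have := Nat.one_lt_two_pow (n := B) (by omega)
          split_ifs <;> omega)
      obtain rfl : ρ = fun v => ((τ v).1, upd t (τ v) (net.G.degree v) (r v)) := funext h2
      have hnone := hg.eq_none_iff
      -- the new edges
      let e : net.V → net.V → Prop := fun v w => q v w t ∧ g v = v ∧ g w = w
      have hav : ∀ v p, avail (τ v).1 t (net.G.degree v) (r v) p ↔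
          ∃ h : p < net.G.degree v, q v (net.P.nbr v ⟨p, h⟩) t ∧
            g (net.P.nbr v ⟨p, h⟩) = net.P.nbr v ⟨p, h⟩ := by
        intro v p
        simp only [avail]
        constructor
        · rintro ⟨h, h3, h4⟩
          have e1 := hq' v ⟨p, h⟩
          have e2 := hr v ⟨p, h⟩
          dsimp only at e1 e2
          rw [e1] at h3
          rw [e2] at h4
          refine ⟨h, h3, (hnone _).1 ?_⟩
          by_contra hc
          rw [if_neg hc] at h4
          omega
        · rintro ⟨h, h3, h4⟩
          have e1 := hq' v ⟨p, h⟩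
          have e2 := hr v ⟨p, h⟩
          dsimp only at e1 e2
          refine ⟨h, by rwa [e1], ?_⟩
          rw [e2, if_pos ((hnone _).2 h4)]
      have huq : ∀ v w w', e v w → e v w' → w = w' := fun v w w' h h' => huniq _ _ _ _ h.1 h'.1
      have hsy : ∀ v w, e v w → e w v := fun v w h => ⟨hsymm _ _ _ h.1, h.2.2, h.2.1⟩
      let g' : net.V → net.V := fun v => if h : ∃ w, e v w then Classical.choose h else g v
      have hg'e : ∀ v w, e v w → g' v = w := by
        intro v w h
        have hex : ∃ w, e v w := ⟨w, h⟩
        simp only [g', hex, dite_true]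
        exact huq _ _ _ (Classical.choose_spec hex) h
      have hg'n : ∀ v, (¬ ∃ w, e v w) → g' v = g v := fun v h => by
        simp only [g', h, dite_false]
      have hext' : ∀ v, g v ≠ v → g' v = g v := fun v h => hg'n v (by
        rintro ⟨w, hw⟩; exact h hw.2.1)
      refine ⟨hq', g', ⟨fun v => ?_, fun v hv => ?_, fun v p => ?_⟩, fun v h => ?_,
        fun j hj v w h => ?_⟩
      · by_cases hex : ∃ w, e v w
        · obtain ⟨w, hw⟩ := hex
          rw [hg'e v w hw, hg'e w v (hsy _ _ hw)]
        · rw [hg'n v hex]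
          by_cases hv : g v = v
          · rw [hv, hg'n v hex, hv]
          · rw [hext', hg.invol]
            rw [hg.invol]
            exact fun h => hv h.symm
      · by_cases hex : ∃ w, e v w
        · obtain ⟨w, hw⟩ := hex
          rw [hg'e v w hw]
          exact hadj _ _ _ hw.1
        · rw [hg'n v hex] at hv ⊢
          exact hg.adj v hv
      · dsimp only [upd]
        by_cases hfree : (τ v).2 = none ∧ ∃ p, avail (τ v).1 t (net.G.degree v) (r v) p
        · rw [dif_pos hfree]
          have hs := Classical.choose_spec hfree.2
          generalize Classical.choose hfree.2 = i at *
          obtain ⟨hi, h3, h4⟩ := (hav v i).1 hs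
          have h5 := hg'e v _ ⟨h3, (hnone v).1 hfree.1, h4⟩
          rw [h5]
          constructor
          · intro h
            obtain rfl := Option.some.inj h
            exact ⟨hi, rfl⟩
          · rintro ⟨h, h6⟩
            exact congrArg some (congrArg Fin.val (Net.nbr_inj h6))
        · rw [dif_neg hfree]
          have hex : ¬ ∃ w, e v w := by
            rintro ⟨w, hw⟩
            obtain ⟨i, rfl⟩ := Net.exists_port (hadj _ _ _ hw.1)
            exact hfree ⟨(hnone v).2 hw.2.1, i, (hav v i).2 ⟨i.2, hw.1, hw.2.2⟩⟩
          rw [hg'n v hex]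
          exact hg.port v p
      · rw [hext' v (by rwa [hext v h]), hext v h]
      · have hkeep : ∀ v, g v ≠ v → g' v ≠ v := fun v h => by rwa [hext' v h]
        rcases Nat.lt_succ_iff_lt_or_eq.1 hj with hj | rfl
        · exact (hmax j hj v w h).imp (hkeep v) (hkeep w)
        · by_cases hv : g v = v
          · by_cases hw : g w = w
            · left
              rw [hg'e v w ⟨h, hv, hw⟩]
              exact (hadj _ _ _ h).ne'
            · exact Or.inr (hkeep w hw)
          · exact Or.inl (hkeep v hv))
  refine (lp.frame (fun z => z) fun _ z => z.2).mono (by omega) ?_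
  rintro net σ τ ⟨ρ, h1, h2⟩ q g hq hadj hsymm huniq hg
  obtain rfl : τ = fun v => (ρ v).2 := funext h2
  exact (h1 q g hq hadj hsymm huniq hg).2

end Computes

/-! ### The potential before and after rounding; classes of arcs -/

/-- If a column sum `S` is at most `q`, the subtracted products are at most `S ^ 2 ≤ q * S`, half of
the leading term. This is the initial value that the rounding preserves up to a factor. -/
theorem mul_sum_le_potential {V : Type} [Fintype V] {q : ℕ} {x : V → V → ℕ}
    (h : ∀ w, ∑ v, x v w ≤ q) : (q : ℤ) * ∑ v, ∑ w, (x v w : ℤ) ≤ potential q x := by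
  unfold potential gain
  rw [sum_comm, mul_sum]
  refine sum_le_sum fun w _ => ?_
  have h1 : ∑ v, (x v w : ℤ) ≤ q := by exact_mod_cast h w
  have h2 : 0 ≤ ∑ v, (x v w : ℤ) := sum_nonneg fun _ _ => Nat.cast_nonneg _
  have h3 : 0 ≤ ∑ v, (x v w : ℤ) ^ 2 := sum_nonneg fun _ _ => sq_nonneg _
  nlinarith

/-- For 0/1 entries a column with sum `S` contributes `3 S - S ^ 2`, which is at most 2 because `(S
- 1) (S - 2) ≥ 0` for integers, and zero if the column is empty. So the potential at `q = 1`
certifies nodes with proposals. -/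
theorem potential_one_le {V : Type} [Fintype V] {y : V → V → ℕ} [DecidableEq V]
    (h : ∀ v w, y v w ≤ 1) : potential 1 y ≤ 2 * (#{w | ∃ v, y v w ≠ 0} : ℕ) := by
  classical
  unfold potential
  rw [card_filter, Nat.cast_sum, mul_sum]
  refine sum_le_sum fun w _ => ?_
  have h1 : ∑ v, (y v w : ℤ) ^ 2 = ∑ v, (y v w : ℤ) := sum_congr rfl fun v _ => by
    have := h v w
    interval_cases y v w <;> rfl
  unfold gain
  rw [h1]
  split_ifs with hw
  · have h2 : (∑ v, (y v w : ℤ) - 1) * (∑ v, (y v w : ℤ) - 2) ≥ 0 := by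
      rcases le_or_gt (∑ v, (y v w : ℤ)) 1 with h3 | h3
      · exact mul_nonneg_of_nonpos_of_nonpos (by omega) (by omega)
      · exact mul_nonneg (by omega) (by omega)
    push_cast
    nlinarith
  · have h2 : ∑ v, (y v w : ℤ) = 0 := sum_eq_zero fun v _ => by
      rw [Nat.cast_eq_zero]
      by_contra hc
      exact hw ⟨v, hc⟩
    rw [h2]
    norm_num

/-- The class of an arc from a node of colour `k` to a node of colour `k'`: the index of a bit
in which the colours differ, together with the value of this bit in `k`. -/
noncomputable def arcClass (k k' : ℕ) : ℕ := by
  classical exact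
    if h : ∃ i, k.testBit i ≠ k'.testBit i then
      2 * Classical.choose h + (k.testBit (Classical.choose h)).toNat
    else 0

theorem arcClass_spec {k k' L : ℕ} (h : k ≠ k') (hk : k < 2 ^ L) (hk' : k' < 2 ^ L) :
    ∃ i < L, arcClass k k' = 2 * i + (k.testBit i).toNat ∧ k.testBit i ≠ k'.testBit i := by
  have hex : ∃ i, k.testBit i ≠ k'.testBit i := by
    by_contra hc
    push Not at hc
    exact h (Nat.eq_of_testBit_eq hc)
  have hs := Classical.choose_spec hex
  refine ⟨Classical.choose hex, ?_, by simp only [arcClass, hex, dite_true], hs⟩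
  by_contra hc
  have hle := Nat.pow_le_pow_right two_pos (not_lt.1 hc)
  rw [Nat.testBit_lt_two_pow (hk.trans_le hle), Nat.testBit_lt_two_pow (hk'.trans_le hle)] at hs
  exact hs rfl

/-- The Cole–Vishkin argument: equal classes would mean the same bit position and the same bit value
in `k` and `k'`, but the position was chosen as one where they differ. So consecutive arcs get
different classes. -/
theorem arcClass_ne {k k' k'' L : ℕ} (h : k ≠ k') (h' : k' ≠ k'') (hk : k < 2 ^ L)
    (hk' : k' < 2 ^ L) (hk'' : k'' < 2 ^ L) : arcClass k k' ≠ arcClass k' k'' := by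
  obtain ⟨i, -, h1, h2⟩ := arcClass_spec h hk hk'
  obtain ⟨j, -, h3, -⟩ := arcClass_spec h' hk' hk''
  rw [h1, h3]
  have ha := Bool.toNat_le (k.testBit i)
  have hb := Bool.toNat_le (k'.testBit j)
  intro he
  obtain rfl : i = j := by omega
  refine h2 ?_
  have hc : (k.testBit i).toNat = (k'.testBit i).toNat := by omega
  revert hc
  cases k.testBit i <;> cases k'.testBit i <;> simp

theorem arcClass_lt {k k' L : ℕ} (h : k ≠ k') (hk : k < 2 ^ L) (hk' : k' < 2 ^ L) :
    arcClass k k' < 2 * L := by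
  obtain ⟨i, hi, h1, -⟩ := arcClass_spec h hk hk'
  have := Bool.toNat_le (k.testBit i)
  omega

/-! ### One phase, and the decrease of matchings of free nodes -/

namespace Computes

variable {N D B : ℕ}

/-- A matching, given as the involution that exchanges matched nodes. -/
structure IsPairing (net : Net N D) (f : net.V → net.V) : Prop where
  invol : ∀ v, f (f v) = v
  adj : ∀ v, f v ≠ v → net.G.Adj v (f v)

/-- Every covered node is in `s` or is the partner of a node in `s`. -/
theorem card_pairing_le {net : Net N D} {f : net.V → net.V} (hf : IsPairing net f)
    (s : Finset net.V) (hs : ∀ v, f v ≠ v → v ∈ s ∨ f v ∈ s) : #{v | f v ≠ v} ≤ 2 * #s := by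
  have : ({v | f v ≠ v} : Finset net.V) ⊆ s ∪ s.image f := by
    intro v hv
    rw [mem_union, mem_image]
    exact (hs v (by simpa using hv)).imp id fun h => ⟨f v, h, hf.invol v⟩
  calc _ ≤ #(s ∪ s.image f) := card_le_card this
    _ ≤ #s + #(s.image f) := card_union_le _ _
    _ ≤ #s + #s := Nat.add_le_add_left card_image_le _
    _ = _ := (two_mul _).symm

/-- The part of the state that is kept between two phases: the port of the matching edge and two
colours. -/
abbrev PhaseState := Option ℕ × ℕ × ℕ

/-- Proposals among the free nodes: every free node proposes to at most one free neighbour, and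
the number of nodes with proposals is proportional to the size of a maximum matching. -/
theorem propose {m b : ℕ} (hD : D ≤ 2 ^ m) (hm : 1 ≤ m) (hb : m + 8 ≤ 2 ^ b)
    (hB : 12 * 2 ^ b ≤ B) :
    Computes N D B (1 + m + m * (8 * 2 ^ b + 4 + 408 * m))
      (fun net (σ : net.V → PhaseState) (τ : net.V → PhaseState × (ℕ → ℕ)) =>
      ∀ g, IsMate net (fun v => (σ v).1) g → (∀ v, (σ v).2.2 < 2 ^ (6 * 2 ^ b)) →
        DistTwo net (fun v => (σ v).2.2) → (∀ v, (τ v).1 = σ v) ∧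
        ∃ y : net.V → net.V → ℕ, net.Reads (fun v => (τ v).2) y ∧
          (∀ v w, y v w ≠ 0 → net.G.Adj v w ∧ g v = v ∧ g w = w) ∧
          (∀ v, ∑ w, y v w ≤ 1) ∧
          ∀ f, IsPairing net f → (∀ v, f v ≠ v → g v = v) →
            #{v | f v ≠ v} ≤ 16 * #{w | ∃ v, y v w ≠ 0}) := by
  classical
  refine (((Computes.round N D B (fun (s : PhaseState) _ => if s.1 = none then 1 else 0)
    (fun s d r => (s, d, fun p => if s.1 = none ∧ r p = 1 then 1 else 0))).comp
    ((fractional_matching hD (by omega)).frame (fun z : PhaseState × ℕ × (ℕ → ℕ) => z.2)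
      fun z x => (z.1, x))).comp
    ((round_proposals hD hm hb hB).frame (fun z : PhaseState × (ℕ → ℕ) => (z.2, z.1.2.2))
      fun z x => (z.1, x))).mono le_rfl ?_
  rintro net σ τ ⟨ρ, ⟨μ, h1, ⟨ν, h2, hρ⟩⟩, ⟨ξ, h3, hτ⟩⟩ g hg hκ hd
  obtain rfl : ρ = fun v => ((μ v).1, ν v) := funext hρ
  obtain rfl : τ = fun v => ((μ v).1, ξ v) := funext hτ
  have hnone := hg.eq_none_iff
  obtain ⟨r, hr, h1⟩ := h1 (fun v _ => if (σ v).1 = none then 1 else 0) (fun _ _ => rfl)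
    (fun v w _ => by
      have := Nat.one_lt_two_pow (n := B) (by omega)
      split_ifs <;> omega)
  obtain rfl : μ = fun v => (σ v, net.G.degree v,
    fun p => if (σ v).1 = none ∧ r v p = 1 then 1 else 0) := funext h1
  let x : net.V → net.V → ℕ := fun v w => if net.G.Adj v w ∧ g v = v ∧ g w = w then 1 else 0
  have hx1 : ∀ v w, x v w ≤ 1 := fun v w => by simp only [x]; split_ifs <;> omega
  have hxs : ∀ v w, x v w = x w v := fun v w => by
    simp only [x, net.G.adj_comm v w, and_comm (a := g v = v)]
  have hxr : net.Reads (fun v p => if (σ v).1 = none ∧ r v p = 1 then 1 else 0) x := by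
    intro v p
    have e := hr v p
    dsimp only at e
    have hadj := Net.adj_nbr v p
    simp only [x, e, hadj, true_and]
    refine if_congr ?_ rfl rfl
    rw [hnone]
    refine and_congr_right fun _ => ?_
    rw [← hnone (net.P.nbr v p)]
    split_ifs with h <;> simp [h]
  obtain ⟨x', hx', hx0', hxs', hrow', hcover⟩ := h2 x (fun _ => rfl) hxr
    (fun v w h => by simp [x, h]) hx1 hxs
  have hcol' : ∀ w, ∑ v, x' v w ≤ 2 ^ m := fun w => by simpa only [hxs' _ w] using hrow' w
  have hz' : ∀ v w, ¬ net.G.Adj v w → x' v w = 0 := fun v w h => hx0' v w (by simp [x, h])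
  have hpot := mul_sum_le_potential hcol'
  have hpos : 0 ≤ potential (2 ^ m) x' := le_trans (by positivity) hpot
  obtain ⟨y, hy, hyx, hyr, hpot'⟩ := h3 x' hx' hz' hrow' hκ hd hpos
  have hy1 : ∀ v w, y v w ≤ 1 := fun v w =>
    (single_le_sum (fun _ _ => Nat.zero_le _) (mem_univ w)).trans (hyr v)
  refine ⟨fun _ => rfl, y, hy, fun v w h => ?_, hyr, fun f hf hfree => ?_⟩
  · by_contra hc
    have := (hyx v w).trans_eq (hx0' v w (by simp only [x, if_neg hc]))
    omega
  -- The heavy nodes meet every free edge, so a matching of free nodes covers at most twice as many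
  -- nodes. There are at most 8 heavy nodes per proposed-to node: a factor 2 from the definition of
  -- heavy, 2 from the rounding and 2 from `potential_one_le`.
  · have h5 := card_pairing_le hf {v | 2 ^ m < 2 * ∑ w, x' v w} (fun v hv => by
      simp only [mem_filter, mem_univ, true_and]
      refine hcover v (f v) ?_
      simp only [x]
      rw [if_pos ⟨hf.adj v hv, hfree v hv, hfree (f v) (by rw [hf.invol]; exact hv.symm)⟩])
    have h6 : 2 ^ m * #{v | 2 ^ m < 2 * ∑ w, x' v w} ≤ 2 * ∑ v, ∑ w, x' v w := by
      rw [card_filter, mul_sum, mul_sum]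
      refine sum_le_sum fun v _ => ?_
      split_ifs with h <;> omega
    have h7 := potential_one_le hy1
    generalize (#{v | 2 ^ m < 2 * ∑ w, x' v w} : ℕ) = t at *
    generalize (#{w | ∃ v, y v w ≠ 0} : ℕ) = s at *
    suffices t ≤ 8 * s by omega
    have h8 : (2 : ℤ) ^ m * t ≤ 2 * ∑ v, ∑ w, (x' v w : ℤ) := by exact_mod_cast h6
    have h4 : (4 : ℤ) ^ m = 2 ^ m * 2 ^ m := by rw [← mul_pow]; norm_num
    have hA : (0 : ℤ) < 2 ^ m := by positivity
    rw [h4] at hpot'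
    push_cast at hpot
    have h9 : (2 : ℤ) ^ m * 2 ^ m * t ≤ 2 ^ m * 2 ^ m * (8 * s) := by
      calc (2 : ℤ) ^ m * 2 ^ m * t = 2 ^ m * (2 ^ m * t) := by ring
        _ ≤ 2 ^ m * (2 * ∑ v, ∑ w, (x' v w : ℤ)) := mul_le_mul_of_nonneg_left h8 hA.le
        _ = 2 * (2 ^ m * ∑ v, ∑ w, (x' v w : ℤ)) := by ring
        _ ≤ 2 * (2 * (2 ^ m * 2 ^ m) * potential 1 y) := by linarith
        _ = 2 ^ m * 2 ^ m * (4 * potential 1 y) := by ring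
        _ ≤ 2 ^ m * 2 ^ m * (8 * s) :=
          mul_le_mul_of_nonneg_left (by linarith) (by positivity)
    exact_mod_cast le_of_mul_le_mul_left h9 (by positivity)

/-- Addition to the matching of a maximal set of accepted proposals. -/
theorem resolve (N D : ℕ) {L : ℕ} (hL : L ≤ B) (hB : 1 ≤ B) :
    Computes N D B (3 + 2 * L)
      (fun net (σ : net.V → PhaseState × (ℕ → ℕ)) (τ : net.V → Option ℕ) =>
      ∀ g, IsMate net (fun v => (σ v).1.1) g → (∀ v, (σ v).1.2.1 < 2 ^ L) →
        (∀ v w, net.G.Adj v w → (σ v).1.2.1 ≠ (σ w).1.2.1) →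
        ∀ y : net.V → net.V → ℕ, net.Reads (fun v => (σ v).2) y →
          (∀ v w, y v w ≠ 0 → net.G.Adj v w ∧ g v = v ∧ g w = w) →
          (∀ v, ∑ w, y v w ≤ 1) →
        ∃ g', IsMate net τ g' ∧ (∀ v, g v ≠ v → g' v = g v) ∧
          #{w | ∃ v, y v w ≠ 0} ≤ 2 * #{v | g v = v ∧ g' v ≠ v}) := by
  classical
  refine ((((accept N D hB).frame (fun z : PhaseState × (ℕ → ℕ) => z.2) fun z t => (z.1, t)).comp
    (Computes.round N D B (fun (z : PhaseState × (ℕ → ℕ) × (ℕ → ℕ)) _ => z.1.2.1)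
      (fun z _ r => ((fun p j => (z.2.1 p ≠ 0 ∧ arcClass z.1.2.1 (r p) = j) ∨
        (z.2.2 p ≠ 0 ∧ arcClass (r p) z.1.2.1 = j) : ℕ → ℕ → Prop), z.1.1)))).comp
    (greedy_matching N D (2 * L) hB)).mono le_rfl ?_
  rintro net σ τ ⟨ρ, ⟨μ, ⟨ν, h1, hμ⟩, h2⟩, h3⟩ g hg hL' hκ y hy hyg hyr
  obtain rfl : μ = fun v => ((σ v).1, ν v) := funext hμ
  have hy1 : ∀ v w, y v w ≤ 1 := fun v w =>
    (single_le_sum (fun _ _ => Nat.zero_le _) (mem_univ w)).trans (hyr v)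
  obtain ⟨z, hz, hzt, hzy, hzc, hzex⟩ := h1 y hy
    (fun v w h => not_not.1 fun h' => h (hyg v w h').1) hy1
  obtain ⟨r, hr, h2⟩ := h2 (fun v _ => (σ v).1.2.1) (fun _ _ => rfl)
    (fun v w _ => (hL' v).trans_le (Nat.pow_le_pow_right two_pos hL))
  obtain rfl := funext h2
  have hzg : ∀ v w, z v w ≠ 0 → net.G.Adj v w ∧ g v = v ∧ g w = w := fun v w h =>
    hyg v w (by have := hzy v w; omega)
  have hzr : ∀ v w w', z v w ≠ 0 → z v w' ≠ 0 → w = w' := by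
    intro v w w' h h'
    by_contra hne
    have h4 := add_le_sum (f := fun w => y v w) (s := univ) (fun _ _ => Nat.zero_le _)
      (mem_univ w) (mem_univ w') hne
    have := hzy v w
    have := hzy v w'
    have := hyr v
    omega
  let q : net.V → net.V → ℕ → Prop := fun v w j =>
    (z v w ≠ 0 ∧ arcClass (σ v).1.2.1 (σ w).1.2.1 = j) ∨
      (z w v ≠ 0 ∧ arcClass (σ w).1.2.1 (σ v).1.2.1 = j)
  have hqr : net.Reads (fun v p j => ((ν v).1 p ≠ 0 ∧ arcClass (σ v).1.2.1 (r v p) = j) ∨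
        ((ν v).2 p ≠ 0 ∧ arcClass (r v p) (σ v).1.2.1 = j)) q := by
    intro v p
    have e1 := hz v p
    have e2 := hzt v p
    have e3 := hr v p
    dsimp only at e1 e2 e3
    funext j
    simp only [q, e1, e2, e3]
  -- Accepted arcs form directed paths and cycles. Consecutive arcs lie in different classes, so the
  -- edges of one class form a matching.
  have hno : ∀ u v w, z u v ≠ 0 → z v w ≠ 0 →
      arcClass (σ u).1.2.1 (σ v).1.2.1 ≠ arcClass (σ v).1.2.1 (σ w).1.2.1 := fun u v w h h' =>
    arcClass_ne (hκ _ _ (hzg _ _ h).1) (hκ _ _ (hzg _ _ h').1) (hL' u) (hL' v) (hL' w)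
  obtain ⟨g', hg', hext, hmax⟩ := h3 q g hqr (fun v w j h => by
      rcases h with h | h
      · exact (hzg _ _ h.1).1
      · exact (hzg _ _ h.1).1.symm) (fun v w j h => Or.symm h) (fun v w w' j h h' => by
      rcases h with h | h <;> rcases h' with h' | h'
      · exact hzr _ _ _ h.1 h'.1
      · exact absurd (h'.2.trans h.2.symm) (hno _ _ _ h'.1 h.1)
      · exact absurd (h.2.trans h'.2.symm) (hno _ _ _ h.1 h'.1)
      · exact hzc _ _ _ h.1 h'.1) hg
  refine ⟨g', hg', hext, ?_⟩
  -- A node with a proposal is newly matched, or the proposer it accepted is. Each proposer has a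
  -- unique target `f v`, so `s` and its image under `f` contain all nodes with proposals.
  let s : Finset net.V := {v | g v = v ∧ g' v ≠ v}
  choose! f hf using fun v (h : ∃ w, z v w ≠ 0) => h
  have hsub : ({w | ∃ v, y v w ≠ 0} : Finset net.V) ⊆ s ∪ s.image f := by
    intro w hw
    simp only [mem_filter, mem_univ, true_and] at hw
    obtain ⟨v, hv⟩ := hw
    obtain ⟨v', hv'⟩ := hzex v w hv
    obtain ⟨hadj, hgv, hgw⟩ := hzg v' w hv'
    rw [mem_union, mem_image]
    simp only [s, mem_filter, mem_univ, true_and]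
    rcases hmax _ (arcClass_lt (hκ _ _ hadj) (hL' v') (hL' w)) v' w (Or.inl ⟨hv', rfl⟩) with h | h
    · exact Or.inr ⟨v', ⟨hgv, h⟩, hzr _ _ _ (hf v' ⟨w, hv'⟩) hv'⟩
    · exact Or.inl ⟨hgw, h⟩
  calc _ ≤ #(s ∪ s.image f) := card_le_card hsub
    _ ≤ #s + #(s.image f) := card_union_le _ _
    _ ≤ #s + #s := Nat.add_le_add_left card_image_le _
    _ = _ := (two_mul _).symm

/-- One phase: the free nodes add to the matching a constant fraction of a maximum matching. -/
theorem phase {m b : ℕ} (hD : D ≤ 2 ^ m) (hm : 1 ≤ m) (hb : m + 8 ≤ 2 ^ b)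
    (hB : 12 * 2 ^ b ≤ B) :
    Computes N D B (1 + m + m * (8 * 2 ^ b + 4 + 408 * m) + (3 + 2 * (6 * 2 ^ b)))
      (fun net (σ : net.V → PhaseState) (τ : net.V → Option ℕ) =>
      ∀ g, IsMate net (fun v => (σ v).1) g → (∀ v, (σ v).2.1 < 2 ^ (6 * 2 ^ b)) →
        (∀ v w, net.G.Adj v w → (σ v).2.1 ≠ (σ w).2.1) →
        (∀ v, (σ v).2.2 < 2 ^ (6 * 2 ^ b)) → DistTwo net (fun v => (σ v).2.2) →
        ∃ g', IsMate net τ g' ∧ (∀ v, g v ≠ v → g' v = g v) ∧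
          ∀ f, IsPairing net f → (∀ v, f v ≠ v → g v = v) →
            #{v | f v ≠ v} ≤ 32 * #{v | g v = v ∧ g' v ≠ v}) := by
  refine ((propose hD hm hb hB).comp
    (resolve N D (L := 6 * 2 ^ b) (by omega) (by omega))).mono le_rfl ?_
  rintro net σ τ ⟨ρ, h1, h2⟩ g hg hκ1 hc1 hκ2 hc2
  obtain ⟨hρ, y, hy, hyg, hyr, hyf⟩ := h1 g hg hκ2 hc2
  obtain ⟨g', hg', hext, hcard⟩ := h2 g (by simpa only [hρ] using hg)
    (by simpa only [hρ] using hκ1) (by simpa only [hρ] using hc1) y hy hyg hyr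
  refine ⟨g', hg', hext, fun f hf hfree => ?_⟩
  have := hyf f hf hfree
  omega

/-- Matchings of the free nodes get smaller by a constant factor in a phase. -/
theorem shrink {net : Net N D} {g g' : net.V → net.V} (hg : IsPairing net g)
    (hg' : IsPairing net g') (hext : ∀ v, g v ≠ v → g' v = g v)
    (h : ∀ f, IsPairing net f → (∀ v, f v ≠ v → g v = v) →
      #{v | f v ≠ v} ≤ 32 * #{v | g v = v ∧ g' v ≠ v}) {K L : ℕ}
    (hK : ∀ f, IsPairing net f → (∀ v, f v ≠ v → g v = v) → L * #{v | f v ≠ v} ≤ K)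
    (f : net.V → net.V) (hf : IsPairing net f) (hfree : ∀ v, f v ≠ v → g' v = v) :
    32 * L * #{v | f v ≠ v} ≤ 31 * K := by
  classical
  have hgg : ∀ v, g' v = v → g v = v := fun v hv => by
    by_contra hc
    exact hc ((hext v hc).symm.trans hv)
  have hdisj : ∀ v, g v = v ∧ g' v ≠ v → f v = v := fun v hv => by
    by_contra hc
    exact hv.2 (hfree v hc)
  have hnew : ∀ v, g v = v ∧ g' v ≠ v → g (g' v) = g' v ∧ g' (g' v) ≠ g' v := by
    intro v hv
    constructor
    · by_contra hc
      have h1 := hext _ hc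
      rw [hg'.invol] at h1
      have h2 := congrArg g h1
      rw [hg.invol, hv.1] at h2
      exact hv.2 h2.symm
    · rw [hg'.invol]
      exact hv.2.symm
  -- The new edges and `f` together; they are disjoint, and both use only nodes that are free for
  -- `g`.
  let F : net.V → net.V := fun v => if g v = v ∧ g' v ≠ v then g' v else f v
  have hFnew : ∀ v, (g v = v ∧ g' v ≠ v) → F v = g' v := fun v hv => if_pos hv
  have hFold : ∀ v, ¬ (g v = v ∧ g' v ≠ v) → F v = f v := fun v hv => if_neg hv
  have hF : IsPairing net F := by
    refine ⟨fun v => ?_, fun v hv => ?_⟩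
    · by_cases hc : g v = v ∧ g' v ≠ v
      · rw [hFnew v hc, hFnew _ (hnew v hc), hg'.invol]
      · rw [hFold v hc]
        by_cases hfv : f v = v
        · rw [hfv, hFold v hc, hfv]
        · rw [hFold, hf.invol]
          intro hc'
          have h1 := hdisj _ hc'
          rw [hf.invol] at h1
          exact hfv h1.symm
    · by_cases hc : g v = v ∧ g' v ≠ v
      · rw [hFnew v hc]
        exact hg'.adj v hc.2
      · rw [hFold v hc] at hv ⊢
        exact hf.adj v hv
  have hFfree : ∀ v, F v ≠ v → g v = v := by
    intro v hv
    by_cases hc : g v = v ∧ g' v ≠ v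
    · exact hc.1
    · rw [hFold v hc] at hv
      exact hgg v (hfree v hv)
  have hcard : #{v | F v ≠ v} = #{v | g v = v ∧ g' v ≠ v} + #{v | f v ≠ v} := by
    rw [← card_union_of_disjoint]
    · congr 1
      ext v
      simp only [mem_union, mem_filter, mem_univ, true_and]
      by_cases hc : g v = v ∧ g' v ≠ v
      · rw [hFnew v hc]
        exact ⟨fun _ => Or.inl hc, fun _ => hc.2⟩
      · rw [hFold v hc]
        exact ⟨Or.inr, fun h => h.resolve_left hc⟩
    · rw [disjoint_filter]
      intro v _ hv
      rw [hdisj v hv]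
      simp
  have h1 := h F hF hFfree
  have h2 := hK F hF hFfree
  rw [hcard] at h1 h2
  generalize (#{v | g v = v ∧ g' v ≠ v} : ℕ) = s at *
  -- With `s` newly matched nodes, `s + #f ≤ 32 * s` gives `#f ≤ 31 * s`; combined with `L * (s +
  -- #f) ≤ K` this is the claim.
  have h3 : L * #{v | f v ≠ v} ≤ 31 * (L * s) := by
    rw [mul_left_comm]
    exact Nat.mul_le_mul_left _ (by omega)
  rw [mul_add] at h2
  rw [mul_assoc]
  omega

end Computes

/-! ### Initial colourings and the whole algorithm -/

namespace Computes

variable {N D B : ℕ}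

/-- If the total weight at every node is small, then the iterated colour reduction separates
all pairs of positive weight. -/
theorem ne_of_monoWeight_le {net : Net N D} {u : net.V → net.V → ℕ} {κ τ : net.V → ℕ} {m b : ℕ}
    (hb : m + 8 ≤ 2 ^ b) {v v' : net.V}
    (h : 2 ^ 2 ^ (b + 1) * monoWeight net u κ τ v ≤ 10 * ∑ v' ∈ univ.erase v, u v v')
    (hu : ∑ v' ∈ univ.erase v, u v v' ≤ 2 ^ (2 * m)) (hvv' : v ≠ v') (hκ : κ v ≠ κ v')
    (h0 : u v v' ≠ 0) : τ v ≠ τ v' := by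
  intro hτ
  have h1 : 1 ≤ monoWeight net u κ τ v := by
    refine le_trans ?_ (single_le_sum (fun _ _ => Nat.zero_le _)
      (mem_erase.2 ⟨hvv'.symm, mem_univ v'⟩))
    rw [if_pos ⟨hκ, hτ⟩]
    omega
  -- The merged weight is then at most `10 / 2 ^ 16`, and an integer below 1 vanishes.
  have h2 : 2 ^ (2 * m + 16) ≤ 2 ^ 2 ^ (b + 1) :=
    Nat.pow_le_pow_right two_pos (by rw [pow_succ]; omega)
  rw [pow_add] at h2
  have h3 : 0 < 2 ^ (2 * m) := by positivity
  nlinarith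

/-- Computation of a proper colouring and a colouring at distance two from the identifiers. -/
theorem initial_colorings {m a b : ℕ} (hD : D ≤ 2 ^ m) (hb : m + 8 ≤ 2 ^ b) (hab : b ≤ a)
    (hB : 12 * 2 ^ a ≤ B) :
    Computes N D B (12 * 2 ^ a) (fun net (σ : net.V → ℕ) (τ : net.V → PhaseState) =>
      Function.Injective σ → (∀ v, σ v < 2 ^ (6 * 2 ^ a)) →
        (∀ v, (τ v).1 = none) ∧ (∀ v, (τ v).2.1 < 2 ^ (6 * 2 ^ b)) ∧
        (∀ v w, net.G.Adj v w → (τ v).2.1 ≠ (τ w).2.1) ∧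
        (∀ v, (τ v).2.2 < 2 ^ (6 * 2 ^ b)) ∧ DistTwo net (fun v => (τ v).2.2)) := by
  have hle : 2 ^ b ≤ 2 ^ a := Nat.pow_le_pow_right two_pos hab
  have hO1 : Oracle N D B 1 AdjWeight (7 * 2 ^ a) (2 ^ a) := oracle_adj _ (by omega)
  have hO2 : Oracle N D B 2 (PairWeight 0) (7 * 2 ^ a) (2 ^ a) :=
    oracle_pair hD (by omega) (by omega)
  obtain ⟨n, rfl⟩ := Nat.exists_eq_add_of_le hab
  refine (((reduce_colors_iterate hO1 n b le_rfl le_rfl).frame (fun k : ℕ => ((), k))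
    fun k k' => (k, k')).comp ((reduce_colors_iterate hO2 n b le_rfl le_rfl).frame
      (fun z : ℕ × ℕ => ((fun _ => 1 : ℕ → ℕ), z.1)) fun z k => ((none, z.2, k) : PhaseState))).mono
    ?_ ?_
  · have : 2 ^ (b + n) - 2 ^ b ≤ 2 ^ (b + n) := Nat.sub_le _ _
    omega
  · rintro net σ τ ⟨ρ, ⟨κ, h1, hρ⟩, ⟨κ', h2, hτ⟩⟩ hinj hσ
    obtain rfl : ρ = fun v => (σ v, κ v) := funext hρ
    obtain rfl : τ = fun v => (none, κ v, κ' v) := funext hτ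
    let x : net.V → net.V → ℕ := fun v w => if net.G.Adj v w then 1 else 0
    have hx1 : ∀ v w, net.G.Adj v w → x v w = 1 := fun v w h => if_pos h
    have hrow : ∀ v, ∑ w, x v w ≤ 2 ^ m := by
      intro v
      rw [← sum_neighborFinset v _ fun w h => if_neg h]
      calc _ = ∑ w ∈ net.G.neighborFinset v, 1 := sum_congr rfl fun w h => hx1 v w (by simpa using h)
        _ = net.G.degree v := by simp
        _ ≤ _ := (net.degree_le v).trans hD
    have hcol : ∀ w, ∑ v, x v w ≤ 2 ^ m := fun w => by
      simpa only [x, net.G.adj_comm w] using hrow w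
    obtain ⟨h3, h4⟩ := h1 x rfl hσ
    obtain ⟨h5, h6⟩ := h2 (fun v v' => ∑ w, x v w * x v' w) ⟨x, fun v p =>
      (hx1 _ _ (Net.adj_nbr v p)).symm, fun v w h => if_neg h, fun v w => by
        simp only [x]; split_ifs <;> simp, rfl⟩ hσ
    refine ⟨fun _ => rfl, h3, fun v w h => ?_, h5, fun v v' w hne hv hv' => ?_⟩
    · refine ne_of_monoWeight_le hb (h4 v) ?_ h.ne (hinj.ne h.ne) (by rw [hx1 _ _ h]; exact one_ne_zero)
      exact (sum_le_sum_of_subset (erase_subset _ _)).trans ((hrow v).trans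
        (Nat.pow_le_pow_right two_pos (by omega)))
    · refine ne_of_monoWeight_le hb (h6 v) ?_ hne (hinj.ne hne) ?_
      · calc _ ≤ ∑ v', ∑ w, x v w * x v' w := sum_le_sum_of_subset (erase_subset _ _)
          _ = ∑ w, x v w * ∑ v', x v' w := by
              rw [sum_comm]
              exact sum_congr rfl fun w _ => (mul_sum _ _ _).symm
          _ ≤ ∑ w, x v w * 2 ^ m := sum_le_sum fun w _ => Nat.mul_le_mul_left _ (hcol w)
          _ = (∑ w, x v w) * 2 ^ m := (sum_mul _ _ _).symm
          _ ≤ 2 ^ m * 2 ^ m := Nat.mul_le_mul_right _ (hrow v)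
          _ = _ := by rw [← pow_add, two_mul]
      · have : x v w * x v' w ≤ ∑ w, x v w * x v' w :=
          single_le_sum (f := fun w => x v w * x v' w) (fun _ _ => Nat.zero_le _) (mem_univ w)
        rw [hx1 _ _ hv, hx1 _ _ hv'] at this
        omega

/-- Deterministic computation of a maximal matching. -/
theorem maximal_matching {m a b l : ℕ} (hD : D ≤ 2 ^ m) (hm : 1 ≤ m) (hb : m + 8 ≤ 2 ^ b)
    (hab : b ≤ a) (hB : 12 * 2 ^ a ≤ B) (hN : N < 2 ^ l) :
    Computes N D B (12 * 2 ^ a + 32 * l *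
        (1 + m + m * (8 * 2 ^ b + 4 + 408 * m) + (3 + 2 * (6 * 2 ^ b))))
      (fun net (σ : net.V → ℕ) (τ : net.V → Option ℕ) =>
      Function.Injective σ → (∀ v, σ v < 2 ^ (6 * 2 ^ a)) → ∃ g, IsMate net τ g ∧
        ∀ f, IsPairing net f → (∀ v, f v ≠ v → g v = v) → ∀ v, f v = v) := by
  have hle : 2 ^ b ≤ 2 ^ a := Nat.pow_le_pow_right two_pos hab
  have lp := Computes.loop (N := N) (D := D) (B := B) (S := PhaseState)
    (T := 1 + m + m * (8 * 2 ^ b + 4 + 408 * m) + (3 + 2 * (6 * 2 ^ b)))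
    (fun i net σ τ => (∀ v, (τ v).2 = (σ v).2) ∧ ((∀ v, (σ v).1 = none) →
      (∀ v, (σ v).2.1 < 2 ^ (6 * 2 ^ b)) →
        (∀ v w, net.G.Adj v w → (σ v).2.1 ≠ (σ w).2.1) →
        (∀ v, (σ v).2.2 < 2 ^ (6 * 2 ^ b)) → DistTwo net (fun v => (σ v).2.2) →
      ∃ g, IsMate net (fun v => (τ v).1) g ∧
        ∀ f, IsPairing net f → (∀ v, f v ≠ v → g v = v) →
          32 ^ i * #{v | f v ≠ v} ≤ 31 ^ i * N)) (32 * l)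
    (fun net σ => ⟨fun _ => rfl, fun h0 _ _ _ _ => ⟨id, ⟨fun _ => rfl, fun v h => absurd rfl h,
      fun v p => by
        rw [h0]
        simp only [reduceCtorEq, id, false_iff, not_exists]
        intro hp h
        exact (Net.adj_nbr v ⟨p, hp⟩).ne h⟩, fun f _ _ => by
          rw [pow_zero, pow_zero, one_mul, one_mul]
          exact (card_le_univ _).trans net.card_le⟩⟩) _
    (fun i _ => (phase hD hm hb (hB := (Nat.mul_le_mul_left 12 hle).trans hB)).frame (fun z => z)
      fun z mate => (mate, z.2)) (by
      rintro i hi net σ τ ρ ⟨hf, h1⟩ ⟨mate, h2, hρ⟩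
      obtain rfl : ρ = fun v => (mate v, (τ v).2) := funext hρ
      refine ⟨hf, fun h0 hκ1 hc1 hκ2 hc2 => ?_⟩
      obtain ⟨g, hg, hK⟩ := h1 h0 hκ1 hc1 hκ2 hc2
      simp only [← hf] at hκ1 hc1 hκ2 hc2
      obtain ⟨g', hg', hext, hcard⟩ := h2 g hg hκ1 hc1 hκ2 hc2
      refine ⟨g', hg', fun f hf' hfree => ?_⟩
      rw [pow_succ', pow_succ', mul_assoc 31]
      exact shrink ⟨hg.invol, hg.adj⟩ ⟨hg'.invol, hg'.adj⟩ hext hcard hK f hf' hfree)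
  refine ((initial_colorings hD hb hab hB).comp (lp.frame (fun z => z) fun _ z => z.1)).mono
    le_rfl ?_
  rintro net σ τ ⟨μ, h1, ⟨ρ, ⟨-, h2⟩, hτ⟩⟩ hinj hσ
  obtain rfl : τ = fun v => (ρ v).1 := funext hτ
  obtain ⟨h3, h4, h5, h6, h7⟩ := h1 hinj hσ
  obtain ⟨g, hg, hK⟩ := h2 h3 h4 h5 h6 h7
  refine ⟨g, hg, fun f hf hfree => ?_⟩
  have h8 := hK f hf hfree
  -- By `2 * 31 ^ 32 ≤ 32 ^ 32`, every 32 phases halve the bound, which starts at `N < 2 ^ l`.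
  have h9 : 31 ^ (32 * l) * N < 32 ^ (32 * l) := by
    calc 31 ^ (32 * l) * N < 31 ^ (32 * l) * 2 ^ l :=
          Nat.mul_lt_mul_of_pos_left hN (by positivity)
      _ = (31 ^ 32 * 2) ^ l := by rw [mul_pow, pow_mul]
      _ ≤ (32 ^ 32) ^ l := Nat.pow_le_pow_left (by norm_num) l
      _ = _ := by rw [pow_mul]
  have h10 : #{v | f v ≠ v} = 0 := by
    by_contra hc
    have := Nat.mul_le_mul_left (32 ^ (32 * l)) (Nat.one_le_iff_ne_zero.2 hc)
    omega
  intro v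
  by_contra hc
  exact absurd (card_eq_zero.1 h10) (ne_empty_of_mem (a := v) (by simpa using hc))

end Computes

/-! ### Translation to subgraphs and to the model; maximum degree one -/

open Computes in
/-- The subgraph of a matching that leaves no edge between free nodes. -/
theorem exists_maximal_matching {N D : ℕ} {net : Net N D} {mate : net.V → Option ℕ}
    {g : net.V → net.V} (hg : IsMate net mate g)
    (hmax : ∀ f, IsPairing net f → (∀ v, f v ≠ v → g v = v) → ∀ v, f v = v) :
    ∃ M : net.G.Subgraph, Maximal SimpleGraph.Subgraph.IsMatching M ∧
      ∀ v p, mate v = some p ↔ ∃ h : p < net.G.degree v, M.Adj v (net.P.nbr v ⟨p, h⟩) := by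
  have hsym : ∀ {v w : net.V}, g v = w → g w = v := fun {v w} h => by rw [← h, hg.invol]
  let M : net.G.Subgraph :=
    { verts := {v | g v ≠ v}
      Adj := fun v w => g v = w ∧ v ≠ w
      adj_sub := by
        rintro v w ⟨rfl, h⟩
        exact hg.adj v h.symm
      edge_vert := by
        rintro v w ⟨rfl, h⟩
        exact h.symm
      symm := ⟨fun v w h => ⟨hsym h.1, h.2.symm⟩⟩ }
  have hadj : ∀ v w, M.Adj v w ↔ g v = w ∧ v ≠ w := fun _ _ => Iff.rfl
  have hM : M.IsMatching := fun v hv => ⟨g v, ⟨rfl, Ne.symm hv⟩, fun w hw => hw.1.symm⟩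
  have key : ∀ M' : net.G.Subgraph, M'.IsMatching → M ≤ M' → ∀ v w, M'.Adj v w → M.Adj v w := by
    intro M' hM' hle v w h
    have hne : v ≠ w := (M'.adj_sub h).ne
    have huniq : ∀ {v w w'}, M'.Adj v w → M'.Adj v w' → w = w' := fun {v w w'} h h' =>
      (hM' (M'.edge_vert h)).unique h h'
    by_cases hv : g v = v
    · by_cases hw : g w = w
      · exfalso
        -- An edge of a larger matching between two free nodes would be a nontrivial matching of
        -- free nodes, given by the transposition of its ends.
        have hs : Equiv.swap v w v = v := hmax (Equiv.swap v w) ⟨fun u => by simp, fun u hu => by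
            rcases Equiv.swap_apply_eq_iff.not.1 hu |> fun _ => eq_or_ne u v with rfl | h1
            · rw [Equiv.swap_apply_left]
              exact M'.adj_sub h
            · rcases eq_or_ne u w with rfl | h2
              · rw [Equiv.swap_apply_right]
                exact (M'.adj_sub h).symm
              · exact absurd (Equiv.swap_apply_of_ne_of_ne h1 h2) hu⟩ (fun u hu => by
            rcases eq_or_ne u v with rfl | h1
            · exact hv
            · rcases eq_or_ne u w with rfl | h2
              · exact hw
              · exact absurd (Equiv.swap_apply_of_ne_of_ne h1 h2) hu) v
        rw [Equiv.swap_apply_left] at hs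
        exact hne hs.symm
      · have h1 : M'.Adj w (g w) := hle.2 ⟨rfl, Ne.symm hw⟩
        have h2 := huniq h1 h.symm
        exact absurd ((hsym h2).symm.trans hv) hne.symm
    · have h1 : M'.Adj v (g v) := hle.2 ⟨rfl, Ne.symm hv⟩
      exact ⟨huniq h1 h, hne⟩
  refine ⟨M, ⟨hM, fun M' hM' hle => ⟨fun v hv => ?_, fun v w h => key M' hM' hle v w h⟩⟩,
    fun v p => ?_⟩
  · obtain ⟨w, hw, -⟩ := hM' hv
    exact M.edge_vert (key M' hM' hle v w hw)
  · rw [hg.port]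
    refine exists_congr fun h => ?_
    rw [hadj]
    exact ⟨fun h' => ⟨h', (Net.adj_nbr v ⟨p, h⟩).ne⟩, fun h' => h'.1⟩

/-- A protocol whose input is the identifier and whose output is the port of the matching edge. -/
def Proto.toCongest {B : ℕ} (A : Proto B ℕ (Option ℕ)) : CongestAlgorithm B where
  State := A.State
  init := A.load
  send := A.send
  receive := A.receive
  output := A.unload

theorem Proto.stateAfter_toCongest {B N D : ℕ} (A : Proto B ℕ (Option ℕ)) (net : Net N D)
    (ident : net.V → ℕ) (t : ℕ) (v : net.V) :
    A.toCongest.stateAfter net.P ident t v = (A.step net)^[t] (fun u => A.load (ident u)) v := by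
  induction t generalizing v with
  | zero => rfl
  | succ t ih =>
    rw [Function.iterate_succ_apply']
    simp only [CongestAlgorithm.stateAfter, ih]
    rfl

open Computes in
/-- In a graph of maximum degree one, a node knows its matching edge after one round. -/
theorem computes_of_degree_le_one (N B : ℕ) :
    Computes N 1 B 1 (fun net (_ : net.V → ℕ) (τ : net.V → Option ℕ) => ∃ g, IsMate net τ g ∧
        ∀ f, IsPairing net f → (∀ v, f v ≠ v → g v = v) → ∀ v, f v = v) := by
  classical
  refine (Computes.round N 1 B (fun (_ : ℕ) _ => 0)
    fun _ d _ => if 0 < d then some 0 else none).mono le_rfl ?_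
  intro net σ τ h
  obtain ⟨-, -, h⟩ := h (fun _ _ => 0) (fun _ _ => rfl) (fun _ _ _ => by positivity)
  let g : net.V → net.V := fun v =>
    if h : 0 < net.G.degree v then net.P.nbr v ⟨0, h⟩ else v
  have hg : ∀ {v w}, net.G.Adj v w → g v = w := by
    intro v w hadj
    obtain ⟨p, rfl⟩ := Net.exists_port hadj
    have hp := p.2
    have hd := net.degree_le v
    have h0 : 0 < net.G.degree v := by omega
    simp only [g, h0, dite_true]
    congr 2
    exact Fin.ext (by dsimp only; omega)
  have hpos : ∀ {v}, g v ≠ v → ∃ h : 0 < net.G.degree v, g v = net.P.nbr v ⟨0, h⟩ := by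
    intro v hv
    by_cases h0 : 0 < net.G.degree v
    · exact ⟨h0, by simp only [g, h0, dite_true]⟩
    · exact absurd (by simp only [g, h0, dite_false]) hv
  have hadj : ∀ v, g v ≠ v → net.G.Adj v (g v) := by
    intro v hv
    obtain ⟨h0, e⟩ := hpos hv
    rw [e]
    exact Net.adj_nbr _ _
  refine ⟨g, ⟨fun v => ?_, hadj, fun v p => ?_⟩, fun f hf hfree v => ?_⟩
  · by_cases hv : g v = v
    · rw [hv, hv]
    · exact hg (hadj v hv).symm
  · rw [h]
    constructor
    · intro hp
      split_ifs at hp with h0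
      obtain rfl := Option.some.inj hp
      exact ⟨h0, hg (Net.adj_nbr _ _)⟩
    · rintro ⟨hp, -⟩
      have := net.degree_le v
      rw [if_pos (by omega)]
      congr 1
      omega
  · by_contra hc
    have h1 := hg (hf.adj v hc)
    rw [hfree v hc] at h1
    exact hc h1.symm

open Computes in
theorem Computes.exists_congestAlgorithm {N D B T : ℕ} {K : ℕ}
    (h : Computes N D B T (fun net (σ : net.V → ℕ) (τ : net.V → Option ℕ) =>
      Function.Injective σ → (∀ v, σ v < K) → ∃ g, IsMate net τ g ∧
        ∀ f, IsPairing net f → (∀ v, f v ≠ v → g v = v) → ∀ v, f v = v)) :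
    ∃ T' ≤ T, ∃ A : CongestAlgorithm B,
      ∀ (V : Type) [Fintype V] (G : SimpleGraph V) [DecidableRel G.Adj]
        (P : PortNumbering G) (ident : V → ℕ),
        Fintype.card V ≤ N → (∀ v, G.degree v ≤ D) →
        Function.Injective ident → (∀ v, ident v < K) →
        A.ComputesMaximalMatching T' P ident := by
  classical
  obtain ⟨A, T', hT', h⟩ := h
  refine ⟨T', hT', A.toCongest, fun V _ G _ P ident hN hD hinj hK => ?_⟩
  let net : Net N D := { V := V, G := G, P := P, card_le := hN, degree_le := hD }
  obtain ⟨g, hg, hmax⟩ := h net ident hinj hK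
  obtain ⟨M, hM, hMp⟩ := exists_maximal_matching hg hmax
  refine ⟨M, hM, fun v p => ?_⟩
  rw [← hMp v p]
  exact iff_of_eq (congrArg (fun s => A.unload s = some p)
    (Proto.stateAfter_toCongest A net ident T' v))

/-! ### Choice of the parameters and the final estimate -/

theorem pow_clog_le {n : ℕ} (hn : 1 ≤ n) : 2 ^ Nat.clog 2 n ≤ 2 * n := by
  rcases hn.eq_or_lt with rfl | hn
  · simp
  · have h := Nat.pow_pred_clog_lt_self one_lt_two hn
    have h1 := Nat.clog_pos one_lt_two hn
    rw [← Nat.succ_pred_eq_of_pos h1, pow_succ]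
    omega

theorem logb_natCast_nonneg (n : ℕ) : 0 ≤ Real.logb 2 n := by
  rcases Nat.eq_zero_or_pos n with rfl | h
  · simp
  · exact Real.logb_nonneg one_lt_two (by exact_mod_cast h)

theorem exists_nat_two_pow_near {n : ℕ} (hn : 2 ≤ n) :
    ∃ l : ℕ, n < 2 ^ l ∧ (l : ℝ) ≤ 2 * Real.logb 2 n := by
  refine ⟨Nat.log 2 n + 1, Nat.lt_pow_succ_log_self one_lt_two n, ?_⟩
  have h0 : (0 : ℝ) < n := by exact_mod_cast (by omega : 0 < n)
  have h1 : ((Nat.log 2 n : ℕ) : ℝ) ≤ Real.logb 2 n := by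
    rw [Real.le_logb_iff_rpow_le one_lt_two h0, Real.rpow_natCast]
    exact_mod_cast Nat.pow_log_le_self 2 (by omega)
  have h2 : 1 ≤ Real.logb 2 n := by
    rw [Real.le_logb_iff_rpow_le one_lt_two h0, Real.rpow_one]
    exact_mod_cast hn
  push_cast
  linarith

/-- Degrees are also bounded by `N`, so `D` may be far larger than `N`. Capping it gives `m ≤ l`,
which message sizes of order `log N` require. -/
theorem exists_degree_parameters {N D : ℕ} (hN : 2 ≤ N) (hD : 2 ≤ D) :
    ∃ m l : ℕ, 1 ≤ m ∧ m ≤ l ∧ min D N ≤ 2 ^ m ∧ N < 2 ^ l ∧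
      (m : ℝ) ≤ 2 * Real.logb 2 D ∧ (l : ℝ) ≤ 2 * Real.logb 2 N := by
  obtain ⟨l, hl, hlR⟩ := exists_nat_two_pow_near hN
  obtain ⟨k, hk, hkR⟩ := exists_nat_two_pow_near hD
  have hpos : ∀ {n j : ℕ}, 2 ≤ n → n < 2 ^ j → 1 ≤ j := by
    intro n j hn hj
    rcases Nat.eq_zero_or_pos j with rfl | h
    · rw [pow_zero] at hj
      omega
    · exact h
  refine ⟨min k l, l, le_min (hpos hD hk) (hpos hN hl), min_le_right _ _, ?_, hl,
    le_trans (by exact_mod_cast min_le_left k l) hkR, hlR⟩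
  rcases le_total k l with h | h
  · rw [min_eq_left h]
    exact (min_le_left _ _).trans hk.le
  · rw [min_eq_right h]
    exact (min_le_right _ _).trans hl.le

/-- `2 ^ b = O(m)` keeps a phase at `O(m ^ 2)` rounds, while `2 ^ a = O(c * l)` fixes the message
size and leaves room for identifiers below `N ^ c`. The 9 guarantees `m + 8 ≤ 9 * l`, hence `b ≤ a`.
-/
theorem exists_message_parameters (c : ℕ) {m l : ℕ} (hm : 1 ≤ m) (hml : m ≤ l) :
    ∃ b a : ℕ, m + 8 ≤ 2 ^ b ∧ b ≤ a ∧ 2 ^ b ≤ 18 * m ∧ (c + 9) * l ≤ 2 ^ a ∧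
      2 ^ a ≤ 2 * ((c + 9) * l) := by
  have h1 : (c + 9) * l = c * l + 9 * l := add_mul _ _ _
  have h2 : 2 ^ Nat.clog 2 (m + 8) ≤ 2 * (m + 8) := pow_clog_le (by omega)
  exact ⟨Nat.clog 2 (m + 8), Nat.clog 2 ((c + 9) * l), Nat.le_pow_clog one_lt_two _,
    Nat.clog_mono_right 2 (by omega), by omega, Nat.le_pow_clog one_lt_two _,
    pow_clog_le (by omega)⟩

theorem theorem4p10 :
    ∀ c : ℕ, ∃ C : ℝ, ∀ N D : ℕ, ∃ (B T : ℕ) (A : CongestAlgorithm B),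
      (B : ℝ) ≤ C * Real.logb 2 N ∧
      (T : ℝ) ≤ C * Real.logb 2 D ^ 2 * Real.logb 2 N + 1 ∧
      ∀ (V : Type) [Fintype V] (G : SimpleGraph V) [DecidableRel G.Adj]
        (P : PortNumbering G) (ident : V → ℕ),
        Fintype.card V ≤ N → G.maxDegree ≤ D →
        Function.Injective ident → (∀ v, ident v < N ^ c) →
        A.ComputesMaximalMatching T P ident := by
  intro c
  refine ⟨200 * c + 300000, fun N D => ?_⟩
  have hdeg : ∀ (V : Type) [Fintype V] (G : SimpleGraph V) [DecidableRel G.Adj],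
      Fintype.card V ≤ N → G.maxDegree ≤ D → ∀ v, G.degree v ≤ min D (N - 1) := by
    intro V _ G _ hV hG v
    have := G.degree_lt_card_verts v
    exact le_min ((G.degree_le_maxDegree v).trans hG) (by omega)
  have hlogN := logb_natCast_nonneg N
  have hlogD := logb_natCast_nonneg D
  -- Here one of the logarithms vanishes and only the additive 1 remains in the round bound.
  -- Messages of zero bits suffice, since a node needs only its degree.
  by_cases hsmall : D ≤ 1 ∨ N ≤ 1
  · obtain ⟨T, hT, A, hA⟩ := ((computes_of_degree_le_one N 0).mono le_rfl
      (fun net σ τ h (_ : Function.Injective σ) (_ : ∀ v, σ v < N ^ c) => h)).exists_congestAlgorithm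
    refine ⟨0, T, A, by push_cast; positivity, ?_, fun V _ G _ P ident hV hG hinj hid =>
      hA V G P ident hV (fun v => ?_) hinj hid⟩
    · have h1 : (T : ℝ) ≤ 1 := by exact_mod_cast hT
      have h2 : 0 ≤ (200 * (c : ℝ) + 300000) * Real.logb 2 D ^ 2 * Real.logb 2 N := by positivity
      linarith
    · have := hdeg V G hV hG v
      omega
  · push Not at hsmall
    obtain ⟨hD2, hN2⟩ := hsmall
    obtain ⟨m, l, hm, hml, hDm, hNl, hmR, hlR⟩ := exists_degree_parameters hN2 hD2
    obtain ⟨b, a, hb, hab, hb', ha, ha'⟩ := exists_message_parameters c hm hml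
    have hid' : N ^ c ≤ 2 ^ (6 * 2 ^ a) := by
      have h1 : (c + 9) * l = l * c + 9 * l := by ring
      calc N ^ c ≤ (2 ^ l) ^ c := Nat.pow_le_pow_left hNl.le c
        _ = 2 ^ (l * c) := (pow_mul _ _ _).symm
        _ ≤ _ := Nat.pow_le_pow_right two_pos (by omega)
    obtain ⟨T, hT, A, hA⟩ := (Computes.maximal_matching (N := N) (D := min D N) (B := 12 * 2 ^ a)
      hDm hm hb hab le_rfl hNl).exists_congestAlgorithm
    refine ⟨12 * 2 ^ a, T, A, ?_, ?_, fun V _ G _ P ident hV hG hinj hid =>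
      hA V G P ident hV (fun v => (hdeg V G hV hG v).trans
        (min_le_min_left _ (Nat.sub_le _ _))) hinj fun v => (hid v).trans_le hid'⟩
    · have h1 : ((12 * 2 ^ a : ℕ) : ℝ) ≤ 24 * ((c + 9) * l) := by
        have : 12 * 2 ^ a ≤ 24 * ((c + 9) * l) := by omega
        exact_mod_cast this
      refine h1.trans ?_
      have h2 : (0 : ℝ) ≤ 24 * (c + 9) := by positivity
      have h3 := mul_le_mul_of_nonneg_left hlR h2
      nlinarith [mul_nonneg (Nat.cast_nonneg (α := ℝ) c) hlogN]
    · have hm2 : m ≤ m * m := Nat.le_mul_self m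
      -- With `2 ^ b ≤ 18 * m` the coefficients add up to 556 + 217 + 4 = 777.
      have hphase : 1 + m + m * (8 * 2 ^ b + 4 + 408 * m) + (3 + 2 * (6 * 2 ^ b)) ≤
          777 * (m * m) := by
        have h2 : m * (8 * 2 ^ b + 4 + 408 * m) ≤ m * (556 * m) :=
          Nat.mul_le_mul_left _ (by omega)
        have h3 : m * (556 * m) = 556 * (m * m) := by ring
        omega
      have h1 : T ≤ (24 * (c + 9) + 32 * 777) * (l * (m * m)) := by
        have h2 := Nat.mul_le_mul_left (32 * l) hphase
        have h3 : (c + 9) * l ≤ (c + 9) * (l * (m * m)) :=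
          Nat.mul_le_mul_left _ (Nat.le_mul_of_pos_right _ (Nat.mul_pos hm hm))
        have h4 : 32 * l * (777 * (m * m)) = 32 * 777 * (l * (m * m)) := by ring
        rw [add_mul, mul_assoc 24]
        omega
      have h2 : (T : ℝ) ≤ (24 * (c + 9) + 32 * 777) * (l * (m * m)) := by exact_mod_cast h1
      have h3 : (l : ℝ) * (m * m) ≤
          2 * Real.logb 2 N * (2 * Real.logb 2 D * (2 * Real.logb 2 D)) :=
        mul_le_mul hlR (mul_le_mul hmR hmR (Nat.cast_nonneg _) (by positivity)) (by positivity)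
          (by positivity)
      have h4 := mul_le_mul_of_nonneg_left h3
        (by positivity : (0 : ℝ) ≤ 24 * (c + 9) + 32 * 777)
      have h5 : 0 ≤ Real.logb 2 D ^ 2 * Real.logb 2 N := by positivity
      have h6 := mul_nonneg (Nat.cast_nonneg (α := ℝ) c) h5
      nlinarith
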